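/- Let $d\ge 1$ and let $F(\mathbf w)=\sum_{\mathbf r\in\mathbb N^d}a_{\mathbf r}\mathbf w^{\mathbf r}$ be a power series converging in a neighborhood of the origin of $\mathbb C^d$. Let $\mathbf z\in\mathbb C^d$, and suppose that $F=G/H$ near the origin, where $G$ and $H$ are analytic in a neighborhood of the closed polydisk $D(\mathbf z)=\{\mathbf w:|w_j|\le|z_j|,\ 1\le j\le d\}$. Let $\mathcal V=\{H=0\}$ and write $H_j=\partial H/\partial z_j$, evaluated at $\mathbf z$. Assume that $\mathbf z$ is a strictly minimal simple pole, that is, $\mathcal V\cap D(\mathbf z)=\{\mathbf z\}$ and $\nabla H(\mathbf z)\neq 0$, and that $z_dH_d\ne0$. Let $g$ be the analytic function with $g(z_1,\dots,z_{d-1})=z_d$ such that, near $\mathbf z$, the set $\mathcal V$ is the graph $w_d=g(w_1,\dots,w_{d-1})$. Let $\mathbf{dir}(\mathbf z)$ be the class of nonzero complex multiples of $(z_1H_1,\dots,z_dH_d)$. For $\theta\in\mathbb R^{d-1}$ near $0$ put $$\tilde f(\theta)=\log\frac{g(z_1e^{i\theta_1},\dots,z_{d-1}e^{i\theta_{d-1}})}{g(z_1,\dots,z_{d-1})}+i\sum_{j=1}^{d-1}\frac{z_jH_j}{z_dH_d}\,\theta_j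 ;$$ here $z_jH_j/(z_dH_d)=r_j/r_d$ for every $\mathbf r\in\mathbf{dir}(\mathbf z)$. Suppose that the Hessian matrix of $\tilde f$ at $\theta=0$ is nonsingular. Let $l_0\in\mathbb N\cup\{\infty\}$ be the order to which $G$ vanishes on $\mathcal V$ near $\mathbf z$, that is, the largest $l$ with $G(\mathbf w)=O(|\mathbf w-\mathbf z|^l)$ as $\mathbf w\to\mathbf z$ in $\mathcal V$ (and $\infty$ if there is no largest one). Then there are complex constants $C_l$ such that, as $\mathbf r\to\infty$ in $\mathbb N^d\cap\mathbf{dir}(\mathbf z)$, $$a_{\mathbf r}\sim\mathbf z^{-\mathbf r}\sum_{l\ge l_0}C_l\,r_d^{(1-d-l)/2},$$ in the sense that for every $N\ge0$ $$a_{\mathbf r}-\mathbf z^{-\mathbf r}\sum_{l_0\le l\le N}C_l\,r_d^{(1-d-l)/2}=o\!\left(\left|\mathbf z^{-\mathbf r}\right|r_d^{(1-d-N)/2}\right).$$ If $G(\mathbf z)\ne0$, then $l_0=0$ and $$C_0=(2\pi)^{(1-d)/2}\,\mathcal H^{-1/2}\,\frac{G(\mathbf z)}{-z_dH_d},$$ where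 $\mathcal H$ is the determinant of the Hessian matrix of $\tilde f$ at $0$ and $\mathcal H^{-1/2}=\prod_j\mu_j^{-1/2}$, the product over the eigenvalues $\mu_j$ of that matrix with multiplicity, with the principal square root taken in each factor. -/

import Mathlib

open Filter Topology Asymptotics
open scoped Classical

/-!  Coefficient asymptotics of `F = G / H` at a smooth point of the pole set.
The number of variables is `d = n + 1`; the distinguished last coordinate is `Fin.last n`, and the
remaining coordinates are indexed by `Fin n` through `Fin.castSucc`. -/

namespace SmoothPoint

noncomputable section

/-- The monomial `z ^ r = z_1 ^ r_1 ⋯ z_d ^ r_d`. -/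
def monomial {d : ℕ} (z : Fin d → ℂ) (r : Fin d → ℕ) : ℂ := ∏ j, z j ^ r j

/-- The power series `∑ a_r w ^ r` converges (absolutely) to `F w` for all `w` near the origin. -/
def HasCoefficients {d : ℕ} (F : (Fin d → ℂ) → ℂ) (a : (Fin d → ℕ) → ℂ) : Prop :=
  ∀ᶠ w in 𝓝 (0 : Fin d → ℂ), HasSum (fun r => a r * monomial w r) (F w)

/-- The closed polydisk `D(z)`. -/
def polydisk {d : ℕ} (z : Fin d → ℂ) : Set (Fin d → ℂ) := {w | ∀ j, ‖w j‖ ≤ ‖z j‖}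

/-- The torus `T(z)`. -/
def torus {d : ℕ} (z : Fin d → ℂ) : Set (Fin d → ℂ) := {w | ∀ j, ‖w j‖ = ‖z j‖}

/-- The zero set `V` of `H`. -/
def variety {d : ℕ} (H : (Fin d → ℂ) → ℂ) : Set (Fin d → ℂ) := {w | H w = 0}

/-- `z` is a minimal point of `V`: it lies on `V`, and `V ∩ D(z) ⊆ T(z)`. -/
def IsMinimal {d : ℕ} (H : (Fin d → ℂ) → ℂ) (z : Fin d → ℂ) : Prop :=
  z ∈ variety H ∧ variety H ∩ polydisk z ⊆ torus z

/-- `z` is strictly minimal: minimal, and `V ∩ D(z)` has exactly one element. -/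
def IsStrictlyMinimal {d : ℕ} (H : (Fin d → ℂ) → ℂ) (z : Fin d → ℂ) : Prop :=
  IsMinimal H z ∧ (variety H ∩ polydisk z).encard = 1

/-- `z` is a simple pole of `G / H`, in the sense that `H` vanishes to order one: a zero of `H` at which the gradient of `H` is nonzero. -/
def IsSimplePole {d : ℕ} (H : (Fin d → ℂ) → ℂ) (z : Fin d → ℂ) : Prop :=
  z ∈ variety H ∧ fderiv ℂ H z ≠ 0

/-- The partial derivative `H_j` at `z`. -/
def partialDeriv {d : ℕ} (H : (Fin d → ℂ) → ℂ) (j : Fin d) (z : Fin d → ℂ) : ℂ :=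
  fderiv ℂ H z (Pi.single j 1)

/-- The integer vectors in `dir(z)`: the nonzero complex multiples of
`(z_1 H_1, …, z_d H_d)` that lie in `ℕ ^ d`. -/
def dir {d : ℕ} (H : (Fin d → ℂ) → ℂ) (z : Fin d → ℂ) : Set (Fin d → ℕ) :=
  {r | ∃ c : ℂ, c ≠ 0 ∧ ∀ j, (r j : ℂ) = c * (z j * partialDeriv H j z)}

/-- The order to which `G` vanishes on `V` near `z`: the largest `l` with
`G w = O(‖w - z‖ ^ l)` as `w → z` in `V` (it is `⊤` if there is no largest one). -/
def vanishingOrder {d : ℕ} (G H : (Fin d → ℂ) → ℂ) (z : Fin d → ℂ) : ℕ∞ :=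
  ⨆ l ∈ {l : ℕ | G =O[𝓝[variety H] z] fun w => ‖w - z‖ ^ l}, (l : ℕ∞)

variable {n : ℕ}

/-- `g` is an analytic parametrization `z_d = g(z_1, …, z_{d-1})` of `V` near `z`. -/
def IsParametrization (H : (Fin (n + 1) → ℂ) → ℂ) (z : Fin (n + 1) → ℂ)
    (g : (Fin n → ℂ) → ℂ) : Prop :=
  AnalyticAt ℂ g (fun j => z j.castSucc) ∧ g (fun j => z j.castSucc) = z (Fin.last n) ∧
    ∀ᶠ w in 𝓝 z, w ∈ variety H ↔ w (Fin.last n) = g fun j => w j.castSucc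

/-- The parametrization `g` of `V` near `z`. It exists if `H` is analytic at `z ∈ V` and
`H_d ≠ 0` there, and all choices agree near `(z_1, …, z_{d-1})`. -/
def parametrization (H : (Fin (n + 1) → ℂ) → ℂ) (z : Fin (n + 1) → ℂ) : (Fin n → ℂ) → ℂ :=
  Classical.epsilon (IsParametrization H z)

/-- The parametrization exists: `parametrization` is one. -/
theorem isParametrization_parametrization {H : (Fin (n + 1) → ℂ) → ℂ}
    {z : Fin (n + 1) → ℂ} (hH : AnalyticAt ℂ H z) (hz : z ∈ variety H)
    (hd : partialDeriv H (Fin.last n) z ≠ 0) :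
    IsParametrization H z (parametrization H z) := by
  apply Classical.epsilon_spec (p := IsParametrization H z)
  let L : (Fin n → ℂ) × ℂ →L[ℂ] (Fin (n + 1) → ℂ) := ContinuousLinearMap.pi
    (Fin.lastCases (ContinuousLinearMap.snd ℂ _ _)
      fun j => (ContinuousLinearMap.proj j).comp (ContinuousLinearMap.fst ℂ _ _))
  let P : (Fin (n + 1) → ℂ) → (Fin n → ℂ) × ℂ := fun w => (fun j => w j.castSucc, w (Fin.last n))
  have hP : Continuous P := by fun_prop
  have hLP : ∀ w, L (P w) = w := by
    intro w
    ext j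
    refine Fin.lastCases ?_ (fun j => ?_) j <;> simp [L, P]
  have hf : AnalyticAt ℂ (H ∘ L) (P z) :=
    AnalyticAt.comp (by rwa [hLP]) (L.analyticAt _)
  have hfd : fderiv ℂ (H ∘ L) (P z) = (fderiv ℂ H z).comp L := by
    rw [fderiv_comp _ (by rw [hLP]; exact hH.differentiableAt) L.differentiableAt, L.fderiv, hLP]
  have hL1 : L (0, 1) = Pi.single (Fin.last n) 1 := by
    ext j
    refine Fin.lastCases ?_ (fun j => ?_) j <;> simp [L]
  have hinv : (fderiv ℂ (H ∘ L) (P z) ∘L .inr ℂ (Fin n → ℂ) ℂ).IsInvertible := by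
    refine ⟨ContinuousLinearEquiv.unitsEquivAut ℂ (Units.mk0 _ hd), ?_⟩
    ext
    simp [hfd, hL1, partialDeriv]
  have cdf : ContDiffAt ℂ ⊤ (H ∘ L) (P z) := hf.contDiffAt
  refine ⟨cdf.implicitFunction (by simp) hinv,
    (cdf.contDiffAt_implicitFunction (by simp) hinv).analyticAt,
    cdf.implicitFunction_apply_self (by simp) hinv, ?_⟩
  have h := hP.continuousAt.eventually
    (cdf.eventually_apply_eq_iff_implicitFunction (by simp) hinv)
  have hz' : H z = 0 := hz
  filter_upwards [h] with w hw
  simp only [Function.comp_apply, hLP, hz'] at hw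
  exact hw.trans eq_comm

/-- The map `M(θ) = (z_1 e ^ (i θ_1), …, z_{d-1} e ^ (i θ_{d-1}))`. -/
def torusMap (z : Fin (n + 1) → ℂ) (θ : Fin n → ℝ) : Fin n → ℂ :=
  fun j => z j.castSucc * Complex.exp (Complex.I * θ j)

/-- The phase `f̃(θ) = log (g (M θ) / g (M 0)) + i ∑_{j < d} (r_j / r_d) θ_j` for `r ∈ dir(z)`;
for all such `r` the ratio `r_j / r_d` is `z_j H_j / (z_d H_d)`. -/
def phase (H : (Fin (n + 1) → ℂ) → ℂ) (z : Fin (n + 1) → ℂ) (θ : Fin n → ℝ) : ℂ :=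
  Complex.log (parametrization H z (torusMap z θ) / parametrization H z (torusMap z 0)) +
    Complex.I * ∑ j : Fin n,
      (z j.castSucc * partialDeriv H j.castSucc z) /
        (z (Fin.last n) * partialDeriv H (Fin.last n) z) * (θ j : ℂ)

/-- The Hessian (matrix of second partial derivatives) at `x` of a function on `ℝ ^ n`. -/
def hessian (f : (Fin n → ℝ) → ℂ) (x : Fin n → ℝ) : Matrix (Fin n) (Fin n) ℂ :=
  Matrix.of fun i j => fderiv ℝ (fun y => fderiv ℝ f y (Pi.single j 1)) x (Pi.single i 1)

/-- The inverse square root of `det A` given by `∏ μ ^ (-1/2)`, where `μ` runs through the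
eigenvalues of `A` with multiplicity and each square root is the principal one. -/
def invSqrtDet (A : Matrix (Fin n) (Fin n) ℂ) : ℂ :=
  (A.charpoly.roots.map fun μ => μ ^ (-(1 / 2) : ℂ)).prod

end

end SmoothPoint

namespace SmoothPoint

noncomputable section

open MeasureTheory Metric
open scoped ContDiff Matrix

variable {n : ℕ}

section

/-! ### Smooth dependence of integrals on parameters -/

/-! Multiply the coefficient by its monomial and write it as an average over a torus: a circle
integral in the last variable, then an integral over the remaining angles `θ`. The power series is
only known to converge near the origin, so the formula is carried to the large torus by analytic
continuation in a scaling parameter `τ`, from `τ` near `0` to `τ = 1` (`integral_torusPoint_eq`).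
Take the last radius `ρ` below `|z_d|`, the other radii equal to `|z_j|`, and push the inner circle
slightly beyond `|z_d|`. For `θ` away from `0`, strict minimality leaves no pole in the way. For `θ`
near `0` the single simple pole `t = g(M θ)` is crossed and contributes a residue. All other terms
are smaller than the main one by a factor `q ^ r_d` with `q < 1`, uniformly in `θ` by compactness
(`exists_coefficient_sub_integral_le`). For `r` in `dir(z)` the character and the power of `g`
combine into `exp (-r_d f̃(θ))`, so that `a_r z ^ r` is, up to this error, a Laplace integral with
large parameter `L = r_d`, phase `f̃` and amplitude `-residue / g`, divided by `(2π) ^ n`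
(`exists_coefficient_sub_laplace_le`).

The phase has a critical point at `0`: the linear term in `f̃` cancels the logarithmic derivative of
`g`. Its real part is `log (|g(M θ)| / |z_d|)`, since the slopes are ratios `r_j / r_d` and hence
real, and strict minimality makes it positive for small `θ ≠ 0` (`eventually_re_phase_pos`).

The Laplace integral (`exists_laplace_expansion`) is expanded without a Morse lemma or a change of
contour. Join the phase linearly to the standard form `|x|² / 2`, giving phases `F(s, ·)` for `s` in
`[0, 1]`. Hadamard's lemma, applied to the gradient of `F`, writes it as an invertible matrix times
`x`; inverting that matrix expresses `u - u(0)` as a smooth combination of the `∂_k F`. One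
integration by parts then turns `∫ (u - u(0)) exp (-L F)` into `1 / L` times an integral with a new
amplitude `transport u`, up to exponentially small terms. Iteration reduces every amplitude to the
amplitude `1` (`PhaseFamily.osc_expansion`).

For amplitude `1`, the derivative of the integral in `s` is `-L` times the integral with amplitude
`∂_s F`. This vanishes at the origin, so the same expansion gives an approximate linear equation `y'
= -a(s) y` with `a` a polynomial in `1 / L`. Solving it from the Gaussian at `s = 0` to `s = 1`
yields the exponential of a polynomial in `1 / L` times the Gaussian, with an error of any
prescribed order (`PhaseFamily.osc_one_sub_exp_mul_le`).

The constant term of `a` is half the logarithmic derivative of the determinant along the segment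
from the identity to the Hessian. The eigenvalues of the Hessian are nonzero with nonnegative real
part, so the factors `1 - s + s μ` stay in the slit plane, and integration produces the product of
the principal values `μ ^ (-1/2)` (`exp_neg_integral_trace`).

Finally, the amplitude vanishes at `0` at least to every order to which `G` is known to vanish on
`V`, and each `transport` costs at most two orders. This kills the coefficients below `l_0`. Only
integer powers of `1 / L` occur besides the Gaussian factor, so the odd-indexed constants can be
taken to be `0`. -/

/-- Differentiation under the integral sign. The closed unit ball around `x` is compact because `E`
is proper, so the derivative is bounded on its product with `K`, and a constant serves as the
dominating function. -/
theorem hasFDerivAt_setIntegral {E Y F : Type} [NormedAddCommGroup E] [NormedSpace ℝ E]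
    [ProperSpace E] [NormedAddCommGroup Y] [NormedSpace ℝ Y] [MeasurableSpace Y]
    [BorelSpace Y] [SecondCountableTopology Y]
    [NormedAddCommGroup F] [NormedSpace ℝ F] [CompleteSpace F]
    (μ : Measure Y) [IsFiniteMeasureOnCompacts μ] {K : Set Y} (hK : IsCompact K)
    {u : E × Y → F} (hu : ContDiff ℝ 1 u) (x : E) :
    HasFDerivAt (fun x => ∫ y in K, u (x, y) ∂μ)
      (∫ y in K, (fderiv ℝ u (x, y)).comp (.inl ℝ E Y) ∂μ) x := by
  have hc : Continuous fun p : E × Y => (fderiv ℝ u p).comp (.inl ℝ E Y) :=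
    (hu.continuous_fderiv (by simp)).clm_comp continuous_const
  obtain ⟨C, hC⟩ := ((isCompact_closedBall x 1).prod hK).exists_bound_of_continuousOn
    hc.continuousOn
  have hfin : μ K ≠ ⊤ := hK.measure_lt_top.ne
  refine hasFDerivAt_integral_of_dominated_of_fderiv_le (bound := fun _ => C)
    (F' := fun x y => (fderiv ℝ u (x, y)).comp (.inl ℝ E Y))
    (closedBall_mem_nhds x one_pos) ?_ ?_ ?_ ?_ ?_ ?_
  · exact .of_forall fun x =>
      (hu.continuous.comp (by fun_prop : Continuous fun y => (x, y))).continuousOn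
        |>.aestronglyMeasurable_of_isCompact hK hK.measurableSet
  · exact (hu.continuous.comp (by fun_prop : Continuous fun y => (x, y))).continuousOn
        |>.integrableOn_compact hK
  · exact (hc.comp (by fun_prop : Continuous fun y => (x, y))).continuousOn
        |>.aestronglyMeasurable_of_isCompact hK hK.measurableSet
  · refine (ae_restrict_mem hK.measurableSet).mono fun y hy x' hx' => hC (x', y) ⟨hx', hy⟩
  · exact integrableOn_const hfin
  · refine .of_forall fun y x' _ => ?_
    have h1 : HasFDerivAt (fun x' : E => (x', y)) (.inl ℝ E Y) x' := by
      simpa using hasFDerivAt_prodMk_left (𝕜 := ℝ) x' y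
    exact ((hu.differentiable (by simp)) (x', y)).hasFDerivAt.comp x' h1

/-- Induction on the order of differentiability. The target space is generalized in the induction
because the derivative is again such an integral, with values in continuous linear maps. -/
theorem contDiff_setIntegral {E Y F : Type} [NormedAddCommGroup E] [NormedSpace ℝ E]
    [ProperSpace E] [NormedAddCommGroup Y] [NormedSpace ℝ Y] [MeasurableSpace Y]
    [BorelSpace Y] [SecondCountableTopology Y]
    [NormedAddCommGroup F] [NormedSpace ℝ F] [CompleteSpace F]
    (μ : Measure Y) [IsFiniteMeasureOnCompacts μ] {K : Set Y} (hK : IsCompact K)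
    {u : E × Y → F} (hu : ContDiff ℝ ∞ u) :
    ContDiff ℝ ∞ fun x => ∫ y in K, u (x, y) ∂μ := by
  have key : ∀ m : ℕ, ∀ {F : Type} [NormedAddCommGroup F] [NormedSpace ℝ F] [CompleteSpace F]
      {u : E × Y → F}, ContDiff ℝ ∞ u → ContDiff ℝ m fun x => ∫ y in K, u (x, y) ∂μ := by
    intro m
    induction m with
    | zero =>
      intro F _ _ _ u hu
      have hu1 : ContDiff ℝ 1 u := hu.of_le (by norm_cast)
      exact contDiff_zero.2 (continuous_iff_continuousAt.2 fun x =>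
        (hasFDerivAt_setIntegral μ hK hu1 x).continuousAt)
    | succ m ih =>
      intro F _ _ _ u hu
      have hu1 : ContDiff ℝ 1 u := hu.of_le (by norm_cast)
      have hd := hasFDerivAt_setIntegral μ hK hu1
      refine (contDiff_succ_iff_fderiv (n := m)).2 ⟨fun x => (hd x).differentiableAt, by simp, ?_⟩
      have : fderiv ℝ (fun x => ∫ y in K, u (x, y) ∂μ) =
          fun x => ∫ y in K, (fderiv ℝ u (x, y)).comp (.inl ℝ E Y) ∂μ :=
        funext fun x => (hd x).fderiv
      rw [this]
      exact ih (u := fun p => (fderiv ℝ u p).comp (.inl ℝ E Y))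
        ((hu.fderiv_right (m := ∞) (by simp)).clm_comp contDiff_const)
  exact contDiff_infty.2 fun m => key m hu

/-- The partial derivative in the `j`-th space variable of a function of a parameter `s` and a
point `x`. -/
def partialX (j : Fin n) (u : ℝ × (Fin n → ℝ) → ℂ) (p : ℝ × (Fin n → ℝ)) : ℂ :=
  fderiv ℝ u p (0, Pi.single j 1)

/-- The weighted mean of `u (s, ·)` along the segment from the origin to `x`. -/
def radialMean (k : ℕ) (u : ℝ × (Fin n → ℝ) → ℂ) (p : ℝ × (Fin n → ℝ)) : ℂ :=
  ∫ t in Set.Icc (0 : ℝ) 1, (t : ℂ) ^ k * u (p.1, t • p.2)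

theorem contDiff_partialX {u : ℝ × (Fin n → ℝ) → ℂ} (hu : ContDiff ℝ ∞ u) (j : Fin n) :
    ContDiff ℝ ∞ (partialX j u) :=
  (hu.fderiv_right (m := ∞) (by simp)).clm_apply contDiff_const

theorem contDiff_radialMean_integrand {u : ℝ × (Fin n → ℝ) → ℂ} (hu : ContDiff ℝ ∞ u) (k : ℕ) :
    ContDiff ℝ ∞ fun q : (ℝ × (Fin n → ℝ)) × ℝ => (q.2 : ℂ) ^ k * u (q.1.1, q.2 • q.1.2) :=
  ((Complex.ofRealCLM.contDiff.comp contDiff_snd).pow k).mul (hu.comp (by fun_prop))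

theorem contDiff_radialMean {u : ℝ × (Fin n → ℝ) → ℂ} (hu : ContDiff ℝ ∞ u) (k : ℕ) :
    ContDiff ℝ ∞ (radialMean k u) :=
  contDiff_setIntegral volume isCompact_Icc (contDiff_radialMean_integrand hu k)

/-- The chain rule for `x ↦ u (s, t • x)` brings out one factor `t`. This is why the means carry a
weight `t ^ k`: the family is closed under differentiation. -/
theorem partialX_radialMean {u : ℝ × (Fin n → ℝ) → ℂ} (hu : ContDiff ℝ ∞ u) (k : ℕ) (j : Fin n) :
    partialX j (radialMean k u) = radialMean (k + 1) (partialX j u) := by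
  ext p
  have hi := (contDiff_radialMean_integrand hu k).of_le
    (show (1 : WithTop ℕ∞) ≤ ∞ by norm_cast)
  have h := hasFDerivAt_setIntegral volume (isCompact_Icc (a := (0 : ℝ)) (b := 1)) hi p
  unfold partialX
  rw [show radialMean k u = fun x => ∫ t in Set.Icc (0 : ℝ) 1, (t : ℂ) ^ k * u (x.1, t • x.2)
    from rfl, h.fderiv, ContinuousLinearMap.integral_apply, radialMean]
  swap
  · exact (((hi.continuous_fderiv (by simp)).clm_comp continuous_const).comp
      (by fun_prop : Continuous fun y : ℝ => (p, y))).continuousOn.integrableOn_compact isCompact_Icc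
  congr 1
  ext t
  have h1 : HasFDerivAt (fun x : ℝ × (Fin n → ℝ) => (t : ℂ) ^ k * u (x.1, t • x.2))
      ((t : ℂ) ^ k • (fderiv ℝ u (p.1, t • p.2)).comp
        ((ContinuousLinearMap.fst ℝ _ _).prod (t • ContinuousLinearMap.snd ℝ _ _))) p := by
    refine HasFDerivAt.const_mul ?_ _
    refine HasFDerivAt.comp p (hu.differentiable (by simp) _).hasFDerivAt ?_
    exact hasFDerivAt_fst.prodMk (hasFDerivAt_snd.const_smul t)
  have h2 : HasFDerivAt (fun x : ℝ × (Fin n → ℝ) => (t : ℂ) ^ k * u (x.1, t • x.2))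
      ((fderiv ℝ (fun q : (ℝ × (Fin n → ℝ)) × ℝ => (q.2 : ℂ) ^ k * u (q.1.1, q.2 • q.1.2))
        (p, t)).comp (.inl ℝ _ _)) p := by
    have h3 : HasFDerivAt (fun x' : ℝ × (Fin n → ℝ) => (x', t)) (.inl ℝ _ ℝ) p := by
      simpa using hasFDerivAt_prodMk_left (𝕜 := ℝ) p t
    exact ((hi.differentiable (by simp)) (p, t)).hasFDerivAt.comp p h3
  rw [h2.unique h1]
  have : ((0 : ℝ), t • (Pi.single j 1 : Fin n → ℝ)) = t • (0, Pi.single j 1) := by simp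
  simp only [_root_.smul_apply, ContinuousLinearMap.comp_apply,
    ContinuousLinearMap.prod_apply, ContinuousLinearMap.coe_fst', ContinuousLinearMap.coe_snd',
    smul_eq_mul]
  rw [this, map_smul, pow_succ, Complex.real_smul]
  ring

/-- The divisor is `1 / ∫ t ^ k`. Its value `2` at `k = 1` is the source of the factor `1 / 2` in
the quadratic term of a phase and in the trace formula for the leading coefficient. -/
theorem radialMean_zero (k : ℕ) (u : ℝ × (Fin n → ℝ) → ℂ) (s : ℝ) :
    radialMean k u (s, 0) = u (s, 0) / (k + 1) := by
  have : ∫ t in Set.Icc (0 : ℝ) 1, (t : ℂ) ^ k = 1 / (k + 1) := by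
    rw [integral_Icc_eq_integral_Ioc, ← intervalIntegral.integral_of_le zero_le_one]
    have := integral_pow (a := 0) (b := 1) k
    rw [← Complex.ofReal_inj, ← intervalIntegral.integral_ofReal] at this
    simpa using this
  simp only [radialMean, smul_zero]
  rw [integral_mul_const, this]
  ring

/-- Hadamard's lemma. -/
theorem sub_eq_sum_mul_radialMean {u : ℝ × (Fin n → ℝ) → ℂ} (hu : ContDiff ℝ ∞ u) (s : ℝ)
    (x : Fin n → ℝ) :
    u (s, x) - u (s, 0) = ∑ j, (x j : ℂ) * radialMean 0 (partialX j u) (s, x) := by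
  -- Integrate the derivative of `u` along the segment from the origin to `x`.
  have hd : ∀ t : ℝ, HasDerivAt (fun t : ℝ => u (s, t • x))
      (∑ j, (x j : ℂ) * partialX j u (s, t • x)) t := by
    intro t
    have h1 : HasDerivAt (fun t : ℝ => (s, t • x)) ((0 : ℝ), x) t := by
      have := (hasDerivAt_id t).smul_const x
      simp only [id, one_smul] at this
      exact (hasDerivAt_const t s).prodMk this
    have h2 := (hu.differentiable (by simp) (s, t • x)).hasFDerivAt.comp_hasDerivAt t h1
    refine h2.congr_deriv ?_
    have h3 : ((0 : ℝ), x) = ∑ j, x j • ((0 : ℝ), (Pi.single j 1 : Fin n → ℝ)) := by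
      ext i
      · simp [Prod.fst_sum]
      · simp [Prod.snd_sum, Finset.sum_apply, Pi.single_apply]
    rw [h3, map_sum]
    refine Finset.sum_congr rfl fun j _ => ?_
    rw [map_smul, Complex.real_smul, partialX]
  have hcont : ∀ j, Continuous fun t : ℝ => partialX j u (s, t • x) := fun j =>
    (contDiff_partialX hu j).continuous.comp (by fun_prop)
  have h := intervalIntegral.integral_eq_sub_of_hasDerivAt (a := 0) (b := 1)
    (fun t _ => hd t)
    ((continuous_finsetSum _ fun j _ => continuous_const.mul (hcont j)).intervalIntegrable _ _)
  simp only [one_smul, zero_smul] at h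
  rw [← h, intervalIntegral.integral_finsetSum]
  · refine Finset.sum_congr rfl fun j _ => ?_
    rw [intervalIntegral.integral_const_mul, radialMean, integral_Icc_eq_integral_Ioc,
      ← intervalIntegral.integral_of_le zero_le_one]
    simp
  · exact fun j _ => (continuous_const.mul (hcont j)).intervalIntegrable _ _

end

/-! ### Oscillatory integrals for a family of phases: integration by parts -/

section

/-- One term of the exponential series, `(c L) ^ N / N! ≤ exp (c L)`. It lets exponentially small
errors be absorbed into any order of the expansion. -/
theorem exp_neg_mul_le_inv_pow {c : ℝ} (hc : 0 < c) (N : ℕ) :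
    ∃ C : ℝ, 0 ≤ C ∧ ∀ L : ℝ, 1 ≤ L → Real.exp (-(c * L)) ≤ C * L⁻¹ ^ N := by
  refine ⟨N.factorial / c ^ N, by positivity, fun L hL => ?_⟩
  have hL0 : 0 < L := by linarith
  have h := Real.pow_div_factorial_le_exp (c * L) (by positivity) N
  rw [Real.exp_neg, inv_pow, div_mul_eq_mul_div, ← div_eq_mul_inv, div_div]
  rw [mul_pow] at h
  rw [inv_le_comm₀ (Real.exp_pos _) (by positivity)]
  rwa [inv_div, mul_comm (L ^ N)]

theorem contDiff_slice {u : ℝ × (Fin n → ℝ) → ℂ} (hu : ContDiff ℝ ∞ u) (s : ℝ) :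
    ContDiff ℝ ∞ fun x => u (s, x) :=
  hu.comp (by fun_prop)

theorem fderiv_slice {u : ℝ × (Fin n → ℝ) → ℂ} (hu : ContDiff ℝ ∞ u) (s : ℝ) (x : Fin n → ℝ)
    (j : Fin n) : fderiv ℝ (fun x => u (s, x)) x (Pi.single j 1) = partialX j u (s, x) := by
  have h : HasFDerivAt (fun x => u (s, x)) ((fderiv ℝ u (s, x)).comp (.inr ℝ ℝ (Fin n → ℝ))) x := by
    have h1 : HasFDerivAt (fun x : Fin n → ℝ => (s, x)) (.inr ℝ ℝ (Fin n → ℝ)) x := by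
      simpa using hasFDerivAt_prodMk_right (𝕜 := ℝ) s x
    exact (hu.differentiable (by simp) (s, x)).hasFDerivAt.comp x h1
  rw [h.fderiv]
  simp [partialX]

/-- A family of phase functions on a ball, nonnegative in real part, whose only critical point is
the origin; the field `W` expresses the coordinates as combinations of the partial derivatives. -/
structure PhaseFamily (n : ℕ) where
  F : ℝ × (Fin n → ℝ) → ℂ
  W : Fin n → Fin n → ℝ × (Fin n → ℝ) → ℂ
  radius : ℝ
  gap : ℝ
  contDiff_F : ContDiff ℝ ∞ F
  contDiff_W : ∀ j k, ContDiff ℝ ∞ (W j k)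
  radius_pos : 0 < radius
  gap_pos : 0 < gap
  sum_W_mul : ∀ s ∈ Set.Icc (0 : ℝ) 1, ∀ x, ‖x‖ ≤ radius → ∀ j,
    ∑ k, W j k (s, x) * partialX k F (s, x) = x j
  re_nonneg : ∀ s ∈ Set.Icc (0 : ℝ) 1, ∀ x, ‖x‖ ≤ radius → 0 ≤ (F (s, x)).re
  gap_le_re : ∀ s ∈ Set.Icc (0 : ℝ) 1, ∀ x, radius / 2 ≤ ‖x‖ → ‖x‖ ≤ radius → gap ≤ (F (s, x)).re
  F_zero : ∀ s, F (s, 0) = 0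

namespace PhaseFamily

variable (P : PhaseFamily n)

/-- A cutoff function, equal to `1` on the ball of half the radius. -/
def bump : ContDiffBump (0 : Fin n → ℝ) :=
  ⟨P.radius / 2, P.radius, half_pos P.radius_pos, half_lt_self P.radius_pos⟩

def cutoff (x : Fin n → ℝ) : ℂ := (P.bump x : ℂ)

theorem contDiff_cutoff : ContDiff ℝ ∞ P.cutoff :=
  Complex.ofRealCLM.contDiff.comp P.bump.contDiff

theorem cutoff_eq_zero {x : Fin n → ℝ} (hx : P.radius ≤ ‖x‖) : P.cutoff x = 0 := by
  simp [cutoff, P.bump.zero_of_le_dist (x := x) (by simpa [bump] using hx)]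

theorem cutoff_eq_one {x : Fin n → ℝ} (hx : ‖x‖ ≤ P.radius / 2) : P.cutoff x = 1 := by
  simp [cutoff, P.bump.one_of_mem_closedBall (x := x) (by simpa [bump] using hx)]

theorem norm_cutoff_le (x : Fin n → ℝ) : ‖P.cutoff x‖ ≤ 1 := by
  rw [cutoff, Complex.norm_real, Real.norm_of_nonneg P.bump.nonneg]
  exact P.bump.le_one

theorem hasCompactSupport_cutoff : HasCompactSupport P.cutoff :=
  P.bump.hasCompactSupport.comp_left (g := fun y : ℝ => (y : ℂ)) (by simp)

theorem fderiv_cutoff_eq_zero {x : Fin n → ℝ} (hx : ¬ (P.radius / 2 ≤ ‖x‖ ∧ ‖x‖ ≤ P.radius)) :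
    fderiv ℝ P.cutoff x = 0 := by
  rcases not_and_or.1 hx with h | h
  · have : P.cutoff =ᶠ[𝓝 x] fun _ => 1 := by
      filter_upwards [(continuous_norm.tendsto x).eventually_lt_const (not_le.1 h)] with y hy
      exact P.cutoff_eq_one hy.le
    rw [this.fderiv_eq]; simp
  · have : P.cutoff =ᶠ[𝓝 x] fun _ => 0 := by
      filter_upwards [(continuous_norm.tendsto x).eventually_const_lt (not_le.1 h)] with y hy
      exact P.cutoff_eq_zero hy.le
    rw [this.fderiv_eq]; simp

/-- The oscillatory integral with amplitude `u`. -/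
def osc (u : ℝ × (Fin n → ℝ) → ℂ) (s L : ℝ) : ℂ :=
  ∫ x, P.cutoff x * u (s, x) * Complex.exp (-(L * P.F (s, x)))

/-- The components of the vector field by which one integrates by parts. -/
def field (u : ℝ × (Fin n → ℝ) → ℂ) (k : Fin n) (p : ℝ × (Fin n → ℝ)) : ℂ :=
  ∑ j, radialMean 0 (partialX j u) p * P.W j k p

/-- The amplitude produced by one integration by parts. -/
def transport (u : ℝ × (Fin n → ℝ) → ℂ) (p : ℝ × (Fin n → ℝ)) : ℂ :=
  ∑ k, partialX k (P.field u k) p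

theorem contDiff_field {u : ℝ × (Fin n → ℝ) → ℂ} (hu : ContDiff ℝ ∞ u) (k : Fin n) :
    ContDiff ℝ ∞ (P.field u k) :=
  ContDiff.sum fun j _ => (contDiff_radialMean (contDiff_partialX hu j) 0).mul (P.contDiff_W j k)

theorem contDiff_transport {u : ℝ × (Fin n → ℝ) → ℂ} (hu : ContDiff ℝ ∞ u) :
    ContDiff ℝ ∞ (P.transport u) :=
  ContDiff.sum fun k _ => contDiff_partialX (P.contDiff_field hu k) k

theorem contDiff_iterate_transport {u : ℝ × (Fin n → ℝ) → ℂ} (hu : ContDiff ℝ ∞ u) (k : ℕ) :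
    ContDiff ℝ ∞ (P.transport^[k] u) := by
  induction k generalizing u with
  | zero => exact hu
  | succ k ih => exact ih (P.contDiff_transport hu)

/-- Contract Hadamard's lemma for `u` with `sum_W_mul`, which replaces each coordinate `x j` by a
combination of the `∂_k F`. The critical point causes no division by zero because `u - u(0)`
vanishes there too. -/
theorem sum_field_mul {u : ℝ × (Fin n → ℝ) → ℂ} (hu : ContDiff ℝ ∞ u) {s : ℝ}
    (hs : s ∈ Set.Icc (0 : ℝ) 1) {x : Fin n → ℝ} (hx : ‖x‖ ≤ P.radius) :
    ∑ k, P.field u k (s, x) * partialX k P.F (s, x) = u (s, x) - u (s, 0) := by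
  rw [sub_eq_sum_mul_radialMean hu]
  simp only [field, Finset.sum_mul]
  rw [Finset.sum_comm]
  refine Finset.sum_congr rfl fun j _ => ?_
  rw [← P.sum_W_mul s hs x hx j, Finset.sum_mul]
  exact Finset.sum_congr rfl fun k _ => by ring

theorem contDiff_exp_phase (s L : ℝ) :
    ContDiff ℝ ∞ fun x => Complex.exp (-(L * P.F (s, x))) :=
  Complex.contDiff_exp.comp (contDiff_const.mul (contDiff_slice P.contDiff_F s)).neg

theorem fderiv_exp_phase (s L : ℝ) (x : Fin n → ℝ) (k : Fin n) :
    fderiv ℝ (fun x => Complex.exp (-(L * P.F (s, x)))) x (Pi.single k 1) =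
      -(L * partialX k P.F (s, x) * Complex.exp (-(L * P.F (s, x)))) := by
  have h : HasFDerivAt (fun x => -(L * P.F (s, x)))
      (-((L : ℂ) • fderiv ℝ (fun x => P.F (s, x)) x)) x :=
    (((contDiff_slice P.contDiff_F s).differentiable (by simp) x).hasFDerivAt.const_mul (L : ℂ)).neg
  rw [h.cexp.fderiv]
  simp only [_root_.smul_apply, _root_.neg_apply, fderiv_slice P.contDiff_F]
  simp only [smul_eq_mul]
  ring

/-- `L ∂_k F exp (-L F)` is minus the `k`-th derivative of `exp (-L F)`. The cutoff has compact
support, so no boundary term arises; the derivative falls either on `v` or on the cutoff. -/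
theorem integral_cutoff_mul_partialX {v : ℝ × (Fin n → ℝ) → ℂ} (hv : ContDiff ℝ ∞ v) (k : Fin n)
    (s L : ℝ) :
    L * ∫ x, P.cutoff x * (v (s, x) * partialX k P.F (s, x)) * Complex.exp (-(L * P.F (s, x))) =
      P.osc (partialX k v) s L + ∫ x, fderiv ℝ P.cutoff x (Pi.single k 1) * v (s, x) *
        Complex.exp (-(L * P.F (s, x))) := by
  have hv' := contDiff_slice hv s
  have hχv : ContDiff ℝ ∞ fun x => P.cutoff x * v (s, x) := P.contDiff_cutoff.mul hv'
  have hcs : HasCompactSupport fun x => P.cutoff x * v (s, x) := P.hasCompactSupport_cutoff.mul_right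
  have he := P.contDiff_exp_phase s L
  have hfc : Continuous fun x => fderiv ℝ P.cutoff x (Pi.single k 1) :=
    (P.contDiff_cutoff.continuous_fderiv (by simp)).clm_apply continuous_const
  have hfs : HasCompactSupport fun x => fderiv ℝ P.cutoff x (Pi.single k 1) :=
    P.hasCompactSupport_cutoff.fderiv_apply (𝕜 := ℝ) _
  have hd : ∀ x, fderiv ℝ (fun x => P.cutoff x * v (s, x)) x (Pi.single k 1) =
      P.cutoff x * partialX k v (s, x) + fderiv ℝ P.cutoff x (Pi.single k 1) * v (s, x) := by
    intro x
    rw [fderiv_fun_mul (P.contDiff_cutoff.differentiable (by simp) x)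
      (hv'.differentiable (by simp) x)]
    simp only [_root_.add_apply, _root_.smul_apply, smul_eq_mul, fderiv_slice hv]
    ring
  have key := integral_mul_fderiv_eq_neg_fderiv_mul_of_integrable (𝕜 := ℂ)
    (μ := (volume : Measure (Fin n → ℝ)))
    (f := fun x => P.cutoff x * v (s, x)) (g := fun x => Complex.exp (-(L * P.F (s, x))))
    (v := Pi.single k 1)
    ((((hχv.continuous_fderiv (by simp)).clm_apply continuous_const).mul
      he.continuous).integrable_of_hasCompactSupport (hcs.fderiv_apply (𝕜 := ℝ) _).mul_right)
    ((hχv.continuous.mul ((he.continuous_fderiv (by simp)).clm_apply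
      continuous_const)).integrable_of_hasCompactSupport hcs.mul_right)
    ((hχv.continuous.mul he.continuous).integrable_of_hasCompactSupport hcs.mul_right)
    (fun x _ => hχv.differentiable (by simp) x) (fun x _ => he.differentiable (by simp) x)
  simp only [fderiv_exp_phase, hd] at key
  rw [osc, ← integral_add, ← integral_const_mul]
  · rw [← neg_inj, ← integral_neg]
    convert key using 1
    · exact integral_congr_ae (.of_forall fun x => by ring)
    · exact congrArg _ (integral_congr_ae (.of_forall fun x => by ring))
  · exact ((P.contDiff_cutoff.continuous.mul (contDiff_slice (contDiff_partialX hv k)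
      s).continuous).mul he.continuous).integrable_of_hasCompactSupport
        (P.hasCompactSupport_cutoff.mul_right.mul_right)
  · exact ((hfc.mul hv'.continuous).mul he.continuous).integrable_of_hasCompactSupport
      (hfs.mul_right.mul_right)

/-- The amplitude of the boundary contribution of one integration by parts. -/
def edge (u : ℝ × (Fin n → ℝ) → ℂ) (p : ℝ × (Fin n → ℝ)) : ℂ :=
  ∑ k, fderiv ℝ P.cutoff p.2 (Pi.single k 1) * P.field u k p

theorem continuous_edge {u : ℝ × (Fin n → ℝ) → ℂ} (hu : ContDiff ℝ ∞ u) :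
    Continuous (P.edge u) :=
  continuous_finsetSum _ fun k _ =>
    ((((P.contDiff_cutoff.continuous_fderiv (by simp)).comp continuous_snd).clm_apply
      continuous_const)).mul (P.contDiff_field hu k).continuous

theorem integrable_cutoff_mul {u : ℝ × (Fin n → ℝ) → ℂ} (hu : ContDiff ℝ ∞ u) (s L : ℝ) :
    Integrable fun x => P.cutoff x * u (s, x) * Complex.exp (-(L * P.F (s, x))) :=
  ((P.contDiff_cutoff.continuous.mul (contDiff_slice hu s).continuous).mul
    (P.contDiff_exp_phase s L).continuous).integrable_of_hasCompactSupport
      (P.hasCompactSupport_cutoff.mul_right.mul_right)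

/-- The basic recursion, an exact identity: write `u - u(0)` as `∑ V_k ∂_k F` on the support of the
cutoff and integrate each term by parts. The right side carries no factor `L`, so one power of `1 /
L` is gained. -/
theorem osc_sub {u : ℝ × (Fin n → ℝ) → ℂ} (hu : ContDiff ℝ ∞ u) {s : ℝ}
    (hs : s ∈ Set.Icc (0 : ℝ) 1) (L : ℝ) :
    L * (P.osc u s L - u (s, 0) * P.osc 1 s L) =
      P.osc (P.transport u) s L + ∫ x, P.edge u (s, x) * Complex.exp (-(L * P.F (s, x))) := by
  have h1 : P.osc u s L - u (s, 0) * P.osc 1 s L = ∑ k, ∫ x, P.cutoff x *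
      (P.field u k (s, x) * partialX k P.F (s, x)) * Complex.exp (-(L * P.F (s, x))) := by
    rw [osc, osc, ← integral_const_mul, ← integral_sub (P.integrable_cutoff_mul hu s L),
      ← integral_finsetSum]
    · refine integral_congr_ae (.of_forall fun x => ?_)
      simp only [Pi.one_apply, mul_one]
      rw [← Finset.sum_mul, ← Finset.mul_sum]
      by_cases hx : ‖x‖ ≤ P.radius
      · rw [P.sum_field_mul hu hs hx]; ring
      · rw [P.cutoff_eq_zero (not_le.1 hx).le]; ring
    · exact fun k _ => P.integrable_cutoff_mul
        ((P.contDiff_field hu k).mul (contDiff_partialX P.contDiff_F k)) s L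
    · exact (P.integrable_cutoff_mul (u := 1) contDiff_const s L).const_mul _
  rw [h1, Finset.mul_sum, Finset.sum_congr rfl fun k _ =>
    P.integral_cutoff_mul_partialX (P.contDiff_field hu k) k s L, Finset.sum_add_distrib]
  congr 1
  · simp only [osc]
    rw [← integral_finsetSum]
    · refine integral_congr_ae (.of_forall fun x => ?_)
      simp only [transport]
      rw [← Finset.sum_mul, ← Finset.mul_sum]
    · exact fun k _ => P.integrable_cutoff_mul (contDiff_partialX (P.contDiff_field hu k) k) s L
  · rw [← integral_finsetSum]
    · refine integral_congr_ae (.of_forall fun x => ?_)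
      simp only [edge]
      rw [← Finset.sum_mul]
    · intro k _
      exact ((((P.contDiff_cutoff.continuous_fderiv (by simp)).clm_apply continuous_const).mul
        (contDiff_slice (P.contDiff_field hu k) s).continuous).mul
        (P.contDiff_exp_phase s L).continuous).integrable_of_hasCompactSupport
        (P.hasCompactSupport_cutoff.fderiv_apply (𝕜 := ℝ) _).mul_right.mul_right

/-- Used with `c = 0` on the whole ball, for boundedness of the integrals, and with `c` the gap on
the outer shell, for exponential decay. The constant does not depend on `s`, which the differential
equation in `s` will require. -/
theorem norm_integral_mul_exp_le {b : ℝ × (Fin n → ℝ) → ℂ} (hb : Continuous b)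
    {K : Set (Fin n → ℝ)} (hK : IsCompact K) {c : ℝ}
    (hb0 : ∀ s ∈ Set.Icc (0 : ℝ) 1, ∀ x ∉ K, b (s, x) = 0)
    (hF : ∀ s ∈ Set.Icc (0 : ℝ) 1, ∀ x ∈ K, c ≤ (P.F (s, x)).re) :
    ∃ C : ℝ, 0 ≤ C ∧ ∀ s ∈ Set.Icc (0 : ℝ) 1, ∀ L : ℝ, 0 ≤ L →
      ‖∫ x, b (s, x) * Complex.exp (-(L * P.F (s, x)))‖ ≤ C * Real.exp (-(c * L)) := by
  obtain ⟨B, hB⟩ := (isCompact_Icc.prod hK).exists_bound_of_continuousOn hb.continuousOn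
  refine ⟨|B| * volume.real K, by positivity, fun s hs L hL => ?_⟩
  rw [← setIntegral_eq_integral_of_forall_compl_eq_zero (s := K)
    (fun x hx => by rw [hb0 s hs x hx, zero_mul])]
  refine (norm_setIntegral_le_of_norm_le_const (C := |B| * Real.exp (-(c * L)))
    hK.measure_lt_top fun x hx => ?_).trans_eq (by ring)
  rw [norm_mul, Complex.norm_exp]
  refine mul_le_mul ((hB (s, x) ⟨hs, hx⟩).trans (le_abs_self _)) (Real.exp_le_exp.2 ?_)
    (Real.exp_pos _).le (abs_nonneg _)
  simp only [Complex.neg_re, Complex.re_ofReal_mul]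
  nlinarith [hF s hs x hx]

theorem norm_osc_le {u : ℝ × (Fin n → ℝ) → ℂ} (hu : ContDiff ℝ ∞ u) :
    ∃ C : ℝ, 0 ≤ C ∧ ∀ s ∈ Set.Icc (0 : ℝ) 1, ∀ L : ℝ, 0 ≤ L → ‖P.osc u s L‖ ≤ C := by
  obtain ⟨C, hC, h⟩ := P.norm_integral_mul_exp_le (b := fun p => P.cutoff p.2 * u p)
    ((P.contDiff_cutoff.continuous.comp continuous_snd).mul hu.continuous)
    (isCompact_closedBall (0 : Fin n → ℝ) P.radius) (c := 0)
    (fun s _ x hx => by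
      simp only
      rw [P.cutoff_eq_zero, zero_mul]
      simpa using (not_le.1 (by simpa using hx) : P.radius < ‖x‖).le)
    (fun s hs x hx => P.re_nonneg s hs x (by simpa using hx))
  exact ⟨C, hC, fun s hs L hL => (h s hs L hL).trans_eq (by simp)⟩

/-- The derivative of the cutoff lives on the shell between half the radius and the radius, where
the real part of the phase is at least the gap. -/
theorem norm_integral_edge_le {u : ℝ × (Fin n → ℝ) → ℂ} (hu : ContDiff ℝ ∞ u) :
    ∃ C : ℝ, 0 ≤ C ∧ ∀ s ∈ Set.Icc (0 : ℝ) 1, ∀ L : ℝ, 0 ≤ L →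
      ‖∫ x, P.edge u (s, x) * Complex.exp (-(L * P.F (s, x)))‖ ≤ C * Real.exp (-(P.gap * L)) := by
  refine P.norm_integral_mul_exp_le (P.continuous_edge hu)
    (K := closedBall 0 P.radius ∩ {x | P.radius / 2 ≤ ‖x‖})
    ((isCompact_closedBall _ _).inter_right (isClosed_le continuous_const continuous_norm))
    (fun s _ x hx => ?_) (fun s hs x hx => P.gap_le_re s hs x hx.2 (by simpa using hx.1))
  simp only [edge]
  rw [P.fderiv_cutoff_eq_zero]
  · simp
  · rintro ⟨h1, h2⟩
    exact hx ⟨by simpa using h2, h1⟩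

/-- Iteration of `osc_sub`. The integral with amplitude `1` is left unevaluated as a common factor,
since the recursion gives no information about it. -/
theorem osc_expansion {u : ℝ × (Fin n → ℝ) → ℂ} (hu : ContDiff ℝ ∞ u) (N : ℕ) :
    ∃ C : ℝ, 0 ≤ C ∧ ∀ s ∈ Set.Icc (0 : ℝ) 1, ∀ L : ℝ, 1 ≤ L →
      ‖P.osc u s L - P.osc 1 s L * ∑ k ∈ Finset.range N, (L : ℂ)⁻¹ ^ k * P.transport^[k] u (s, 0)‖
        ≤ C * L⁻¹ ^ N := by
  induction N generalizing u with
  | zero =>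
    obtain ⟨C, hC, h⟩ := P.norm_osc_le hu
    exact ⟨C, hC, fun s hs L hL => by simpa using h s hs L (by linarith)⟩
  | succ N ih =>
    obtain ⟨C₁, hC₁, h₁⟩ := ih (P.contDiff_transport hu)
    obtain ⟨C₂, hC₂, h₂⟩ := P.norm_integral_edge_le hu
    obtain ⟨C₃, hC₃, h₃⟩ := exp_neg_mul_le_inv_pow P.gap_pos N
    refine ⟨C₁ + C₂ * C₃, by positivity, fun s hs L hL => ?_⟩
    have hL0 : 0 < L := by linarith
    have hLc : (L : ℂ) ≠ 0 := by exact_mod_cast hL0.ne'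
    -- The error for `u` at order `N + 1` is `1 / L` times the error for `transport u` at order `N`,
    -- plus `1 / L` times the edge term.
    have key : P.osc u s L - P.osc 1 s L *
        ∑ k ∈ Finset.range (N + 1), (L : ℂ)⁻¹ ^ k * P.transport^[k] u (s, 0) =
        (L : ℂ)⁻¹ * ((P.osc (P.transport u) s L - P.osc 1 s L *
          ∑ k ∈ Finset.range N, (L : ℂ)⁻¹ ^ k * P.transport^[k] (P.transport u) (s, 0)) +
          ∫ x, P.edge u (s, x) * Complex.exp (-(L * P.F (s, x)))) := by
      have h := P.osc_sub hu hs L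
      have hS : ∑ k ∈ Finset.range N, (L : ℂ)⁻¹ ^ (k + 1) * P.transport^[k + 1] u (s, 0) =
          (L : ℂ)⁻¹ * ∑ k ∈ Finset.range N, (L : ℂ)⁻¹ ^ k *
            P.transport^[k] (P.transport u) (s, 0) := by
        rw [Finset.mul_sum]
        refine Finset.sum_congr rfl fun k _ => ?_
        rw [Function.iterate_succ_apply]
        ring
      have h' : P.osc u s L = u (s, 0) * P.osc 1 s L + (L : ℂ)⁻¹ * (P.osc (P.transport u) s L +
          ∫ x, P.edge u (s, x) * Complex.exp (-(L * P.F (s, x)))) := by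
        rw [← h]; field_simp; ring
      rw [Finset.sum_range_succ', hS, h', pow_zero, one_mul, Function.iterate_zero, id]
      ring
    rw [key, norm_mul, norm_inv, Complex.norm_real, Real.norm_of_nonneg hL0.le]
    calc L⁻¹ * ‖_ + _‖ ≤ L⁻¹ * (C₁ * L⁻¹ ^ N + C₂ * (C₃ * L⁻¹ ^ N)) := by
          gcongr
          refine (norm_add_le _ _).trans (add_le_add (h₁ s hs L hL) ((h₂ s hs L hL0.le).trans ?_))
          gcongr
          exact h₃ L hL
      _ = _ := by ring

end PhaseFamily

end

/-! ### The integral with amplitude one: a differential equation in the parameter -/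

section

/-- An approximate solution of `y' = -a y` on `[0, 1]` is close to the exact one. -/
theorem norm_sub_exp_mul_le {y a e : ℝ → ℂ} {A ε : ℝ} (ha : Continuous a)
    (hA : ∀ s ∈ Set.Icc (0 : ℝ) 1, ‖a s‖ ≤ A)
    (hy : ∀ s, HasDerivAt y (-(a s * y s) + e s) s) (he : ∀ s ∈ Set.Icc (0 : ℝ) 1, ‖e s‖ ≤ ε) :
    ‖y 1 - Complex.exp (-∫ s in (0 : ℝ)..1, a s) * y 0‖ ≤ Real.exp (2 * A) * ε := by
  have hA0 : 0 ≤ A := (norm_nonneg _).trans (hA 0 (by simp))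
  have hα : ∀ s, HasDerivAt (fun s => ∫ t in (0 : ℝ)..s, a t) (a s) s := fun s =>
    intervalIntegral.integral_hasDerivAt_right (ha.intervalIntegrable _ _)
      (ha.stronglyMeasurableAtFilter _ _) ha.continuousAt
  have hαb : ∀ s ∈ Set.Icc (0 : ℝ) 1, ‖∫ t in (0 : ℝ)..s, a t‖ ≤ A := by
    intro s hs
    refine (intervalIntegral.norm_integral_le_of_norm_le_const (C := A) fun t ht => ?_).trans ?_
    · rw [Set.uIoc_of_le hs.1] at ht
      exact hA t ⟨ht.1.le, ht.2.trans hs.2⟩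
    · rw [sub_zero, abs_of_nonneg hs.1]
      nlinarith [hs.2]
  -- Integrating factor. In the final constant one `exp A` bounds this factor in the derivative, the
  -- other comes from dividing it out at `s = 1`.
  have hz : ∀ s, HasDerivAt (fun s => Complex.exp (∫ t in (0 : ℝ)..s, a t) * y s)
      (Complex.exp (∫ t in (0 : ℝ)..s, a t) * e s) s := fun s =>
    ((hα s).cexp.mul (hy s)).congr_deriv (by ring)
  have hexp : ∀ w : ℂ, ‖w‖ ≤ A → ‖Complex.exp w‖ ≤ Real.exp A := fun w hw =>
    (Complex.norm_exp_le_exp_norm w).trans (Real.exp_le_exp.2 hw)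
  have h1 := norm_image_sub_le_of_norm_deriv_le_segment_01'
    (fun s _ => (hz s).hasDerivWithinAt) (C := Real.exp A * ε) fun s hs => by
      rw [norm_mul]
      exact mul_le_mul (hexp _ (hαb s ⟨hs.1, hs.2.le⟩)) (he s ⟨hs.1, hs.2.le⟩) (norm_nonneg _)
        (Real.exp_pos _).le
  simp only [intervalIntegral.integral_same, Complex.exp_zero, one_mul] at h1
  have h2 : y 1 - Complex.exp (-∫ s in (0 : ℝ)..1, a s) * y 0 =
      Complex.exp (-∫ s in (0 : ℝ)..1, a s) *
        (Complex.exp (∫ s in (0 : ℝ)..1, a s) * y 1 - y 0) := by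
    rw [mul_sub, ← mul_assoc, ← Complex.exp_add]
    simp
  rw [h2, norm_mul, two_mul, Real.exp_add, mul_assoc]
  refine mul_le_mul (hexp _ ?_) h1 (norm_nonneg _) (Real.exp_pos _).le
  rw [norm_neg]
  exact hαb 1 (by simp)

/-- The derivative in the parameter. -/
def partialS (u : ℝ × (Fin n → ℝ) → ℂ) (p : ℝ × (Fin n → ℝ)) : ℂ := fderiv ℝ u p (1, 0)

theorem contDiff_partialS {u : ℝ × (Fin n → ℝ) → ℂ} (hu : ContDiff ℝ ∞ u) :
    ContDiff ℝ ∞ (partialS u) :=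
  (hu.fderiv_right (m := ∞) (by simp)).clm_apply contDiff_const

theorem hasDerivAt_partialS {u : ℝ × (Fin n → ℝ) → ℂ} (hu : ContDiff ℝ ∞ u) (s : ℝ)
    (x : Fin n → ℝ) : HasDerivAt (fun s => u (s, x)) (partialS u (s, x)) s :=
  (hu.differentiable (by simp) (s, x)).hasFDerivAt.comp_hasDerivAt s
    ((hasDerivAt_id s).prodMk (hasDerivAt_const s x))

namespace PhaseFamily

variable (P : PhaseFamily n)

theorem osc_eq_setIntegral (u : ℝ × (Fin n → ℝ) → ℂ) (s L : ℝ) :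
    P.osc u s L = ∫ x in closedBall 0 P.radius,
      P.cutoff x * u (s, x) * Complex.exp (-(L * P.F (s, x))) := by
  refine (setIntegral_eq_integral_of_forall_compl_eq_zero fun x hx => ?_).symm
  rw [P.cutoff_eq_zero (by simpa using (not_le.1 (by simpa using hx) : P.radius < ‖x‖).le)]
  simp

/-- The parameter enters only through the exponential. Restricting to the closed ball first gives
the compact domain needed to differentiate under the integral. -/
theorem hasDerivAt_osc_one (s L : ℝ) :
    HasDerivAt (fun s => P.osc 1 s L) (-(L * P.osc (partialS P.F) s L)) s := by
  have hu : ContDiff ℝ ∞ fun p : ℝ × (Fin n → ℝ) =>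
      P.cutoff p.2 * Complex.exp (-(L * P.F p)) :=
    (P.contDiff_cutoff.comp contDiff_snd).mul
      (Complex.contDiff_exp.comp (contDiff_const.mul P.contDiff_F).neg)
  have hu1 : ContDiff ℝ 1 fun p : ℝ × (Fin n → ℝ) =>
      P.cutoff p.2 * Complex.exp (-(L * P.F p)) := hu.of_le (by norm_cast)
  have h := (hasFDerivAt_setIntegral volume
    (isCompact_closedBall (0 : Fin n → ℝ) P.radius) hu1 s).hasDerivAt
  have h1 : (fun s => P.osc 1 s L) = fun s => ∫ x in closedBall (0 : Fin n → ℝ) P.radius,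
      P.cutoff x * Complex.exp (-(L * P.F (s, x))) := by
    ext s
    rw [osc_eq_setIntegral]
    simp
  rw [h1]
  refine h.congr_deriv ?_
  rw [ContinuousLinearMap.integral_apply, osc_eq_setIntegral, ← integral_const_mul, ← integral_neg]
  · refine integral_congr_ae (.of_forall fun x => ?_)
    have h2 := hasDerivAt_partialS hu s x
    have h3 : HasDerivAt (fun s => P.cutoff x * Complex.exp (-(L * P.F (s, x))))
        (P.cutoff x * (Complex.exp (-(L * P.F (s, x))) * -(L * partialS P.F (s, x)))) s :=
      (((hasDerivAt_partialS P.contDiff_F s x).const_mul (L : ℂ)).fun_neg.cexp).const_mul _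
    have h4 := h2.unique h3
    simp only [partialS] at h4
    simp only [ContinuousLinearMap.comp_apply, ContinuousLinearMap.inl_apply]
    rw [h4, partialS]
    ring
  · exact (((hu.continuous_fderiv (by simp)).clm_comp continuous_const).comp
      (by fun_prop : Continuous fun y : Fin n → ℝ => (s, y))).continuousOn.integrableOn_compact
        (isCompact_closedBall _ _)

/-- All phases of the family vanish at the origin. This removes the term of order `0` from the
expansion of the integral with amplitude `∂_s F`, which compensates the factor `L` in its
coefficient. -/
theorem partialS_F_zero (s : ℝ) : partialS P.F (s, 0) = 0 := by
  have h := hasDerivAt_partialS P.contDiff_F s 0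
  simp only [P.F_zero] at h
  exact h.unique (hasDerivAt_const s 0)

/-- The coefficients of the logarithm of the integral with amplitude `1`. -/
def logCoeff (k : ℕ) : ℂ :=
  ∫ s in (0 : ℝ)..1, P.transport^[k] (P.transport (partialS P.F)) (s, 0)

/-- Expanding the integral with amplitude `∂_s F` turns `hasDerivAt_osc_one` into `y' = -a y + e`
with `a` a polynomial in `1 / L`, bounded uniformly for `L ≥ 1`, and `e` of order `L⁻¹ ^ N`. The
integral of `a` over `[0, 1]` is the sum in the exponent. -/
theorem osc_one_sub_exp_mul_le (N : ℕ) : ∃ C : ℝ, 0 ≤ C ∧ ∀ L : ℝ, 1 ≤ L →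
    ‖P.osc 1 1 L - Complex.exp (-∑ k ∈ Finset.range N, (L : ℂ)⁻¹ ^ k * P.logCoeff k) *
      P.osc 1 0 L‖ ≤ C * L⁻¹ ^ N := by
  have hF := contDiff_partialS P.contDiff_F
  -- One extra order, because the error is multiplied by `L` in the differential equation.
  obtain ⟨C, hC, h⟩ := P.osc_expansion hF (N + 1)
  have hcont : ∀ k, Continuous fun s : ℝ => P.transport^[k] (P.transport (partialS P.F)) (s, 0) :=
    fun k => (P.contDiff_iterate_transport (P.contDiff_transport hF) k).continuous.comp
      (by fun_prop)
  choose B hB using fun k => isCompact_Icc.exists_bound_of_continuousOn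
    (s := Set.Icc (0 : ℝ) 1) (hcont k).continuousOn
  refine ⟨Real.exp (2 * ∑ k ∈ Finset.range N, |B k|) * C, by positivity, fun L hL => ?_⟩
  have hL0 : 0 < L := by linarith
  have hLc : (L : ℂ) ≠ 0 := by exact_mod_cast hL0.ne'
  have hLi : L⁻¹ ≤ 1 := inv_le_one_of_one_le₀ hL
  set a : ℝ → ℂ := fun s => ∑ k ∈ Finset.range N,
    (L : ℂ)⁻¹ ^ k * P.transport^[k] (P.transport (partialS P.F)) (s, 0) with ha
  have hac : Continuous a := continuous_finsetSum _ fun k _ => continuous_const.mul (hcont k)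
  have hint : ∫ s in (0 : ℝ)..1, a s = ∑ k ∈ Finset.range N, (L : ℂ)⁻¹ ^ k * P.logCoeff k := by
    rw [ha, intervalIntegral.integral_finsetSum]
    · refine Finset.sum_congr rfl fun k _ => ?_
      rw [intervalIntegral.integral_const_mul, logCoeff]
    · exact fun k _ => (continuous_const.mul (hcont k)).intervalIntegrable _ _
  rw [← hint, mul_assoc]
  refine norm_sub_exp_mul_le (y := fun s => P.osc 1 s L)
    (e := fun s => a s * P.osc 1 s L - L * P.osc (partialS P.F) s L) hac ?_ ?_ ?_
  · intro s hs
    refine norm_sum_le_of_le _ fun k _ => ?_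
    rw [norm_mul, norm_pow, norm_inv, Complex.norm_real, Real.norm_of_nonneg hL0.le]
    exact (mul_le_of_le_one_left (norm_nonneg _) (pow_le_one₀ (by positivity) hLi)).trans
      ((hB k s hs).trans (le_abs_self _))
  · exact fun s => (P.hasDerivAt_osc_one s L).congr_deriv (by ring)
  · intro s hs
    have h1 := h s hs L hL
    have hS : ∑ k ∈ Finset.range (N + 1), (L : ℂ)⁻¹ ^ k * P.transport^[k] (partialS P.F) (s, 0) =
        (L : ℂ)⁻¹ * a s := by
      rw [Finset.sum_range_succ', ha, Finset.mul_sum]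
      simp only [Function.iterate_succ_apply, Function.iterate_zero, id, P.partialS_F_zero,
        mul_zero, add_zero]
      exact Finset.sum_congr rfl fun k _ => by ring
    rw [hS] at h1
    have h2 : a s * P.osc 1 s L - L * P.osc (partialS P.F) s L =
        -(L * (P.osc (partialS P.F) s L - P.osc 1 s L * ((L : ℂ)⁻¹ * a s))) := by
      field_simp; ring
    rw [h2, norm_neg, norm_mul, Complex.norm_real, Real.norm_of_nonneg hL0.le]
    calc L * ‖_‖ ≤ L * (C * L⁻¹ ^ (N + 1)) := by gcongr
      _ = C * L⁻¹ ^ N := by rw [pow_succ]; field_simp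

end PhaseFamily

end

section

/-! ### Asymptotic power series -/

section Asymptotic

variable {α : Type} {l : Filter α} {ε : α → ℂ}

theorem isBigO_sum_range_sub (hε : Tendsto ε l (𝓝[≠] 0)) (c : ℕ → ℂ) {M N : ℕ} (h : M ≤ N) :
    (fun x => ∑ k ∈ Finset.range N, c k * ε x ^ k - ∑ k ∈ Finset.range M, c k * ε x ^ k) =O[l]
      fun x => ε x ^ M := by
  have h0 : Tendsto ε l (𝓝 0) := hε.mono_right nhdsWithin_le_nhds
  have h1 : ∀ x, ∑ k ∈ Finset.range N, c k * ε x ^ k - ∑ k ∈ Finset.range M, c k * ε x ^ k =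
      ∑ k ∈ Finset.Ico M N, c k * ε x ^ k := fun x => by
    rw [Finset.sum_Ico_eq_sub _ h]
  simp only [h1]
  refine IsBigO.fun_sum fun k hk => IsBigO.const_mul_left ?_ _
  have hk' := (Finset.mem_Ico.1 hk).1
  have : (fun x => ε x ^ k) = fun x => ε x ^ (k - M) * ε x ^ M := by
    ext x; rw [← pow_add, Nat.sub_add_cancel hk']
  rw [this]
  simpa using ((h0.pow (k - M)).isBigO_one ℂ).mul (isBigO_refl (fun x => ε x ^ M) l)

/-- Letting `ε → 0` shows that the constant term vanishes; then divide by `ε`, which is eventually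
nonzero, and repeat. -/
theorem eq_zero_of_sum_isBigO [l.NeBot] (hε : Tendsto ε l (𝓝[≠] 0)) {c : ℕ → ℂ} {N : ℕ}
    (h : (fun x => ∑ k ∈ Finset.range N, c k * ε x ^ k) =O[l] fun x => ε x ^ N) :
    ∀ k < N, c k = 0 := by
  have h0 : Tendsto ε l (𝓝 0) := hε.mono_right nhdsWithin_le_nhds
  have hne : ∀ᶠ x in l, ε x ≠ 0 := hε.eventually self_mem_nhdsWithin
  induction N generalizing c with
  | zero => simp
  | succ N ih =>
    have h1 : Tendsto (fun x => ∑ k ∈ Finset.range (N + 1), c k * ε x ^ k) l (𝓝 (c 0)) := by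
      have := tendsto_finsetSum (Finset.range (N + 1)) fun k _ => (h0.pow k).const_mul (c k)
      simpa [Finset.sum_range_succ'] using this
    have h2 : c 0 = 0 := tendsto_nhds_unique h1
      (h.trans_tendsto (by simpa using h0.pow (N + 1)))
    have h3 : (fun x => ∑ k ∈ Finset.range N, c (k + 1) * ε x ^ k) =O[l] fun x => ε x ^ N := by
      have := h.mul (isBigO_refl (fun x => (ε x)⁻¹) l)
      refine this.congr' ?_ ?_
      · filter_upwards [hne] with x hx
        rw [Finset.sum_range_succ', h2, zero_mul, add_zero, Finset.sum_mul]
        exact Finset.sum_congr rfl fun k _ => by field_simp; ring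
      · filter_upwards [hne] with x hx
        field_simp
        ring
    intro k hk
    cases k with
    | zero => exact h2
    | succ k => exact ih h3 k (by omega)

theorem coeff_eq_of_isBigO [l.NeBot] (hε : Tendsto ε l (𝓝[≠] 0)) {E : α → ℂ} {c d : ℕ → ℂ}
    {M N : ℕ} (hc : (fun x => E x - ∑ k ∈ Finset.range M, c k * ε x ^ k) =O[l] fun x => ε x ^ M)
    (hd : (fun x => E x - ∑ k ∈ Finset.range N, d k * ε x ^ k) =O[l] fun x => ε x ^ N)
    (h : M ≤ N) : ∀ k < M, c k = d k := by
  have h0 : Tendsto ε l (𝓝 0) := hε.mono_right nhdsWithin_le_nhds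
  have hd' : (fun x => E x - ∑ k ∈ Finset.range N, d k * ε x ^ k) =O[l] fun x => ε x ^ M := by
    refine hd.trans ?_
    have : (fun x => ε x ^ N) = fun x => ε x ^ (N - M) * ε x ^ M := by
      ext x; rw [← pow_add, Nat.sub_add_cancel h]
    rw [this]
    simpa using ((h0.pow (N - M)).isBigO_one ℂ).mul (isBigO_refl (fun x => ε x ^ M) l)
  have key : (fun x => ∑ k ∈ Finset.range M, (d k - c k) * ε x ^ k) =O[l] fun x => ε x ^ M := by
    refine ((hc.sub hd').sub (isBigO_sum_range_sub hε d h)).congr_left fun x => ?_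
    simp only [sub_mul, Finset.sum_sub_distrib]
    ring
  intro k hk
  exact (sub_eq_zero.1 (eq_zero_of_sum_isBigO hε key k hk)).symm

/-- A function that is analytic in the small quantity `ε` up to every order of precision has an
asymptotic power series. -/
theorem exists_asymptotic_series [l.NeBot] (hε : Tendsto ε l (𝓝[≠] 0)) {E : α → ℂ}
    (h : ∀ N : ℕ, ∃ f : ℂ → ℂ, AnalyticAt ℂ f 0 ∧ (fun x => E x - f (ε x)) =O[l] fun x => ε x ^ N) :
    ∃ c : ℕ → ℂ, ∀ N : ℕ,
      (fun x => E x - ∑ k ∈ Finset.range N, c k * ε x ^ k) =O[l] fun x => ε x ^ N := by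
  have h0 : Tendsto ε l (𝓝 0) := hε.mono_right nhdsWithin_le_nhds
  have h1 : ∀ N : ℕ, ∃ c : ℕ → ℂ,
      (fun x => E x - ∑ k ∈ Finset.range N, c k * ε x ^ k) =O[l] fun x => ε x ^ N := by
    intro N
    obtain ⟨f, ⟨p, hp⟩, hf⟩ := h N
    refine ⟨p.coeff, ?_⟩
    have h2 := (hp.isBigO_sub_partialSum_pow N).comp_tendsto h0
    have h3 : (fun x => f (ε x) - ∑ k ∈ Finset.range N, p.coeff k * ε x ^ k) =O[l]
        fun x => ε x ^ N := by
      refine (h2.congr_left fun x => ?_).trans (IsBigO.of_norm_right ?_)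
      · simp only [Function.comp_apply, zero_add, FormalMultilinearSeries.partialSum]
        congr 1
        refine Finset.sum_congr rfl fun k _ => ?_
        rw [FormalMultilinearSeries.apply_eq_pow_smul_coeff, smul_eq_mul, mul_comm]
      · simp only [norm_pow]
        exact isBigO_refl _ _
    exact (hf.add h3).congr_left fun x => by ring
  choose c hc using h1
  -- Each order `N` comes with its own coefficients. Uniqueness makes the `k`-th one the same for
  -- all `N > k`, so it may be read off at the first order that contains it.
  refine ⟨fun k => c (k + 1) k, fun N => ?_⟩
  refine (hc N).congr_left fun x => ?_
  congr 1
  refine Finset.sum_congr rfl fun k hk => ?_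
  exact congrArg (· * ε x ^ k)
    (coeff_eq_of_isBigO hε (hc (k + 1)) (hc N) (Finset.mem_range.1 hk) k (by omega)).symm

end Asymptotic

/-! ### The Gaussian integral -/

/-- The norm on `Fin n → ℝ` is the supremum norm. This comparison bounds the quadratic form from
below outside a ball. -/
theorem sq_norm_le_sum_sq (x : Fin n → ℝ) : ‖x‖ ^ 2 ≤ ∑ i, x i ^ 2 := by
  have h0 : 0 ≤ ∑ i, x i ^ 2 := Finset.sum_nonneg fun i _ => sq_nonneg _
  rw [← Real.le_sqrt (norm_nonneg _) h0, pi_norm_le_iff_of_nonneg (Real.sqrt_nonneg _)]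
  intro i
  refine Real.le_sqrt_of_sq_le ?_
  rw [Real.norm_eq_abs, sq_abs]
  exact Finset.single_le_sum (f := fun i => x i ^ 2) (fun i _ => sq_nonneg _) (Finset.mem_univ i)

theorem exp_sum_sq (L : ℝ) (x : Fin n → ℝ) :
    Real.exp (-(L * ((∑ i, x i ^ 2) / 2))) = ∏ i, Real.exp (-(L / 2) * x i ^ 2) := by
  rw [← Real.exp_sum, ← Finset.mul_sum]
  congr 1; ring

theorem integrable_exp_sum_sq {L : ℝ} (hL : 0 < L) :
    Integrable fun x : Fin n → ℝ => Real.exp (-(L * ((∑ i, x i ^ 2) / 2))) := by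
  simp only [exp_sum_sq]
  exact Integrable.fintype_prod fun _ => integrable_exp_neg_mul_sq (by positivity)

theorem integral_exp_sum_sq (L : ℝ) :
    ∫ x : Fin n → ℝ, Real.exp (-(L * ((∑ i, x i ^ 2) / 2))) = √(2 * Real.pi / L) ^ n := by
  simp only [exp_sum_sq]
  rw [integral_fintype_prod_volume_eq_pow (fun y : ℝ => Real.exp (-(L / 2) * y ^ 2)),
    integral_gaussian, Fintype.card_fin]
  congr 2
  rw [div_div_eq_mul_div, mul_comm]

namespace PhaseFamily

variable (P : PhaseFamily n)

/-- At `s = 0` the integral differs from a full Gaussian only through the cutoff, which equals `1`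
on the inner ball; outside it the quadratic form is at least `c`. -/
theorem osc_one_zero_sub_le (hq : ∀ x, P.F (0, x) = ((∑ i, x i ^ 2) / 2 : ℝ)) (N : ℕ) :
    ∃ C : ℝ, 0 ≤ C ∧ ∀ L : ℝ, 1 ≤ L →
      ‖P.osc 1 0 L - ((√(2 * Real.pi / L) ^ n : ℝ) : ℂ)‖ ≤ C * L⁻¹ ^ N := by
  set c := (P.radius / 2) ^ 2 / 2 with hc
  have hc0 : 0 < c := by have := P.radius_pos; positivity
  obtain ⟨B, hB, hBL⟩ := exp_neg_mul_le_inv_pow hc0 N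
  set I : ℝ := ∫ x : Fin n → ℝ, 2 * Real.exp c * Real.exp (-(1 * ((∑ i, x i ^ 2) / 2)))
  have hI : 0 ≤ I := integral_nonneg fun x => by positivity
  refine ⟨I * B, by positivity, fun L hL => ?_⟩
  have hL0 : 0 < L := by linarith
  have hexp : ∀ x, Complex.exp (-(L * P.F (0, x))) =
      (Real.exp (-(L * ((∑ i, x i ^ 2) / 2))) : ℂ) := fun x => by
    rw [hq, ← Complex.ofReal_mul, ← Complex.ofReal_neg, Complex.ofReal_exp]
  have h1 : P.osc 1 0 L - ((√(2 * Real.pi / L) ^ n : ℝ) : ℂ) =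
      ∫ x, (P.cutoff x - 1) * (Real.exp (-(L * ((∑ i, x i ^ 2) / 2))) : ℂ) := by
    rw [← integral_exp_sum_sq, ← integral_complex_ofReal, osc, ← integral_sub]
    · refine integral_congr_ae (.of_forall fun x => ?_)
      simp only [hexp, Pi.one_apply]
      ring
    · exact P.integrable_cutoff_mul (u := 1) contDiff_const 0 L
    · exact (integrable_exp_sum_sq hL0).ofReal
  rw [h1]
  -- Writing `q` for the quadratic form, `(L - 1) (q - c) ≥ 0` gives `exp (-L q) ≤ exp c * exp (-q)
  -- * exp (-c L)`. This separates the decay in `L` from an integrable function of `x`. The factor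
  -- `2` bounds `‖cutoff - 1‖`.
  have h2 : ∀ x, ‖(P.cutoff x - 1) * (Real.exp (-(L * ((∑ i, x i ^ 2) / 2))) : ℂ)‖ ≤
      2 * Real.exp c * Real.exp (-(1 * ((∑ i, x i ^ 2) / 2))) * Real.exp (-(c * L)) := by
    intro x
    by_cases hx : ‖x‖ ≤ P.radius / 2
    · rw [P.cutoff_eq_one hx]
      simp only [sub_self, zero_mul, norm_zero]
      positivity
    · have h3 : c ≤ (∑ i, x i ^ 2) / 2 := by
        have := sq_norm_le_sum_sq x
        have h4 : (P.radius / 2) ^ 2 ≤ ‖x‖ ^ 2 :=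
          pow_le_pow_left₀ (by have := P.radius_pos; positivity) (not_le.1 hx).le 2
        rw [hc]; linarith
      rw [norm_mul, Complex.norm_real, Real.norm_of_nonneg (Real.exp_pos _).le, mul_assoc,
        mul_assoc, ← Real.exp_add, ← Real.exp_add]
      refine mul_le_mul ?_ (Real.exp_le_exp.2 ?_) (Real.exp_pos _).le zero_le_two
      · refine (norm_sub_le _ _).trans ?_
        have := P.norm_cutoff_le x
        rw [norm_one]; linarith
      · nlinarith
  refine (norm_integral_le_of_norm_le
    (((integrable_exp_sum_sq one_pos).const_mul _).mul_const _) (.of_forall h2)).trans ?_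
  rw [integral_mul_const, mul_assoc]
  exact mul_le_mul_of_nonneg_left (hBL L hL) hI

/-- The complete asymptotic expansion of the integral. -/
theorem exists_expansion (hq : ∀ x, P.F (0, x) = ((∑ i, x i ^ 2) / 2 : ℝ))
    {u : ℝ × (Fin n → ℝ) → ℂ} (hu : ContDiff ℝ ∞ u) :
    ∃ c : ℕ → ℂ, (∀ N : ℕ, (fun L : ℝ => P.osc u 1 L / ((√(2 * Real.pi / L) ^ n : ℝ) : ℂ) -
        ∑ k ∈ Finset.range N, c k * (L : ℂ)⁻¹ ^ k) =O[atTop] fun L : ℝ => (L : ℂ)⁻¹ ^ N) ∧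
      c 0 = Complex.exp (-P.logCoeff 0) * u (1, 0) ∧
      ∀ m : ℕ, (∀ k, k < m → P.transport^[k] u (1, 0) = 0) → ∀ k, k < m → c k = 0 := by
  have hε0 : Tendsto (fun L : ℝ => (L : ℂ)⁻¹) atTop (𝓝 0) := by
    have := (Complex.continuous_ofReal.tendsto 0).comp tendsto_inv_atTop_zero
    simpa [Function.comp_def] using this
  have hε : Tendsto (fun L : ℝ => (L : ℂ)⁻¹) atTop (𝓝[≠] 0) := by
    refine tendsto_nhdsWithin_iff.2 ⟨hε0, ?_⟩
    filter_upwards [eventually_gt_atTop 0] with L hL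
    exact inv_ne_zero (by exact_mod_cast hL.ne')
  have hpoly : ∀ (d : ℕ → ℂ) (M : ℕ),
      (fun L : ℝ => ∑ k ∈ Finset.range M, (L : ℂ)⁻¹ ^ k * d k) =O[atTop] fun _ => (1 : ℂ) :=
    fun d M => (tendsto_finsetSum (Finset.range M)
      fun k _ => (hε0.pow k).mul_const (d k)).isBigO_one ℂ
  have hO : ∀ {f : ℝ → ℂ} {C : ℝ} {M : ℕ}, (∀ L : ℝ, 1 ≤ L → ‖f L‖ ≤ C * L⁻¹ ^ M) →
      f =O[atTop] fun L : ℝ => (L : ℂ)⁻¹ ^ M := by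
    intro f C M hf
    refine IsBigO.of_bound C ?_
    filter_upwards [eventually_ge_atTop 1] with L hL
    rw [norm_pow, norm_inv, Complex.norm_real, Real.norm_of_nonneg (by linarith)]
    exact hf L hL
  set e : ℕ → ℂ → ℂ := fun M w => Complex.exp (-∑ k ∈ Finset.range M, w ^ k * P.logCoeff k) with he
  set S : ℕ → ℂ → ℂ := fun M w => ∑ k ∈ Finset.range M, w ^ k * P.transport^[k] u (1, 0) with hS
  have heO : ∀ M, (fun L : ℝ => e M (L : ℂ)⁻¹) =O[atTop] fun _ => (1 : ℂ) := fun M =>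
    ((Complex.continuous_exp.tendsto _).comp (tendsto_finsetSum (Finset.range M)
      fun k _ => (hε0.pow k).mul_const (P.logCoeff k)).neg).isBigO_one ℂ
  -- A crude bound: dividing by the Gaussian costs at most `L ^ n` for `L ≥ 1`. The order `N + n +
  -- 1` used below pays for it.
  have hg : (fun L : ℝ => (((√(2 * Real.pi / L) ^ n : ℝ) : ℂ))⁻¹) =O[atTop]
      fun L : ℝ => (L : ℂ) ^ n := by
    refine IsBigO.of_bound 1 ?_
    filter_upwards [eventually_ge_atTop 1] with L hL
    have hL0 : 0 < L := by linarith
    rw [← Complex.ofReal_inv, ← Complex.ofReal_pow, Complex.norm_real, Complex.norm_real,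
      Real.norm_of_nonneg (by positivity), Real.norm_of_nonneg (by positivity), one_mul, ← inv_pow]
    refine pow_le_pow_left₀ (by positivity) ?_ n
    rw [inv_le_comm₀ (Real.sqrt_pos.2 (by positivity)) hL0]
    refine Real.le_sqrt_of_sq_le ?_
    rw [div_eq_mul_inv, sq]
    have h1 : L⁻¹ ≤ 1 := inv_le_one_of_one_le₀ hL
    have h2 : 1 ≤ 2 * Real.pi := by linarith [Real.pi_gt_three]
    exact mul_le_mul_of_nonneg_right (h1.trans h2) (by positivity)
  have main : ∀ N : ℕ, (fun L : ℝ => P.osc u 1 L / ((√(2 * Real.pi / L) ^ n : ℝ) : ℂ) -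
      e (N + n + 1) (L : ℂ)⁻¹ * S (N + n + 1) (L : ℂ)⁻¹) =O[atTop] fun L : ℝ => (L : ℂ)⁻¹ ^ N := by
    intro N
    obtain ⟨C₁, -, h₁⟩ := P.osc_expansion hu (N + n + 1)
    obtain ⟨C₂, -, h₂⟩ := P.osc_one_sub_exp_mul_le (N + n + 1)
    obtain ⟨C₃, -, h₃⟩ := P.osc_one_zero_sub_le hq (N + n + 1)
    have k₁ := hO (h₁ 1 (by simp))
    have k₂ := (hO h₂).mul (hpoly (fun k => P.transport^[k] u (1, 0)) (N + n + 1))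
    have k₃ := ((hO h₃).mul (heO (N + n + 1))).mul
      (hpoly (fun k => P.transport^[k] u (1, 0)) (N + n + 1))
    simp only [mul_one] at k₂ k₃
    have k₄ := ((k₁.add k₂).add k₃).mul hg
    refine (k₄.congr' ?_ .rfl).trans ?_
    · filter_upwards [eventually_gt_atTop 0] with L hL
      have hgL : ((√(2 * Real.pi / L) ^ n : ℝ) : ℂ) ≠ 0 := by
        have : √(2 * Real.pi / L) ≠ 0 := (Real.sqrt_pos.2 (by positivity)).ne'
        exact_mod_cast pow_ne_zero n this
      simp only [he, hS]
      field_simp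
      ring
    · refine IsBigO.of_bound 1 ?_
      filter_upwards [eventually_ge_atTop 1] with L hL
      have hL0 : 0 < L := by linarith
      have hLc : (L : ℂ) ≠ 0 := by exact_mod_cast hL0.ne'
      have : (L : ℂ)⁻¹ ^ (N + n + 1) * (L : ℂ) ^ n = (L : ℂ)⁻¹ ^ N * (L : ℂ)⁻¹ := by
        rw [pow_succ, pow_add, inv_pow (L : ℂ) n]; field_simp
      rw [this, norm_mul, one_mul, norm_inv (L : ℂ), Complex.norm_real,
        Real.norm_of_nonneg hL0.le]
      exact mul_le_of_le_one_right (norm_nonneg _) (inv_le_one_of_one_le₀ hL)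
  have hean : ∀ M, AnalyticAt ℂ (fun w => e M w * S M w) 0 := fun M => by
    have h1 : Differentiable ℂ fun w => e M w * S M w := by
      simp only [he, hS]; fun_prop
    exact h1.analyticAt 0
  -- The products `e M w * S M w` are entire in `w = 1 / L`, so each precision has an analytic
  -- approximant; their Taylor coefficients fit together into one series.
  obtain ⟨c, hc⟩ := exists_asymptotic_series hε fun N => ⟨_, hean (N + n + 1), main N⟩
  refine ⟨c, hc, ?_, fun m hm => ?_⟩
  -- The normalized integral has one limit as `L → ∞`; it is both `c 0` and the value of the
  -- approximant at `w = 0`.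
  · have t1 := (hc 1).trans_tendsto (by simpa using hε0.pow 1)
    have t2 := (main 1).trans_tendsto (by simpa using hε0.pow 1)
    have t3 := (hean (1 + n + 1)).continuousAt.tendsto.comp hε0
    have t4 := (t2.sub t1).add t3
    simp only [Finset.range_one, Finset.sum_singleton, pow_zero, mul_one, Function.comp_def] at t4
    have t5 : Tendsto (fun _ : ℝ => c 0) atTop
        (𝓝 (0 - 0 + e (1 + n + 1) 0 * S (1 + n + 1) 0)) := t4.congr fun L => by ring
    have t6 := tendsto_nhds_unique t5 tendsto_const_nhds
    rw [← t6]
    simp [he, hS, Finset.sum_range_succ']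
  -- If the first `m` transported amplitudes vanish at the origin, the normalized integral is itself
  -- of order `L⁻¹ ^ m`, and uniqueness kills the first `m` coefficients.
  · have h1 : (fun L : ℝ => S (m + n + 1) (L : ℂ)⁻¹) =O[atTop] fun L : ℝ => (L : ℂ)⁻¹ ^ m := by
      refine (isBigO_sum_range_sub hε (fun k => P.transport^[k] u (1, 0))
        (show m ≤ m + n + 1 by omega)).congr_left fun L => ?_
      rw [Finset.sum_eq_zero (s := Finset.range m) fun k hk => by
        rw [hm k (Finset.mem_range.1 hk), zero_mul], sub_zero]
      exact Finset.sum_congr rfl fun k _ => mul_comm _ _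
    have h2 := ((main m).add (by simpa using (heO (m + n + 1)).mul h1)).sub (hc m)
    refine eq_zero_of_sum_isBigO hε (N := m) (h2.congr_left fun L => by ring)

end PhaseFamily

end

section

/-! ### The determinant along a segment of matrices -/

/-- The segment from the identity matrix to `A`. -/
def segment (A : Matrix (Fin n) (Fin n) ℂ) (s : ℝ) : Matrix (Fin n) (Fin n) ℂ :=
  (1 - s : ℂ) • 1 + (s : ℂ) • A

/-- The eigenvalues along the segment are `1 - s + s μ`. For `s ≠ 0` the determinant is a rescaled
value of the characteristic polynomial of `A`, so diagonalizability is not needed. -/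
theorem det_segment (A : Matrix (Fin n) (Fin n) ℂ) (s : ℝ) :
    (segment A s).det = (A.charpoly.roots.map fun μ => (1 - s + s * μ : ℂ)).prod := by
  have hcard : Multiset.card A.charpoly.roots = n := by
    rw [← (IsAlgClosed.splits A.charpoly).natDegree_eq_card_roots,
      Matrix.charpoly_natDegree_eq_dim, Fintype.card_fin]
  rcases eq_or_ne s 0 with rfl | hs
  · simp [segment]
  have hs' : (s : ℂ) ≠ 0 := by exact_mod_cast hs
  have h1 : segment A s = (-s : ℂ) • (Matrix.scalar (Fin n) ((s - 1 : ℂ) / s) - A) := by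
    rw [segment, smul_sub, Matrix.scalar_apply, ← Matrix.smul_one_eq_diagonal, smul_smul]
    rw [show (-s : ℂ) * ((s - 1) / s) = 1 - s by field_simp; ring, neg_smul, sub_neg_eq_add]
  have h2 : A.charpoly.eval ((s - 1 : ℂ) / s) =
      (A.charpoly.roots.map fun μ => (s - 1 : ℂ) / s - μ).prod := by
    conv_lhs => rw [(IsAlgClosed.splits A.charpoly).eq_prod_roots_of_monic A.charpoly_monic]
    rw [Polynomial.eval_multiset_prod, Multiset.map_map]
    simp
  have h3 : (-s : ℂ) ^ n = (A.charpoly.roots.map fun _ => (-s : ℂ)).prod := by simp [hcard]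
  rw [h1, Matrix.det_smul, ← Matrix.eval_charpoly, h2, Fintype.card_fin, h3,
    ← Multiset.prod_map_mul]
  refine congrArg _ (Multiset.map_congr rfl fun μ _ => ?_)
  field_simp
  ring

/-- Jacobi's formula: the matrix at `t` is `1 + (t - s) X` times the matrix at `s`, and `det (1 + r
X)` is `1 + r tr X` plus a multiple of `r ^ 2`. -/
theorem hasDerivAt_det_segment {A : Matrix (Fin n) (Fin n) ℂ} {s : ℝ}
    (h : (segment A s).det ≠ 0) :
    HasDerivAt (fun s => (segment A s).det)
      ((segment A s).det * ((A - 1) * (segment A s)⁻¹).trace) s := by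
  have hu : IsUnit (segment A s).det := isUnit_iff_ne_zero.2 h
  set X := (A - 1) * (segment A s)⁻¹ with hX
  have h1 : ∀ t : ℝ, (segment A t).det =
      (1 + ((t - s : ℝ) : ℂ) • X).det * (segment A s).det := by
    intro t
    rw [← Matrix.det_mul, add_mul, one_mul, Matrix.smul_mul, hX, Matrix.mul_assoc,
      Matrix.nonsing_inv_mul _ hu, Matrix.mul_one]
    congr 1
    simp only [segment, Complex.ofReal_sub]
    module
  have h2 : HasDerivAt (fun r : ℂ => (1 + r • X).det) X.trace 0 := by
    rw [funext fun r : ℂ => Matrix.det_one_add_smul r X]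
    set q := (Matrix.det (1 + (Polynomial.X : Polynomial ℂ) • X.map Polynomial.C)).divX.divX
    have := (((hasDerivAt_id (0 : ℂ)).const_mul X.trace).const_add 1).add
      ((q.hasDerivAt 0).mul (hasDerivAt_pow 2 (0 : ℂ)))
    exact this.congr_deriv (by simp)
  have h3 : HasDerivAt (fun t : ℝ => ((t - s : ℝ) : ℂ)) 1 s := by
    simpa using ((hasDerivAt_id s).sub_const s).ofReal_comp
  have h4 : HasDerivAt (fun t : ℝ => (1 + ((t - s : ℝ) : ℂ) • X).det) X.trace s := by
    have := HasDerivAt.scomp (g₁ := fun r : ℂ => (1 + r • X).det)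
      (h := fun t : ℝ => ((t - s : ℝ) : ℂ)) s (by simpa using h2) h3
    simpa [Function.comp_def] using this
  have h5 := h4.mul_const (segment A s).det
  rw [funext h1]
  exact h5.congr_deriv (mul_comm _ _)

/-- For `s < 1` the real part is positive; at `s = 1` the factor is `μ`, which may be purely
imaginary but not zero. Hence principal logarithms vary continuously along the whole path, which
fixes the branch of the square root. -/
theorem segment_factor_mem_slitPlane {μ : ℂ} (hre : 0 ≤ μ.re) (h0 : μ ≠ 0) {s : ℝ}
    (hs : s ∈ Set.Icc (0 : ℝ) 1) : (1 - s + s * μ : ℂ) ∈ Complex.slitPlane := by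
  rw [Complex.mem_slitPlane_iff]
  rcases eq_or_lt_of_le hs.2 with h | h
  · subst h
    simp only [Complex.ofReal_one, sub_self, one_mul, zero_add]
    rcases hre.lt_or_eq with h1 | h1
    · exact .inl h1
    · exact .inr fun h2 => h0 (Complex.ext h1.symm h2)
  · left
    simp only [Complex.add_re, Complex.sub_re, Complex.one_re, Complex.ofReal_re,
      Complex.re_ofReal_mul]
    nlinarith [mul_nonneg hs.1 hre]

theorem hasDerivAt_sum_log {m : Multiset ℂ} (hm : ∀ μ ∈ m, 0 ≤ μ.re ∧ μ ≠ 0) {s : ℝ}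
    (hs : s ∈ Set.Icc (0 : ℝ) 1) :
    HasDerivAt (fun s : ℝ => (m.map fun μ => Complex.log (1 - s + s * μ)).sum)
      (m.map fun μ => ((μ - 1) / (1 - s + s * μ) : ℂ)).sum s := by
  induction m using Multiset.induction with
  | empty => simpa using hasDerivAt_const s (0 : ℂ)
  | cons μ m ih =>
    simp only [Multiset.map_cons, Multiset.sum_cons]
    refine HasDerivAt.add ?_ (ih fun ν hν => hm ν (Multiset.mem_cons_of_mem hν))
    have h1 := hm μ (Multiset.mem_cons_self _ _)
    refine HasDerivAt.clog_real ?_ (segment_factor_mem_slitPlane h1.1 h1.2 hs)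
    have h2 : HasDerivAt (fun s : ℝ => (s : ℂ)) 1 s := (hasDerivAt_id s).ofReal_comp
    exact ((h2.const_sub 1).add (h2.mul_const μ)).congr_deriv (by ring)

/-- Let `Φ(s)` be the sum of the principal logarithms of `1 - s + s μ`. Since `exp Φ` is the
determinant along the segment, `Φ'` is the trace in Jacobi's formula. With `Φ(0) = 0`, the integral
of `τ` is `Φ(1) / 2`. -/
theorem exp_neg_integral_trace {A : Matrix (Fin n) (Fin n) ℂ}
    (hA : ∀ μ ∈ A.charpoly.roots, 0 ≤ μ.re ∧ μ ≠ 0) {τ : ℝ → ℂ} (hτ : Continuous τ)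
    (h : ∀ s ∈ Set.Icc (0 : ℝ) 1, τ s = 1 / 2 * ((A - 1) * (segment A s)⁻¹).trace) :
    Complex.exp (-∫ s in (0 : ℝ)..1, τ s) = invSqrtDet A := by
  set Φ : ℝ → ℂ := fun s => (A.charpoly.roots.map fun μ => Complex.log (1 - s + s * μ)).sum with hΦ
  have hexp : ∀ s ∈ Set.Icc (0 : ℝ) 1, Complex.exp (Φ s) = (segment A s).det := by
    intro s hs
    rw [hΦ, Complex.exp_multiset_sum, Multiset.map_map, det_segment]
    refine congrArg _ (Multiset.map_congr rfl fun μ hμ => ?_)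
    exact Complex.exp_log (Complex.slitPlane_ne_zero
      (segment_factor_mem_slitPlane (hA μ hμ).1 (hA μ hμ).2 hs))
  -- Only the open interval is used here: the identity `exp Φ = det` is known on `[0, 1]`, and
  -- comparing derivatives needs it in a neighbourhood of `s`.
  have hder : ∀ s ∈ Set.Ioo (0 : ℝ) 1, HasDerivAt Φ (2 * τ s) s := by
    intro s hs
    have hs' : s ∈ Set.Icc (0 : ℝ) 1 := ⟨hs.1.le, hs.2.le⟩
    have h0 : (segment A s).det ≠ 0 := by rw [← hexp s hs']; exact Complex.exp_ne_zero _
    have h1 := hasDerivAt_sum_log hA hs'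
    have h2 := h1.cexp.congr_of_eventuallyEq (f₁ := fun s => (segment A s).det) (by
      filter_upwards [Ioo_mem_nhds hs.1 hs.2] with t ht
      exact (hexp t ⟨ht.1.le, ht.2.le⟩).symm)
    have h3 := h2.unique (hasDerivAt_det_segment h0)
    rw [← hexp s hs'] at h3
    have h4 := mul_left_cancel₀ (Complex.exp_ne_zero _) h3
    refine h1.congr_deriv ?_
    rw [h4, h s hs']
    ring
  have hcont : ContinuousOn Φ (Set.Icc 0 1) := fun s hs =>
    (hasDerivAt_sum_log hA hs).continuousAt.continuousWithinAt
  have h1 := intervalIntegral.integral_eq_sub_of_hasDerivAt_of_le zero_le_one hcont hder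
    ((continuous_const.mul hτ).intervalIntegrable _ _)
  rw [intervalIntegral.integral_const_mul] at h1
  have h2 : Φ 0 = 0 := by simp [hΦ]
  have h3 : -∫ s in (0 : ℝ)..1, τ s = (A.charpoly.roots.map fun μ => -(1 / 2) * Complex.log μ).sum := by
    rw [Multiset.sum_map_mul_left]
    have : Φ 1 = (A.charpoly.roots.map Complex.log).sum := by simp [hΦ]
    rw [← this]
    rw [h2] at h1
    linear_combination (-1 / 2 : ℂ) * h1
  rw [h3, Complex.exp_multiset_sum, Multiset.map_map, invSqrtDet]
  refine congrArg _ (Multiset.map_congr rfl fun μ hμ => ?_)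
  rw [Function.comp_apply, Complex.cpow_def_of_ne_zero (hA μ hμ).2, mul_comm]

/-- The eigenvalues of a symmetric matrix with nonnegative real part lie in the closed right half
plane. -/
theorem re_nonneg_of_mem_roots_charpoly {A : Matrix (Fin n) (Fin n) ℂ} (hA : Aᵀ = A)
    (hre : ∀ x : Fin n → ℝ, 0 ≤ (∑ i, ∑ j, (x i : ℂ) * A i j * x j).re) {μ : ℂ}
    (hμ : μ ∈ A.charpoly.roots) : 0 ≤ μ.re := by
  have h1 : A.charpoly.eval μ = 0 := (Polynomial.mem_roots'.1 hμ).2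
  rw [Matrix.eval_charpoly] at h1
  obtain ⟨v, hv0, hv⟩ := Matrix.exists_mulVec_eq_zero_iff.2 h1
  have hAv : ∀ i, ∑ j, A i j * v j = μ * v i := by
    intro i
    have := congrFun hv i
    rw [Matrix.sub_mulVec] at this
    simp only [Pi.sub_apply, Pi.zero_apply, Matrix.scalar_apply, Matrix.mulVec_diagonal] at this
    exact (sub_eq_zero.1 this).symm
  have h2 : ∑ i, ∑ j, (starRingEnd ℂ (v i)) * A i j * v j = μ * ∑ i, (Complex.normSq (v i) : ℂ) := by
    rw [Finset.mul_sum]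
    refine Finset.sum_congr rfl fun i _ => ?_
    rw [Complex.normSq_eq_conj_mul_self, show μ * (starRingEnd ℂ (v i) * v i) =
      starRingEnd ℂ (v i) * (μ * v i) by ring, ← hAv, Finset.mul_sum]
    exact Finset.sum_congr rfl fun j _ => by ring
  have h3 : ∑ i, ∑ j, (starRingEnd ℂ (v i)) * A i j * v j =
      (∑ i, ∑ j, (((v i).re : ℝ) : ℂ) * A i j * ((v j).re : ℝ)) +
      ∑ i, ∑ j, (((v i).im : ℝ) : ℂ) * A i j * ((v j).im : ℝ) := by
    -- The matrix is symmetric without conjugation. With `v = p + i q` this cancels the cross terms,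
    -- so `v* A v` is the sum of the form at the real vectors `p` and `q`.
    have h4 : ∑ i, ∑ j, (((v i).re : ℝ) : ℂ) * A i j * ((v j).im : ℝ) =
        ∑ i, ∑ j, (((v i).im : ℝ) : ℂ) * A i j * ((v j).re : ℝ) := by
      rw [Finset.sum_comm]
      refine Finset.sum_congr rfl fun i _ => Finset.sum_congr rfl fun j _ => ?_
      rw [show A j i = A i j from congrFun (congrFun hA i) j]
      ring
    have h5 : ∀ i j, (starRingEnd ℂ (v i)) * A i j * v j =
        (((v i).re : ℝ) : ℂ) * A i j * ((v j).re : ℝ) + (((v i).im : ℝ) : ℂ) * A i j * ((v j).im : ℝ)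
        + Complex.I * ((((v i).re : ℝ) : ℂ) * A i j * ((v j).im : ℝ)
          - (((v i).im : ℝ) : ℂ) * A i j * ((v j).re : ℝ)) := by
      intro i j
      have e1 : starRingEnd ℂ (v i) = ((v i).re : ℂ) - (v i).im * Complex.I := by
        apply Complex.ext <;> simp
      have e2 : v j = ((v j).re : ℂ) + (v j).im * Complex.I := (Complex.re_add_im (v j)).symm
      rw [e1]
      conv_lhs => rw [e2]
      linear_combination (-((v i).im : ℂ) * A i j * (v j).im) * Complex.I_sq
    simp only [h5, Finset.sum_add_distrib, ← Finset.mul_sum, Finset.sum_sub_distrib]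
    rw [h4]; ring
  have h6 : 0 < ∑ i, Complex.normSq (v i) := by
    obtain ⟨i, hi⟩ := Function.ne_iff.1 hv0
    exact Finset.sum_pos' (fun i _ => Complex.normSq_nonneg _)
      ⟨i, Finset.mem_univ _, Complex.normSq_pos.2 hi⟩
  have h7 : 0 ≤ (μ * ∑ i, (Complex.normSq (v i) : ℂ)).re := by
    rw [← h2, h3, Complex.add_re]
    exact add_nonneg (hre _) (hre _)
  rw [← Complex.ofReal_sum, Complex.re_mul_ofReal] at h7
  exact nonneg_of_mul_nonneg_left h7 h6

end

section

/-! ### Vanishing orders -/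

/-- `u (s, ·)` vanishes to order `m` at the origin, for every `s`. -/
def VanishesTo : ℕ → (ℝ × (Fin n → ℝ) → ℂ) → Prop
  | 0, _ => True
  | m + 1, u => (∀ s, u (s, 0) = 0) ∧ ∀ j, VanishesTo m (partialX j u)

theorem partialX_add {u v : ℝ × (Fin n → ℝ) → ℂ} (hu : ContDiff ℝ ∞ u) (hv : ContDiff ℝ ∞ v)
    (j : Fin n) : partialX j (fun p => u p + v p) = fun p => partialX j u p + partialX j v p := by
  ext p
  simp only [partialX]
  rw [fderiv_fun_add (hu.differentiable (by simp) p) (hv.differentiable (by simp) p)]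
  rfl

theorem partialX_mul {u v : ℝ × (Fin n → ℝ) → ℂ} (hu : ContDiff ℝ ∞ u) (hv : ContDiff ℝ ∞ v)
    (j : Fin n) :
    partialX j (fun p => u p * v p) = fun p => partialX j u p * v p + u p * partialX j v p := by
  ext p
  simp only [partialX]
  rw [fderiv_fun_mul (hu.differentiable (by simp) p) (hv.differentiable (by simp) p)]
  simp only [_root_.add_apply, _root_.smul_apply, smul_eq_mul]
  ring

theorem partialX_sum {ι : Type} (t : Finset ι) {u : ι → ℝ × (Fin n → ℝ) → ℂ}
    (hu : ∀ i, ContDiff ℝ ∞ (u i)) (j : Fin n) :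
    partialX j (fun p => ∑ i ∈ t, u i p) = fun p => ∑ i ∈ t, partialX j (u i) p := by
  ext p
  simp only [partialX]
  rw [fderiv_fun_sum fun i _ => (hu i).differentiable (by simp) p]
  simp

theorem VanishesTo.of_succ {m : ℕ} {u : ℝ × (Fin n → ℝ) → ℂ} (h : VanishesTo (m + 1) u) :
    VanishesTo m u := by
  induction m generalizing u with
  | zero => trivial
  | succ m ih => exact ⟨h.1, fun j => ih (h.2 j)⟩

theorem VanishesTo.partialX {m : ℕ} {u : ℝ × (Fin n → ℝ) → ℂ} (h : VanishesTo m u) (j : Fin n) :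
    VanishesTo (m - 1) (partialX j u) := by
  cases m with
  | zero => trivial
  | succ m => exact h.2 j

theorem VanishesTo.add {m : ℕ} {u v : ℝ × (Fin n → ℝ) → ℂ} (hu : ContDiff ℝ ∞ u)
    (hv : ContDiff ℝ ∞ v) (h : VanishesTo m u) (h' : VanishesTo m v) :
    VanishesTo m fun p => u p + v p := by
  induction m generalizing u v with
  | zero => trivial
  | succ m ih =>
    refine ⟨fun s => by simp only [h.1, h'.1, add_zero], fun j => ?_⟩
    rw [partialX_add hu hv]
    exact ih (contDiff_partialX hu j) (contDiff_partialX hv j) (h.2 j) (h'.2 j)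

theorem VanishesTo.zero (m : ℕ) : VanishesTo m fun _ : ℝ × (Fin n → ℝ) => 0 := by
  induction m with
  | zero => trivial
  | succ m ih =>
    refine ⟨fun _ => rfl, fun j => ?_⟩
    have : SmoothPoint.partialX j (fun _ : ℝ × (Fin n → ℝ) => (0 : ℂ)) = fun _ => 0 := by
      ext p; simp [SmoothPoint.partialX]
    rwa [this]

theorem VanishesTo.sum {ι : Type} (t : Finset ι) {m : ℕ} {u : ι → ℝ × (Fin n → ℝ) → ℂ}
    (hu : ∀ i, ContDiff ℝ ∞ (u i)) (h : ∀ i, VanishesTo m (u i)) :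
    VanishesTo m fun p => ∑ i ∈ t, u i p := by
  induction t using Finset.induction_on with
  | empty => simpa using VanishesTo.zero m
  | insert i t hi ih =>
    simp only [Finset.sum_insert hi]
    exact (h i).add (hu i) (ContDiff.sum fun i _ => hu i) ih

theorem VanishesTo.mul_right {m : ℕ} {u v : ℝ × (Fin n → ℝ) → ℂ} (hu : ContDiff ℝ ∞ u)
    (hv : ContDiff ℝ ∞ v) (h : VanishesTo m u) : VanishesTo m fun p => u p * v p := by
  induction m generalizing u v with
  | zero => trivial
  | succ m ih =>
    refine ⟨fun s => by simp only [h.1, zero_mul], fun j => ?_⟩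
    rw [partialX_mul hu hv]
    exact (ih (contDiff_partialX hu j) hv (h.2 j)).add ((contDiff_partialX hu j).mul hv)
      (hu.mul (contDiff_partialX hv j)) (ih hu (contDiff_partialX hv j) h.of_succ)

theorem VanishesTo.radialMean {m : ℕ} {u : ℝ × (Fin n → ℝ) → ℂ} (hu : ContDiff ℝ ∞ u)
    (h : VanishesTo m u) (k : ℕ) : VanishesTo m (radialMean k u) := by
  induction m generalizing u k with
  | zero => trivial
  | succ m ih =>
    refine ⟨fun s => by rw [radialMean_zero, h.1, zero_div], fun j => ?_⟩
    rw [partialX_radialMean hu]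
    exact ih (contDiff_partialX hu j) (h.2 j) (k + 1)

namespace PhaseFamily

variable (P : PhaseFamily n)

/-- One order is lost to the gradient of `u` inside the field and one to the divergence of the
field; radial means and smooth factors lose none. -/
theorem vanishesTo_transport {m : ℕ} {u : ℝ × (Fin n → ℝ) → ℂ} (hu : ContDiff ℝ ∞ u)
    (h : VanishesTo m u) : VanishesTo (m - 2) (P.transport u) := by
  refine VanishesTo.sum _ (fun k => contDiff_partialX (P.contDiff_field hu k) k) fun k => ?_
  refine VanishesTo.partialX (m := m - 1) ?_ k
  have hr := fun j => contDiff_radialMean (contDiff_partialX hu j) 0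
  exact VanishesTo.sum _ (fun j => (hr j).mul (P.contDiff_W j k)) fun j =>
    ((h.partialX j).radialMean (contDiff_partialX hu j) 0).mul_right (hr j) (P.contDiff_W j k)

theorem iterate_transport_eq_zero {m k : ℕ} {u : ℝ × (Fin n → ℝ) → ℂ} (hu : ContDiff ℝ ∞ u)
    (h : VanishesTo m u) (hk : 2 * k < m) (s : ℝ) : P.transport^[k] u (s, 0) = 0 := by
  induction k generalizing u m with
  | zero =>
    obtain ⟨m, rfl⟩ := Nat.exists_eq_add_of_lt hk
    have h' : VanishesTo (m + 1) u := by simpa using h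
    exact h'.1 s
  | succ k ih =>
    rw [Function.iterate_succ_apply]
    exact ih (P.contDiff_transport hu) (P.vanishesTo_transport hu h) (by omega)

end PhaseFamily

/-! ### The family joining a phase to the standard quadratic form -/

/-- The partial derivative in a coordinate direction. -/
def coordDeriv (j : Fin n) (f : (Fin n → ℝ) → ℂ) (x : Fin n → ℝ) : ℂ :=
  fderiv ℝ f x (Pi.single j 1)

theorem contDiff_coordDeriv {f : (Fin n → ℝ) → ℂ} (hf : ContDiff ℝ ∞ f) (j : Fin n) :
    ContDiff ℝ ∞ (coordDeriv j f) :=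
  (hf.fderiv_right (m := ∞) (by simp)).clm_apply contDiff_const

/-- Linear interpolation between two functions. -/
def blend (a b : (Fin n → ℝ) → ℂ) (p : ℝ × (Fin n → ℝ)) : ℂ := (1 - p.1) * a p.2 + p.1 * b p.2

theorem contDiff_blend {a b : (Fin n → ℝ) → ℂ} (ha : ContDiff ℝ ∞ a) (hb : ContDiff ℝ ∞ b) :
    ContDiff ℝ ∞ (blend a b) := by
  have h : ContDiff ℝ ∞ fun p : ℝ × (Fin n → ℝ) => (p.1 : ℂ) :=
    Complex.ofRealCLM.contDiff.comp contDiff_fst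
  exact ((contDiff_const.sub h).mul (ha.comp contDiff_snd)).add (h.mul (hb.comp contDiff_snd))

theorem partialX_blend {a b : (Fin n → ℝ) → ℂ} (ha : ContDiff ℝ ∞ a) (hb : ContDiff ℝ ∞ b)
    (j : Fin n) : partialX j (blend a b) = blend (coordDeriv j a) (coordDeriv j b) := by
  ext ⟨s, x⟩
  have h : HasFDerivAt (fun x => blend a b (s, x))
      ((1 - s : ℂ) • fderiv ℝ a x + (s : ℂ) • fderiv ℝ b x) x :=
    ((ha.differentiable (by simp) x).hasFDerivAt.const_mul (1 - s : ℂ)).add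
      ((hb.differentiable (by simp) x).hasFDerivAt.const_mul (s : ℂ))
  rw [← fderiv_slice (contDiff_blend ha hb), h.fderiv]
  simp [blend, coordDeriv]

theorem partialS_blend {a b : (Fin n → ℝ) → ℂ} (ha : ContDiff ℝ ∞ a) (hb : ContDiff ℝ ∞ b) :
    partialS (blend a b) = blend (fun x => b x - a x) (fun x => b x - a x) := by
  ext ⟨s, x⟩
  have h1 : HasDerivAt (fun s : ℝ => (s : ℂ)) 1 s := (hasDerivAt_id s).ofReal_comp
  have h : HasDerivAt (fun s => blend a b (s, x)) (-1 * a x + 1 * b x) s :=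
    ((h1.const_sub 1).mul_const (a x)).add (h1.mul_const (b x))
  rw [(hasDerivAt_partialS (contDiff_blend ha hb) s x).unique h]
  simp only [blend]
  ring

/-- The standard quadratic form. -/
def quad (x : Fin n → ℝ) : ℂ := ((∑ i, x i ^ 2) / 2 : ℝ)

theorem contDiff_quad : ContDiff ℝ ∞ (quad (n := n)) :=
  Complex.ofRealCLM.contDiff.comp
    (ContDiff.div_const (f := fun x : Fin n → ℝ => ∑ i, x i ^ 2) (by fun_prop) 2)

theorem coordDeriv_coe (i j : Fin n) :
    coordDeriv i (fun x : Fin n → ℝ => (x j : ℂ)) = fun _ => (1 : Matrix (Fin n) (Fin n) ℂ) i j := by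
  ext x
  have h : HasFDerivAt (fun x : Fin n → ℝ => (x j : ℂ))
      (Complex.ofRealCLM.comp (ContinuousLinearMap.proj (R := ℝ) (φ := fun _ : Fin n => ℝ) j)) x :=
    (Complex.ofRealCLM.comp (ContinuousLinearMap.proj (R := ℝ) (φ := fun _ : Fin n => ℝ) j)).hasFDerivAt
  rw [coordDeriv, h.fderiv]
  by_cases hij : i = j <;> simp [Matrix.one_apply, hij, eq_comm]

theorem coordDeriv_quad (j : Fin n) : coordDeriv j (quad (n := n)) = fun x => (x j : ℂ) := by
  ext x
  have h : HasFDerivAt (quad (n := n)) (Complex.ofRealCLM.comp ((1 / 2 : ℝ) •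
      ∑ i, (2 * x i) • ContinuousLinearMap.proj (R := ℝ) (φ := fun _ : Fin n => ℝ) i)) x := by
    refine Complex.ofRealCLM.hasFDerivAt.comp x ?_
    have h1 : HasFDerivAt (fun x : Fin n → ℝ => ∑ i, x i ^ 2)
        (∑ i, (2 * x i) • ContinuousLinearMap.proj (R := ℝ) (φ := fun _ : Fin n => ℝ) i) x := by
      refine HasFDerivAt.fun_sum fun i _ => ?_
      have := (ContinuousLinearMap.proj (R := ℝ) (φ := fun _ : Fin n => ℝ) i).hasFDerivAt
        (x := x) |>.pow 2
      simpa using this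
    have h2 := h1.const_mul (1 / 2 : ℝ)
    refine h2.congr_of_eventuallyEq (.of_forall fun y => ?_)
    change (∑ i, y i ^ 2) / 2 = 1 / 2 * ∑ i, y i ^ 2
    ring
  rw [coordDeriv, h.fderiv]
  simp [Pi.single_apply]

theorem hessian_apply (f : (Fin n → ℝ) → ℂ) (x : Fin n → ℝ) (i j : Fin n) :
    hessian f x i j = coordDeriv i (coordDeriv j f) x := rfl

theorem transpose_hessian {f : (Fin n → ℝ) → ℂ} (hf : ContDiff ℝ ∞ f) (x : Fin n → ℝ) :
    (hessian f x)ᵀ = hessian f x := by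
  have hf' : ContDiff ℝ ∞ (fderiv ℝ f) := hf.fderiv_right (m := ∞) (by simp)
  have key : ∀ i j, coordDeriv i (coordDeriv j f) x =
      fderiv ℝ (fderiv ℝ f) x (Pi.single i 1) (Pi.single j 1) := by
    intro i j
    have h := ((hf'.differentiable (by simp) x).hasFDerivAt).clm_apply
      (hasFDerivAt_const (Pi.single j 1 : Fin n → ℝ) x)
    change fderiv ℝ (fun y => fderiv ℝ f y (Pi.single j 1)) x (Pi.single i 1) = _
    rw [h.fderiv]
    simp
  ext i j
  rw [Matrix.transpose_apply, hessian_apply, hessian_apply, key, key]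
  exact second_derivative_symmetric (fun y => (hf.differentiable (by simp) y).hasFDerivAt)
    (hf'.differentiable (by simp) x).hasFDerivAt _ _

/-- A function with nonnegative real part that vanishes to second order at the origin has a
Hessian with positive semidefinite real part. -/
theorem re_hessian_nonneg {f : (Fin n → ℝ) → ℂ} (hf : ContDiff ℝ ∞ f) (h0 : f 0 = 0)
    (h1 : ∀ j, coordDeriv j f 0 = 0) {r : ℝ} (hr : 0 < r) (hre : ∀ x, ‖x‖ ≤ r → 0 ≤ (f x).re)
    (x : Fin n → ℝ) : 0 ≤ (∑ i, ∑ j, (x i : ℂ) * hessian f 0 i j * x j).re := by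
  -- `blend f f` is `f` with a dummy parameter, so that the radial means apply.
  have hb := contDiff_blend hf hf
  have hp : ∀ j, ContDiff ℝ ∞ (radialMean 0 (partialX j (blend f f))) := fun j =>
    contDiff_radialMean (contDiff_partialX hb j) 0
  set R : Fin n → Fin n → (Fin n → ℝ) → ℂ := fun j k y =>
    radialMean 0 (partialX k (radialMean 0 (partialX j (blend f f)))) (0, y) with hR
  have hRc : ∀ j k, Continuous (R j k) := fun j k =>
    (contDiff_radialMean (contDiff_partialX (hp j) k) 0).continuous.comp (by fun_prop)
  have hb0 : ∀ y, blend f f (0, y) = f y := fun y => by simp [blend]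
  have hf2 : ∀ y, f y = ∑ j, ∑ k, (y j : ℂ) * R j k y * y k := by
    intro y
    have e1 := sub_eq_sum_mul_radialMean hb 0 y
    rw [hb0, hb0, h0, sub_zero] at e1
    rw [e1]
    refine Finset.sum_congr rfl fun j _ => ?_
    have e2 := sub_eq_sum_mul_radialMean (hp j) 0 y
    have e3 : radialMean 0 (partialX j (blend f f)) (0, 0) = 0 := by
      rw [radialMean_zero, partialX_blend hf hf]
      simp [blend, h1]
    rw [e3, sub_zero] at e2
    rw [e2, Finset.mul_sum]
    exact Finset.sum_congr rfl fun k _ => by ring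
  have hR0 : ∀ j k, R j k 0 = hessian f 0 k j / 2 := by
    intro j k
    simp only [hR]
    rw [radialMean_zero, partialX_radialMean (contDiff_partialX hb j), radialMean_zero,
      partialX_blend hf hf, partialX_blend (contDiff_coordDeriv hf j) (contDiff_coordDeriv hf j),
      hessian_apply]
    simp [blend]
    norm_num
  -- For small `t > 0`, `Q t` is the real part of `f (t • x) / t ^ 2`, hence nonnegative. It extends
  -- continuously to `t = 0`, where it is half the Hessian form.
  set Q : ℝ → ℝ := fun t => (∑ j, ∑ k, (x j : ℂ) * R j k (t • x) * x k).re with hQ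
  have hQc : Continuous Q := Complex.continuous_re.comp <|
    continuous_finsetSum _ fun j _ => continuous_finsetSum _ fun k _ =>
      (continuous_const.mul ((hRc j k).comp (by fun_prop))).mul continuous_const
  have hQ0 : 0 ≤ Q 0 := by
    refine ge_of_tendsto (hQc.continuousAt.tendsto.mono_left nhdsWithin_le_nhds : Tendsto Q (𝓝[>] 0) _) ?_
    have h2 : ∀ᶠ t in 𝓝[>] (0 : ℝ), ‖t • x‖ ≤ r := by
      have : Tendsto (fun t : ℝ => ‖t • x‖) (𝓝[>] 0) (𝓝 ‖(0 : ℝ) • x‖) :=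
        (Continuous.tendsto (by fun_prop) 0).mono_left nhdsWithin_le_nhds
      exact (this.eventually_lt_const (by simpa using hr)).mono fun t ht => ht.le
    filter_upwards [h2, self_mem_nhdsWithin] with t ht ht0
    have ht0' : (0 : ℝ) < t := ht0
    have h3 := hre _ ht
    have h4 : f (t • x) = ((t ^ 2 : ℝ) : ℂ) * ∑ j, ∑ k, (x j : ℂ) * R j k (t • x) * x k := by
      rw [hf2, Finset.mul_sum]
      refine Finset.sum_congr rfl fun j _ => ?_
      rw [Finset.mul_sum]
      refine Finset.sum_congr rfl fun k _ => ?_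
      simp only [Pi.smul_apply, smul_eq_mul, Complex.ofReal_mul, Complex.ofReal_pow]
      ring
    rw [h4, Complex.re_ofReal_mul] at h3
    exact nonneg_of_mul_nonneg_right h3 (by positivity)
  have h5 : Q 0 = (1 / 2) * (∑ i, ∑ j, (x i : ℂ) * hessian f 0 i j * x j).re := by
    simp only [hQ, zero_smul, hR0]
    rw [← Complex.re_ofReal_mul]
    congr 1
    rw [Finset.mul_sum]
    refine Finset.sum_congr rfl fun j _ => ?_
    rw [Finset.mul_sum]
    refine Finset.sum_congr rfl fun k _ => ?_
    rw [show hessian f 0 k j = hessian f 0 j k from congrFun (congrFun (transpose_hessian hf 0) j) k]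
    push_cast
    ring
  linarith

end

/-! ### Construction of the family from the quadratic form to a given phase -/

section

/-- Take the conjugate of `w` divided by a smooth interpolation between `1`, for small `|w|²`, and
`|w|²`, for `|w|² ≥ δ`; that denominator never vanishes. A globally smooth substitute is needed
because the fields of `PhaseFamily` are smooth everywhere. -/
theorem exists_smooth_inverse {δ : ℝ} (hδ : 0 < δ) :
    ∃ ι : ℂ → ℂ, ContDiff ℝ ∞ ι ∧ ∀ w, δ ≤ Complex.normSq w → ι w * w = 1 := by
  set S : ℝ → ℝ := fun y => Real.smoothTransition (2 * y / δ - 1) with hS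
  have hSc : ContDiff ℝ ∞ S := Real.smoothTransition.contDiff.comp
    (((contDiff_const.mul contDiff_id).div_const δ).sub contDiff_const)
  have hg : ContDiff ℝ ∞ fun y : ℝ => y * S y + (1 - S y) :=
    (contDiff_id.mul hSc).add (contDiff_const.sub hSc)
  have hg0 : ∀ y : ℝ, 0 ≤ y → y * S y + (1 - S y) ≠ 0 := by
    intro y hy
    have h0 : 0 ≤ S y := Real.smoothTransition.nonneg _
    have h1 : S y ≤ 1 := Real.smoothTransition.le_one _
    rcases le_or_gt y (δ / 2) with h | h
    · have : S y = 0 := Real.smoothTransition.zero_of_nonpos (by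
        rw [sub_nonpos, div_le_one hδ]; linarith)
      rw [this]; norm_num
    · have h2 : 0 < y := by linarith
      rcases h0.eq_or_lt with h3 | h3
      · rw [← h3]; norm_num
      · have := mul_pos h2 h3
        linarith
  have hn : ContDiff ℝ ∞ Complex.normSq := by
    have : (Complex.normSq : ℂ → ℝ) = fun w => w.re * w.re + w.im * w.im := by
      ext w; exact Complex.normSq_apply w
    rw [this]
    exact (Complex.reCLM.contDiff.mul Complex.reCLM.contDiff).add
      (Complex.imCLM.contDiff.mul Complex.imCLM.contDiff)
  refine ⟨fun w => starRingEnd ℂ w *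
    (((Complex.normSq w * S (Complex.normSq w) + (1 - S (Complex.normSq w)))⁻¹ : ℝ) : ℂ), ?_, ?_⟩
  · exact Complex.conjCLE.contDiff.mul (Complex.ofRealCLM.contDiff.comp
      ((hg.comp hn).inv fun w => hg0 _ (Complex.normSq_nonneg w)))
  · intro w hw
    have h1 : S (Complex.normSq w) = 1 := Real.smoothTransition.one_of_one_le (by
      rw [le_sub_iff_add_le, le_div_iff₀ hδ]; linarith)
    have h2 : (Complex.normSq w : ℂ) ≠ 0 := by
      have : Complex.normSq w ≠ 0 := by linarith
      exact_mod_cast this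
    simp only [h1, mul_one, sub_self, add_zero]
    rw [mul_right_comm, ← Complex.normSq_eq_conj_mul_self, Complex.ofReal_inv, mul_inv_cancel₀ h2]

theorem contDiff_det {M : ℝ × (Fin n → ℝ) → Matrix (Fin n) (Fin n) ℂ}
    (hM : ∀ i j, ContDiff ℝ ∞ fun p => M p i j) : ContDiff ℝ ∞ fun p => (M p).det := by
  simp only [Matrix.det_apply]
  exact ContDiff.sum fun σ _ => (contDiff_prod fun i _ => hM _ _).const_smul _

/-- On the compact set of points `(s, 0)` the determinant is bounded away from zero. The tube lemma
extends this to a ball of radius independent of `s`, where the adjugate times the smooth reciprocal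
of the determinant is the inverse. -/
theorem exists_smooth_matrix_inverse {M : ℝ × (Fin n → ℝ) → Matrix (Fin n) (Fin n) ℂ}
    (hM : ∀ i j, ContDiff ℝ ∞ fun p => M p i j)
    (hdet : ∀ s ∈ Set.Icc (0 : ℝ) 1, (M (s, 0)).det ≠ 0) {r : ℝ} (hr : 0 < r) :
    ∃ ρ, 0 < ρ ∧ ρ ≤ r ∧ ∃ W : ℝ × (Fin n → ℝ) → Matrix (Fin n) (Fin n) ℂ,
      (∀ i j, ContDiff ℝ ∞ fun p => W p i j) ∧
      ∀ s ∈ Set.Icc (0 : ℝ) 1, ∀ x, ‖x‖ ≤ ρ → W (s, x) * M (s, x) = 1 := by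
  have hD := contDiff_det hM
  have hDc : Continuous fun p => Complex.normSq (M p).det :=
    Complex.continuous_normSq.comp hD.continuous
  have hK : IsCompact (Set.Icc (0 : ℝ) 1 ×ˢ {(0 : Fin n → ℝ)}) := isCompact_Icc.prod isCompact_singleton
  obtain ⟨δ, hδ0, hδ⟩ := hK.exists_forall_le' (a := 0) hDc.continuousOn (by
    rintro ⟨s, x⟩ ⟨hs, hx⟩
    obtain rfl : x = 0 := hx
    exact Complex.normSq_pos.2 (hdet s hs))
  obtain ⟨u, v, -, hv, hu, h0v, huv⟩ := generalized_tube_lemma isCompact_Icc isCompact_singleton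
    (isOpen_lt (continuous_const (y := δ / 2)) hDc)
    (fun p hp => show δ / 2 < Complex.normSq (M p).det by have := hδ p hp; linarith :
      Set.Icc (0 : ℝ) 1 ×ˢ {(0 : Fin n → ℝ)} ⊆ _)
  obtain ⟨ε, hε, hεv⟩ := Metric.isOpen_iff.1 hv 0 (h0v rfl)
  obtain ⟨ι, hι, hι1⟩ := exists_smooth_inverse (half_pos hδ0)
  refine ⟨min r (ε / 2), lt_min hr (half_pos hε), min_le_left _ _,
    fun p => ι (M p).det • (M p).adjugate, fun i j => ?_, fun s hs x hx => ?_⟩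
  · simp only [Matrix.smul_apply, smul_eq_mul, Matrix.adjugate_apply]
    refine (hι.comp hD).mul (contDiff_det fun k l => ?_)
    by_cases hk : k = j
    · simp only [Matrix.updateRow_apply, hk, if_true]
      exact contDiff_const
    · simp only [Matrix.updateRow_apply, hk, if_false]
      exact hM k l
  · have hx' : x ∈ v := hεv (by
      rw [mem_ball_zero_iff]
      have := hx.trans (min_le_right _ _)
      linarith)
    have h1 : δ / 2 < Complex.normSq (M (s, x)).det := huv ⟨hu hs, hx'⟩
    rw [Matrix.smul_mul, Matrix.adjugate_mul, smul_smul, hι1 _ h1.le, one_smul]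

/-- The family of phases from the standard quadratic form to `f`. -/
theorem exists_phaseFamily {f : (Fin n → ℝ) → ℂ} (hf : ContDiff ℝ ∞ f) (h0 : f 0 = 0)
    (h1 : ∀ j, coordDeriv j f 0 = 0) (hdet : (hessian f 0).det ≠ 0) {r : ℝ} (hr : 0 < r)
    (hpos : ∀ x, x ≠ 0 → ‖x‖ ≤ r → 0 < (f x).re) :
    ∃ P : PhaseFamily n, P.F = blend quad f ∧ P.radius ≤ r ∧
      Complex.exp (-P.logCoeff 0) = invSqrtDet (hessian f 0) := by
  set A := hessian f 0 with hAdef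
  have hA : Aᵀ = A := transpose_hessian hf 0
  have hnn : ∀ x, ‖x‖ ≤ r → 0 ≤ (f x).re := fun x hx => by
    rcases eq_or_ne x 0 with rfl | h
    · simp [h0]
    · exact (hpos x h hx).le
  have hroots : ∀ μ ∈ A.charpoly.roots, 0 ≤ μ.re ∧ μ ≠ 0 := fun μ hμ =>
    ⟨re_nonneg_of_mem_roots_charpoly hA (re_hessian_nonneg hf h0 h1 hr hnn) hμ, fun hμ0 => by
      refine hdet ?_
      rw [Matrix.det_eq_prod_roots_charpoly]
      exact Multiset.prod_eq_zero (hμ0 ▸ hμ)⟩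
  have hseg : ∀ s ∈ Set.Icc (0 : ℝ) 1, (segment A s).det ≠ 0 := by
    intro s hs
    rw [det_segment]
    refine Multiset.prod_ne_zero fun h => ?_
    obtain ⟨μ, hμ, hμ0⟩ := Multiset.mem_map.1 h
    exact Complex.slitPlane_ne_zero
      (segment_factor_mem_slitPlane (hroots μ hμ).1 (hroots μ hμ).2 hs) hμ0
  have hF : ContDiff ℝ ∞ (blend quad f) := contDiff_blend contDiff_quad hf
  -- The gradient of the phase at `(s, x)` is `M (s, x)` applied to `x`, by Hadamard's lemma and the
  -- vanishing of the gradient at the origin. At `x = 0` this matrix is the point `s` of the segment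
  -- from the identity to `A`.
  set M : ℝ × (Fin n → ℝ) → Matrix (Fin n) (Fin n) ℂ := fun p => Matrix.of fun k l =>
    radialMean 0 (partialX l (partialX k (blend quad f))) p with hM
  have hMc : ∀ i j, ContDiff ℝ ∞ fun p => M p i j := fun i j =>
    contDiff_radialMean (contDiff_partialX (contDiff_partialX hF i) j) 0
  have hM0 : ∀ s : ℝ, M (s, 0) = segment A s := by
    intro s
    ext k l
    simp only [hM, Matrix.of_apply]
    rw [radialMean_zero, partialX_blend contDiff_quad hf, partialX_blend
      (contDiff_coordDeriv contDiff_quad k) (contDiff_coordDeriv hf k), coordDeriv_quad,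
      coordDeriv_coe]
    have : coordDeriv l (coordDeriv k f) 0 = A k l := congrFun (congrFun hA k) l
    simp only [blend, segment, this, Matrix.add_apply, Matrix.smul_apply, smul_eq_mul]
    rw [show (1 : Matrix (Fin n) (Fin n) ℂ) l k = (1 : Matrix (Fin n) (Fin n) ℂ) k l by
      simp [Matrix.one_apply, eq_comm]]
    simp
  obtain ⟨ρ, hρ0, hρr, W, hW, hWM⟩ := exists_smooth_matrix_inverse hMc
    (fun s hs => by rw [hM0]; exact hseg s hs) hr
  have hre : ∀ s ∈ Set.Icc (0 : ℝ) 1, ∀ x, (blend quad f (s, x)).re =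
      (1 - s) * ((∑ i, x i ^ 2) / 2) + s * (f x).re := by
    intro s _ x
    simp only [blend, quad, Complex.add_re, Complex.re_ofReal_mul]
    rw [← Complex.ofReal_one, ← Complex.ofReal_sub, Complex.re_ofReal_mul, Complex.ofReal_re]
  have hre0 : ∀ s ∈ Set.Icc (0 : ℝ) 1, ∀ x, x ≠ 0 → ‖x‖ ≤ r → 0 < (blend quad f (s, x)).re := by
    intro s hs x hx hxr
    rw [hre s hs]
    have h2 : 0 < (∑ i, x i ^ 2) / 2 := by
      have := sq_norm_le_sum_sq x
      have h3 : 0 < ‖x‖ ^ 2 := by have := norm_pos_iff.2 hx; positivity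
      linarith
    have h3 := hpos x hx hxr
    rcases eq_or_lt_of_le hs.1 with h | h
    · rw [← h]; linarith
    · have h4 : 0 ≤ 1 - s := by linarith [hs.2]
      have := mul_pos h h3
      have := mul_nonneg h4 h2.le
      linarith
  have hFc : Continuous fun p => (blend quad f p).re := Complex.continuous_re.comp hF.continuous
  obtain ⟨c, hc0, hc⟩ := (isCompact_Icc.prod ((isCompact_closedBall (0 : Fin n → ℝ) ρ).inter_right
    (isClosed_le (continuous_const (y := ρ / 2)) continuous_norm))).exists_forall_le' (a := 0)
    (s := Set.Icc (0 : ℝ) 1 ×ˢ _) hFc.continuousOn (by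
      rintro ⟨s, x⟩ ⟨hs, hx1, hx2⟩
      refine hre0 s hs x ?_ ((mem_closedBall_zero_iff.1 hx1).trans hρr)
      rintro rfl
      simp only [Set.mem_ofPred_eq, norm_zero] at hx2
      linarith)
  let P : PhaseFamily n :=
    { F := blend quad f
      W := fun j k p => W p j k
      radius := ρ
      gap := c
      contDiff_F := hF
      contDiff_W := hW
      radius_pos := hρ0
      gap_pos := hc0
      sum_W_mul := by
        intro s hs x hx j
        have e1 : ∀ k, partialX k (blend quad f) (s, x) = ∑ l, M (s, x) k l * x l := by
          intro k
          have h2 := sub_eq_sum_mul_radialMean (contDiff_partialX hF k) s x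
          have h3 : partialX k (blend quad f) (s, 0) = 0 := by
            rw [partialX_blend contDiff_quad hf, coordDeriv_quad]
            simp [blend, h1]
          rw [h3, sub_zero] at h2
          rw [h2]
          exact Finset.sum_congr rfl fun l _ => mul_comm _ _
        simp only [e1, Finset.mul_sum]
        rw [Finset.sum_comm]
        have e2 : ∀ l, ∑ k, W (s, x) j k * (M (s, x) k l * x l) =
            (1 : Matrix (Fin n) (Fin n) ℂ) j l * x l := by
          intro l
          rw [← hWM s hs x hx, Matrix.mul_apply, Finset.sum_mul]
          exact Finset.sum_congr rfl fun k _ => by ring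
        simp [e2, Matrix.one_apply]
      re_nonneg := by
        intro s hs x hx
        rcases eq_or_ne x 0 with rfl | h
        · rw [hre s hs]; simp [h0]
        · exact (hre0 s hs x h (hx.trans hρr)).le
      gap_le_re := fun s hs x hx1 hx2 => hc (s, x) ⟨hs, mem_closedBall_zero_iff.2 hx2, hx1⟩
      F_zero := fun s => by simp [blend, quad, h0] }
  refine ⟨P, rfl, hρr, ?_⟩
  have hS : ContDiff ℝ ∞ (partialS P.F) := contDiff_partialS hF
  -- It remains to see that the first transported amplitude of `∂_s F = f - quad`, at the origin, is
  -- half the trace of `(A - 1) (segment A s)⁻¹`.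
  refine exp_neg_integral_trace hroots ((P.contDiff_transport hS).continuous.comp (by fun_prop)) ?_
  intro s hs
  have hWs : W (s, 0) = (segment A s)⁻¹ := by
    have := hWM s hs 0 (by simpa using hρ0.le)
    rw [hM0] at this
    exact (Matrix.inv_eq_left_inv this).symm
  have hd : ContDiff ℝ ∞ fun x => f x - quad x := hf.sub contDiff_quad
  have hpS : partialS P.F = blend (fun x => f x - quad x) (fun x => f x - quad x) :=
    partialS_blend contDiff_quad hf
  have hd1 : ∀ j x, coordDeriv j (fun x => f x - quad x) x = coordDeriv j f x - x j := by
    intro j x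
    rw [← congrFun (coordDeriv_quad j) x]
    simp only [coordDeriv]
    rw [fderiv_fun_sub (hf.differentiable (by simp) x) (contDiff_quad.differentiable (by simp) x)]
    rfl
  have hd2 : ∀ k j, coordDeriv k (coordDeriv j fun x => f x - quad x) 0 = (A - 1) k j := by
    intro k j
    rw [funext (hd1 j), Matrix.sub_apply, ← congrFun (coordDeriv_coe k j) 0, hAdef, hessian_apply]
    have h2 : DifferentiableAt ℝ (fun x : Fin n → ℝ => (x j : ℂ)) 0 := by
      rw [← coordDeriv_quad j]
      exact (contDiff_coordDeriv contDiff_quad j).differentiable (by simp) 0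
    change fderiv ℝ (fun x => coordDeriv j f x - (x j : ℂ)) 0 _ = _
    rw [fderiv_fun_sub ((contDiff_coordDeriv hf j).differentiable (by simp) 0) h2]
    rfl
  rw [Function.iterate_zero, id, PhaseFamily.transport]
  have hr : ∀ j, ContDiff ℝ ∞ (radialMean 0 (partialX j (partialS P.F))) := fun j =>
    contDiff_radialMean (contDiff_partialX hS j) 0
  -- The gradient of `f - quad` vanishes at the origin, so in the product rule only the derivative
  -- of the radial mean survives. That mean has weight `t`, whence the factor `1 / 2`.
  have key : ∀ k, partialX k (P.field (partialS P.F) k) (s, 0) =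
      ∑ j, 1 / 2 * ((A - 1) k j * W (s, 0) j k) := by
    intro k
    change partialX k (fun p => ∑ j, radialMean 0 (partialX j (partialS P.F)) p * P.W j k p) _ = _
    rw [partialX_sum _ fun j => (hr j).mul (P.contDiff_W j k)]
    refine Finset.sum_congr rfl fun j _ => ?_
    rw [partialX_mul (hr j) (P.contDiff_W j k), partialX_radialMean (contDiff_partialX hS j)]
    beta_reduce
    rw [radialMean_zero,
      radialMean_zero, hpS, partialX_blend hd hd, partialX_blend (contDiff_coordDeriv hd j)
      (contDiff_coordDeriv hd j)]
    simp only [blend, hd2, hd1, h1]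
    simp [P]
    ring
  simp only [key, ← Finset.mul_sum]
  rw [hWs]
  rfl

end

/-! ### Localization and the Laplace expansion -/

section

/-- Multiply by a bump function. The phase and the amplitude are smooth only near the origin,
whereas the preceding theory asks for global smoothness. -/
theorem exists_contDiff_eventuallyEq {f : (Fin n → ℝ) → ℂ} (hf : ∀ᶠ x in 𝓝 0, ContDiffAt ℝ ∞ f x) :
    ∃ g : (Fin n → ℝ) → ℂ, ContDiff ℝ ∞ g ∧ g =ᶠ[𝓝 0] f := by
  obtain ⟨δ, hδ, h⟩ := Metric.eventually_nhds_iff_ball.1 hf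
  let b : ContDiffBump (0 : Fin n → ℝ) := ⟨δ / 4, δ / 2, by positivity, by linarith⟩
  refine ⟨fun x => (b x : ℂ) * f x, contDiff_iff_contDiffAt.2 fun x => ?_, ?_⟩
  · by_cases hx : x ∈ ball (0 : Fin n → ℝ) δ
    · exact (Complex.ofRealCLM.contDiff.comp b.contDiff).contDiffAt.mul (h x hx)
    · have h1 : (fun x => (b x : ℂ) * f x) =ᶠ[𝓝 x] fun _ => 0 := by
        have h2 : ∀ᶠ y in 𝓝 x, δ / 2 < ‖y‖ :=
          (continuous_norm.tendsto x).eventually_const_lt (by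
            have : δ ≤ ‖x‖ := by simpa using hx
            linarith)
        filter_upwards [h2] with y hy
        rw [b.zero_of_le_dist (by simpa [b] using hy.le)]
        simp
      exact contDiffAt_const.congr_of_eventuallyEq h1
  · filter_upwards [closedBall_mem_nhds (0 : Fin n → ℝ) (by positivity : 0 < δ / 4)] with x hx
    rw [b.one_of_mem_closedBall hx]
    simp

theorem coordDeriv_congr {f g : (Fin n → ℝ) → ℂ} (h : f =ᶠ[𝓝 0] g) (j : Fin n) :
    coordDeriv j f =ᶠ[𝓝 0] coordDeriv j g := by
  filter_upwards [h.eventuallyEq_nhds] with x hx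
  rw [coordDeriv, coordDeriv, hx.fderiv_eq]

theorem hessian_congr {f g : (Fin n → ℝ) → ℂ} (h : f =ᶠ[𝓝 0] g) : hessian f 0 = hessian g 0 := by
  ext i j
  rw [hessian_apply, hessian_apply]
  exact (coordDeriv_congr (coordDeriv_congr h j) i).eq_of_nhds

/-- `f` vanishes to order `m` at the origin. -/
def VanishesAt : ℕ → ((Fin n → ℝ) → ℂ) → Prop
  | 0, _ => True
  | m + 1, f => f 0 = 0 ∧ ∀ j, VanishesAt m (coordDeriv j f)

theorem VanishesAt.congr {m : ℕ} {f g : (Fin n → ℝ) → ℂ} (hf : VanishesAt m f) (h : f =ᶠ[𝓝 0] g) :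
    VanishesAt m g := by
  induction m generalizing f g with
  | zero => trivial
  | succ m ih => exact ⟨h.eq_of_nhds ▸ hf.1, fun j => ih (hf.2 j) (coordDeriv_congr h j)⟩

theorem VanishesAt.vanishesTo_blend {m : ℕ} {f : (Fin n → ℝ) → ℂ} (hf : ContDiff ℝ ∞ f)
    (h : VanishesAt m f) : VanishesTo m (blend f f) := by
  induction m generalizing f with
  | zero => trivial
  | succ m ih =>
    refine ⟨fun s => by simp [blend, h.1], fun j => ?_⟩
    rw [partialX_blend hf hf]
    exact ih (contDiff_coordDeriv hf j) (h.2 j)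

theorem blend_self (f : (Fin n → ℝ) → ℂ) (s : ℝ) (x : Fin n → ℝ) : blend f f (s, x) = f x := by
  simp only [blend]; ring

namespace PhaseFamily

variable (P : PhaseFamily n)

/-- The smooth cutoff can be traded for a sharp one at half the radius: the two integrands differ
only on the outer shell, where the exponential is at most `exp (-gap * L)`. -/
theorem osc_sub_setIntegral_le {u : ℝ × (Fin n → ℝ) → ℂ} (hu : ContDiff ℝ ∞ u) :
    ∃ C : ℝ, ∀ L : ℝ, 0 ≤ L →
      ‖P.osc u 1 L - ∫ x in closedBall 0 (P.radius / 2),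
        u (1, x) * Complex.exp (-(L * P.F (1, x)))‖ ≤ C * Real.exp (-(P.gap * L)) := by
  have huc := (contDiff_slice hu 1).continuous
  obtain ⟨B, hB⟩ := (isCompact_closedBall (0 : Fin n → ℝ) P.radius).exists_bound_of_continuousOn
    huc.continuousOn
  refine ⟨|B| * volume.real (closedBall 0 P.radius \ closedBall (0 : Fin n → ℝ) (P.radius / 2)),
    fun L hL => ?_⟩
  have hsub : closedBall (0 : Fin n → ℝ) (P.radius / 2) ⊆ closedBall 0 P.radius :=
    closedBall_subset_closedBall (half_le_self P.radius_pos.le)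
  have h1 : ∫ x in closedBall 0 (P.radius / 2), u (1, x) * Complex.exp (-(L * P.F (1, x))) =
      ∫ x in closedBall 0 (P.radius / 2),
        P.cutoff x * u (1, x) * Complex.exp (-(L * P.F (1, x))) := by
    refine setIntegral_congr_fun measurableSet_closedBall fun x hx => ?_
    rw [P.cutoff_eq_one (by simpa using hx), one_mul]
  rw [h1, osc_eq_setIntegral, ← setIntegral_sdiff measurableSet_closedBall
    (P.integrable_cutoff_mul hu 1 L).integrableOn hsub]
  refine (norm_setIntegral_le_of_norm_le_const (C := |B| * Real.exp (-(P.gap * L)))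
    ((measure_mono Set.sdiff_subset).trans_lt measure_closedBall_lt_top) fun x hx => ?_).trans_eq
    (by ring)
  have hx1 : ‖x‖ ≤ P.radius := by simpa using hx.1
  have hx2 : P.radius / 2 < ‖x‖ := by simpa using hx.2
  rw [norm_mul, norm_mul, Complex.norm_exp]
  refine mul_le_mul ?_ (Real.exp_le_exp.2 ?_) (Real.exp_pos _).le (abs_nonneg _)
  · exact (mul_le_of_le_one_left (norm_nonneg _) (P.norm_cutoff_le x)).trans
      ((hB x hx.1).trans (le_abs_self _))
  · simp only [Complex.neg_re, Complex.re_ofReal_mul]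
    nlinarith [P.gap_le_re 1 (by simp) x hx2.le hx1]

end PhaseFamily

/-- Complete asymptotic expansion of a Laplace integral with complex phase whose real part has a
strict minimum at the nondegenerate critical point `0`. -/
theorem exists_laplace_expansion {f ψ : (Fin n → ℝ) → ℂ} (hf : ∀ᶠ x in 𝓝 0, ContDiffAt ℝ ∞ f x)
    (hψ : ∀ᶠ x in 𝓝 0, ContDiffAt ℝ ∞ ψ x) (h0 : f 0 = 0) (h1 : ∀ j, coordDeriv j f 0 = 0)
    (hdet : (hessian f 0).det ≠ 0) (hpos : ∀ᶠ x in 𝓝 0, x ≠ 0 → 0 < (f x).re) {r : ℝ}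
    (hr : 0 < r) :
    ∃ ρ : ℝ, 0 < ρ ∧ ρ ≤ r ∧ ∃ c : ℕ → ℂ,
      (∀ N : ℕ, (fun L : ℝ => (∫ x in closedBall 0 ρ, ψ x * Complex.exp (-(L * f x))) /
          ((√(2 * Real.pi / L) ^ n : ℝ) : ℂ) - ∑ k ∈ Finset.range N, c k * (L : ℂ)⁻¹ ^ k)
        =O[atTop] fun L : ℝ => (L : ℂ)⁻¹ ^ N) ∧
      c 0 = invSqrtDet (hessian f 0) * ψ 0 ∧
      ∀ m : ℕ, VanishesAt m ψ → ∀ k, 2 * k < m → c k = 0 := by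
  obtain ⟨f', hf', hff'⟩ := exists_contDiff_eventuallyEq hf
  obtain ⟨ψ', hψ', hψψ'⟩ := exists_contDiff_eventuallyEq hψ
  obtain ⟨δ, hδ, hall⟩ := Metric.eventually_nhds_iff_ball.1 (hff'.and (hψψ'.and hpos))
  have hr' : 0 < min r (δ / 2) := lt_min hr (half_pos hδ)
  have hin : ∀ x : Fin n → ℝ, ‖x‖ ≤ min r (δ / 2) → x ∈ ball (0 : Fin n → ℝ) δ := fun x hx => by
    rw [mem_ball_zero_iff]
    have := hx.trans (min_le_right _ _)
    linarith
  obtain ⟨P, hPF, hPr, hlog⟩ := exists_phaseFamily hf' (by rw [hff'.eq_of_nhds, h0])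
    (fun j => by rw [(coordDeriv_congr hff' j).eq_of_nhds, h1]) (by rwa [hessian_congr hff']) hr'
    (fun x hx hxr => by rw [(hall x (hin x hxr)).1]; exact (hall x (hin x hxr)).2.2 hx)
  have hu : ContDiff ℝ ∞ (blend ψ' ψ') := contDiff_blend hψ' hψ'
  obtain ⟨c, hc, hc0, hcv⟩ := P.exists_expansion (fun x => by simp [hPF, blend, quad]) hu
  have hrad : P.radius / 2 ≤ min r (δ / 2) := (half_le_self P.radius_pos.le).trans hPr
  refine ⟨P.radius / 2, half_pos P.radius_pos, hrad.trans (min_le_left _ _), c, fun N => ?_, ?_, ?_⟩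
  · obtain ⟨C, hC⟩ := P.osc_sub_setIntegral_le hu
    -- The extra `n` orders absorb the division by the Gaussian, which costs at most `L ^ n`.
    obtain ⟨D, hD0, hD⟩ := exp_neg_mul_le_inv_pow P.gap_pos (N + n)
    have hint : ∀ L : ℝ, ∫ x in closedBall 0 (P.radius / 2), ψ x * Complex.exp (-(L * f x)) =
        ∫ x in closedBall 0 (P.radius / 2),
          blend ψ' ψ' (1, x) * Complex.exp (-(L * P.F (1, x))) := by
      intro L
      refine setIntegral_congr_fun measurableSet_closedBall fun x hx => ?_
      have hx' := hall x (hin x ((by simpa using hx : ‖x‖ ≤ P.radius / 2).trans hrad))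
      rw [blend_self, hPF, hx'.2.1, ← hx'.1]
      simp [blend]
    refine ((hc N).sub (IsBigO.of_bound (|C| * D) ?_ : (fun L : ℝ => (P.osc (blend ψ' ψ') 1 L -
      ∫ x in closedBall 0 (P.radius / 2), ψ x * Complex.exp (-(L * f x))) /
        ((√(2 * Real.pi / L) ^ n : ℝ) : ℂ)) =O[atTop] fun L : ℝ => (L : ℂ)⁻¹ ^ N)).congr_left
      fun L => by ring
    filter_upwards [eventually_ge_atTop 1] with L hL
    have hL0 : 0 < L := by linarith
    have hg : (√(2 * Real.pi / L) ^ n)⁻¹ ≤ L ^ n := by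
      rw [← inv_pow]
      refine pow_le_pow_left₀ (by positivity) ?_ n
      rw [inv_le_comm₀ (Real.sqrt_pos.2 (by positivity)) hL0]
      refine Real.le_sqrt_of_sq_le ?_
      rw [div_eq_mul_inv, sq]
      exact mul_le_mul_of_nonneg_right ((inv_le_one_of_one_le₀ hL).trans
        (by linarith [Real.pi_gt_three])) (by positivity)
    rw [hint, norm_div, Complex.norm_real, norm_pow (L : ℂ)⁻¹, norm_inv (L : ℂ),
      Complex.norm_real L, Real.norm_of_nonneg hL0.le, Real.norm_of_nonneg (by positivity),
      div_eq_mul_inv]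
    calc _ ≤ (|C| * (D * L⁻¹ ^ (N + n))) * L ^ n := by
          refine mul_le_mul ((hC L hL0.le).trans ?_) hg (by positivity) (by positivity)
          exact mul_le_mul (le_abs_self _) (hD L hL) (Real.exp_pos _).le (abs_nonneg _)
      _ = |C| * D * L⁻¹ ^ N := by
          rw [pow_add, inv_pow L n]
          field_simp
  · rw [hc0, hlog, hessian_congr hff', blend_self, hψψ'.eq_of_nhds]
  · intro m hm k hk
    -- Each transport loses at most two orders, so the iterates with index `i ≤ k` vanish at the
    -- origin when `2 * k < m`.
    exact hcv (k + 1) (fun i hi => P.iterate_transport_eq_zero hu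
      ((hm.congr hψψ'.symm).vanishesTo_blend hψ') (by omega) 1) k (by omega)

/-! ### Vanishing orders of holomorphic functions -/

/-- Cauchy's estimate: the derivative of a holomorphic function that is `O(‖w‖ ^ (m + 1))` is
`O(‖w‖ ^ m)`. -/
theorem isBigO_fderiv_of_isBigO {Ψ : (Fin n → ℂ) → ℂ} (hΨ : AnalyticAt ℂ Ψ 0) {m : ℕ}
    (h : Ψ =O[𝓝 0] fun w => ‖w‖ ^ (m + 1)) (j : Fin n) :
    (fun w => fderiv ℂ Ψ w (Pi.single j 1)) =O[𝓝 0] fun w => ‖w‖ ^ m := by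
  obtain ⟨C, hC⟩ := h.bound
  obtain ⟨δ, hδ, hall⟩ := Metric.eventually_nhds_iff_ball.1 (hC.and hΨ.eventually_analyticAt)
  -- Cauchy's estimate on the disk of radius `R` about `w` in the `j`-th direction. Since `‖w‖ ≤ R`,
  -- the disk lies within distance `2 * R` of the origin, which produces the factor `2 ^ (m + 1)`.
  have hbound : ∀ w : Fin n → ℂ, ∀ R : ℝ, 0 < R → ‖w‖ ≤ R → R < δ / 2 →
      ‖fderiv ℂ Ψ w (Pi.single j 1)‖ ≤ |C| * 2 ^ (m + 1) * R ^ m := by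
    intro w R hR hwR hRδ
    have hsingle : ∀ t : ℂ, ‖(t • Pi.single j 1 : Fin n → ℂ)‖ = ‖t‖ := fun t => by
      rw [norm_smul, Pi.norm_single]; simp
    have hnorm : ∀ t : ℂ, ‖t‖ ≤ R → ‖w + t • Pi.single j 1‖ ≤ 2 * R := fun t ht =>
      (norm_add_le _ _).trans (by rw [hsingle]; linarith)
    have hmem : ∀ t : ℂ, ‖t‖ ≤ R → w + t • Pi.single j 1 ∈ ball (0 : Fin n → ℂ) δ := fun t ht => by
      rw [mem_ball_zero_iff]
      linarith [hnorm t ht]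
    have hder : ∀ t : ℂ, ‖t‖ ≤ R → HasDerivAt (fun t : ℂ => Ψ (w + t • Pi.single j 1))
        (fderiv ℂ Ψ (w + t • Pi.single j 1) (Pi.single j 1)) t := fun t ht => by
      have h1 : HasDerivAt (fun t : ℂ => w + t • (Pi.single j 1 : Fin n → ℂ)) (Pi.single j 1) t := by
        simpa using ((hasDerivAt_id t).smul_const (Pi.single j 1 : Fin n → ℂ)).const_add w
      exact (hall _ (hmem t ht)).2.differentiableAt.hasFDerivAt.comp_hasDerivAt t h1
    have h2 : DiffContOnCl ℂ (fun t : ℂ => Ψ (w + t • Pi.single j 1)) (ball 0 R) := by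
      refine DifferentiableOn.diffContOnCl fun t ht => ?_
      rw [closure_ball _ hR.ne'] at ht
      exact (hder t (by simpa using ht)).differentiableAt.differentiableWithinAt
    have h3 := Complex.norm_deriv_le_of_forall_mem_sphere_norm_le (C := |C| * (2 * R) ^ (m + 1))
      hR h2 fun t ht => by
        have ht' : ‖t‖ ≤ R := by simpa using (mem_sphere_zero_iff_norm.1 ht).le
        refine (hall _ (hmem t ht')).1.trans ?_
        rw [norm_pow, norm_norm]
        exact mul_le_mul (le_abs_self _) (pow_le_pow_left₀ (norm_nonneg _) (hnorm t ht') _)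
          (by positivity) (abs_nonneg _)
    rw [(hder 0 (by simpa using hR.le)).deriv] at h3
    simp only [zero_smul, add_zero] at h3
    refine h3.trans_eq ?_
    rw [mul_pow, pow_succ R]
    field_simp
  refine IsBigO.of_bound (|C| * 2 ^ (m + 1)) ?_
  filter_upwards [ball_mem_nhds (0 : Fin n → ℂ) (half_pos hδ)] with w hw
  rw [mem_ball_zero_iff] at hw
  rw [norm_pow, norm_norm]
  -- The radius `‖w‖` itself is degenerate at `w = 0`, so it is reached as a limit from above.
  have hlim : Tendsto (fun R : ℝ => |C| * 2 ^ (m + 1) * R ^ m) (𝓝[>] ‖w‖)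
      (𝓝 (|C| * 2 ^ (m + 1) * ‖w‖ ^ m)) :=
    (Continuous.tendsto (by fun_prop) _).mono_left nhdsWithin_le_nhds
  refine ge_of_tendsto hlim ?_
  filter_upwards [Ioo_mem_nhdsGT hw] with R hR
  exact hbound w R ((norm_nonneg _).trans_lt hR.1) hR.1.le hR.2

theorem coordDeriv_restrict {Ψ : (Fin n → ℂ) → ℂ} (hΨ : AnalyticAt ℂ Ψ 0) (j : Fin n) :
    coordDeriv j (fun x : Fin n → ℝ => Ψ fun j => (x j : ℂ)) =ᶠ[𝓝 0]
      fun x => fderiv ℂ Ψ (fun j => (x j : ℂ)) (Pi.single j 1) := by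
  let ι : (Fin n → ℝ) →L[ℝ] (Fin n → ℂ) := ContinuousLinearMap.pi fun j =>
    Complex.ofRealCLM.comp (ContinuousLinearMap.proj j)
  have hι : Tendsto ι (𝓝 0) (𝓝 0) := by simpa using ι.continuous.tendsto 0
  filter_upwards [hι.eventually hΨ.eventually_analyticAt] with x hx
  have h1 : HasFDerivAt (fun x => Ψ (ι x)) (((fderiv ℂ Ψ (ι x)).restrictScalars ℝ).comp ι) x :=
    (hx.differentiableAt.hasFDerivAt.restrictScalars ℝ).comp x ι.hasFDerivAt
  change fderiv ℝ (fun x => Ψ (ι x)) x (Pi.single j 1) = fderiv ℂ Ψ (ι x) (Pi.single j 1)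
  rw [h1.fderiv]
  simp only [ContinuousLinearMap.comp_apply, ContinuousLinearMap.coe_restrictScalars']
  congr 1
  ext i
  by_cases hij : i = j
  · subst hij; simp [ι]
  · simp [ι, hij]

theorem eventually_contDiffAt_restrict {Ψ : (Fin n → ℂ) → ℂ} (hΨ : AnalyticAt ℂ Ψ 0) :
    ∀ᶠ x in 𝓝 (0 : Fin n → ℝ), ContDiffAt ℝ ∞ (fun x : Fin n → ℝ => Ψ fun j => (x j : ℂ)) x := by
  let ι : (Fin n → ℝ) →L[ℝ] (Fin n → ℂ) := ContinuousLinearMap.pi fun j =>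
    Complex.ofRealCLM.comp (ContinuousLinearMap.proj j)
  have hι : Tendsto ι (𝓝 0) (𝓝 0) := by simpa using ι.continuous.tendsto 0
  filter_upwards [hι.eventually hΨ.eventually_analyticAt] with x hx
  exact (hx.contDiffAt.restrict_scalars ℝ).comp x ι.contDiff.contDiffAt

/-- The Cauchy estimate lowers the order by one with each complex derivative, and real coordinate
derivatives of the restriction are restrictions of complex ones. -/
theorem vanishesAt_of_isBigO {Ψ : (Fin n → ℂ) → ℂ} (hΨ : AnalyticAt ℂ Ψ 0) {m : ℕ}
    (h : Ψ =O[𝓝 0] fun w => ‖w‖ ^ m) : VanishesAt m fun x : Fin n → ℝ => Ψ fun j => (x j : ℂ) := by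
  induction m generalizing Ψ with
  | zero => trivial
  | succ m ih =>
    refine ⟨?_, fun j => ?_⟩
    · obtain ⟨C, hC⟩ := h.bound
      have h2 := hC.self_of_nhds
      rw [norm_zero, zero_pow m.succ_ne_zero, norm_zero, mul_zero, norm_le_zero_iff] at h2
      simpa [Pi.zero_def] using h2
    · have h1 : AnalyticAt ℂ (fun w => fderiv ℂ Ψ w (Pi.single j 1)) 0 := by
        exact (ContinuousLinearMap.apply ℂ ℂ (Pi.single j 1 : Fin n → ℂ)).analyticAt _ |>.comp hΨ.fderiv
      exact (ih h1 (isBigO_fderiv_of_isBigO hΨ h j)).congr (coordDeriv_restrict hΨ j).symm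

end

section

/-! ### Cauchy's coefficient formula on a torus -/

/-- The point of the torus through `w` with arguments `θ`. -/
def torusPoint {m : ℕ} (w : Fin m → ℂ) (θ : Fin m → ℝ) : Fin m → ℂ :=
  fun j => w j * Complex.exp (Complex.I * θ j)

/-- The character `e ^ (-i r · θ)`. -/
def character {m : ℕ} (r : Fin m → ℕ) (θ : Fin m → ℝ) : ℂ :=
  ∏ j, Complex.exp (-(Complex.I * r j * θ j))

/-- Lebesgue measure on a cube with side length `2π`. -/
def cubeMeasure {m : ℕ} (c : Fin m → ℝ) : Measure (Fin m → ℝ) :=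
  Measure.pi fun j => volume.restrict (Set.Ioc (c j) (c j + 2 * Real.pi))

instance {m : ℕ} (c : Fin m → ℝ) : IsFiniteMeasure (cubeMeasure c) := by
  unfold cubeMeasure; infer_instance

section

variable {m : ℕ}

theorem norm_exp_I_mul (t : ℝ) : ‖Complex.exp (Complex.I * t)‖ = 1 := by
  rw [mul_comm]; exact Complex.norm_exp_ofReal_mul_I t

theorem norm_torusPoint_apply (w : Fin m → ℂ) (θ : Fin m → ℝ) (j : Fin m) :
    ‖torusPoint w θ j‖ = ‖w j‖ := by
  rw [torusPoint, norm_mul, norm_exp_I_mul, mul_one]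

theorem continuous_torusPoint (w : Fin m → ℂ) : Continuous (torusPoint w) := by
  unfold torusPoint; fun_prop

theorem norm_character (r : Fin m → ℕ) (θ : Fin m → ℝ) : ‖character r θ‖ = 1 := by
  rw [character, norm_prod]
  refine Finset.prod_eq_one fun j _ => ?_
  rw [Complex.norm_exp]
  simp

theorem continuous_character (r : Fin m → ℕ) : Continuous (character r) := by
  unfold character; fun_prop

theorem monomial_smul (τ : ℂ) (w : Fin m → ℂ) (r : Fin m → ℕ) :
    monomial (τ • w) r = τ ^ (∑ j, r j) * monomial w r := by
  simp only [monomial, Pi.smul_apply, smul_eq_mul, mul_pow, Finset.prod_mul_distrib,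
    Finset.prod_pow_eq_pow_sum]

theorem norm_monomial_torusPoint (w : Fin m → ℂ) (θ : Fin m → ℝ) (k : Fin m → ℕ) :
    ‖monomial (torusPoint w θ) k‖ = ‖monomial w k‖ := by
  simp only [monomial, norm_prod, norm_pow, norm_torusPoint_apply]

theorem continuous_monomial (k : Fin m → ℕ) : Continuous fun w : Fin m → ℂ => monomial w k := by
  unfold monomial; fun_prop

theorem integral_exp_Ioc (c : ℝ) (k : ℤ) :
    ∫ t in Set.Ioc c (c + 2 * Real.pi), Complex.exp (Complex.I * k * t) =
      if k = 0 then (2 * Real.pi : ℂ) else 0 := by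
  rw [← intervalIntegral.integral_of_le (by linarith [Real.pi_pos])]
  split_ifs with h
  · simp [h]
  · have hk : (Complex.I * k : ℂ) ≠ 0 := mul_ne_zero Complex.I_ne_zero (by exact_mod_cast h)
    rw [integral_exp_mul_complex hk]
    have : Complex.exp (Complex.I * k * ((c + 2 * Real.pi : ℝ) : ℂ)) =
        Complex.exp (Complex.I * k * c) := by
      rw [Complex.exp_eq_exp_iff_exists_int]
      exact ⟨k, by push_cast; ring⟩
    rw [this, sub_self, zero_div]

theorem integral_monomial_torusPoint (c : Fin m → ℝ) (w : Fin m → ℂ) (k r : Fin m → ℕ) :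
    ∫ θ, monomial (torusPoint w θ) k * character r θ ∂cubeMeasure c =
      if k = r then (2 * Real.pi : ℂ) ^ m * monomial w r else 0 := by
  have h1 : ∀ θ, monomial (torusPoint w θ) k * character r θ =
      monomial w k * ∏ j, Complex.exp (Complex.I * ((k j : ℤ) - r j : ℤ) * θ j) := by
    intro θ
    simp only [monomial, torusPoint, character, mul_pow, Finset.prod_mul_distrib, mul_assoc]
    congr 1
    rw [← Finset.prod_mul_distrib]
    refine Finset.prod_congr rfl fun j _ => ?_
    rw [← Complex.exp_nat_mul, ← Complex.exp_add]
    push_cast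
    ring_nf
  simp only [h1]
  rw [integral_const_mul, cubeMeasure,
    integral_fintype_prod_eq_prod (fun j (t : ℝ) => Complex.exp (Complex.I * ((k j : ℤ) - r j : ℤ) * t))]
  simp only [integral_exp_Ioc]
  split_ifs with h
  · subst h
    simp [mul_comm]
  · obtain ⟨j, hj⟩ := Function.ne_iff.1 h
    rw [Finset.prod_eq_zero (Finset.mem_univ j), mul_zero]
    rw [if_neg]
    intro h'
    exact hj (by exact_mod_cast sub_eq_zero.1 h')

/-- Integrate the series term by term; orthogonality of the characters leaves one term. Moduli are
constant on the torus, so convergence at a single point already gives a summable majorant. -/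
theorem integral_torusPoint_of_hasSum {F : (Fin m → ℂ) → ℂ} {a : (Fin m → ℕ) → ℂ} {w : Fin m → ℂ}
    (h : ∀ θ, HasSum (fun r => a r * monomial (torusPoint w θ) r) (F (torusPoint w θ)))
    (c : Fin m → ℝ) (r : Fin m → ℕ) :
    ∫ θ, F (torusPoint w θ) * character r θ ∂cubeMeasure c =
      (2 * Real.pi : ℂ) ^ m * (a r * monomial w r) := by
  have hcont : ∀ k, Continuous fun θ => a k * monomial (torusPoint w θ) k * character r θ :=
    fun k => (continuous_const.mul ((continuous_monomial k).comp (continuous_torusPoint w))).mul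
      (continuous_character r)
  have hnorm : ∀ k θ, ‖a k * monomial (torusPoint w θ) k * character r θ‖ =
      ‖a k * monomial w k‖ := fun k θ => by
    rw [norm_mul, norm_mul, norm_character, norm_monomial_torusPoint, mul_one, ← norm_mul]
  have hsum : Summable fun k => ‖a k * monomial w k‖ := by
    have := (h 0).summable.norm
    simpa [norm_mul, norm_monomial_torusPoint] using this
  have h1 := hasSum_integral_of_summable_integral_norm (μ := cubeMeasure c)
    (F := fun k θ => a k * monomial (torusPoint w θ) k * character r θ)
    (fun k => Integrable.of_bound (hcont k).aestronglyMeasurable ‖a k * monomial w k‖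
      (.of_forall fun θ => (hnorm k θ).le))
    (by simp only [hnorm, integral_const]; exact hsum.const_smul _)
  have h2 : ∀ k, ∫ θ, a k * monomial (torusPoint w θ) k * character r θ ∂cubeMeasure c =
      if k = r then (2 * Real.pi : ℂ) ^ m * (a r * monomial w r) else 0 := by
    intro k
    simp only [mul_assoc]
    rw [integral_const_mul, integral_monomial_torusPoint]
    split_ifs with hk
    · subst hk; ring
    · simp
  simp only [h2] at h1
  have h3 := h1.unique (hasSum_ite_eq r _)
  rw [← h3]
  refine integral_congr_ae (.of_forall fun θ => ?_)
  simp only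
  rw [tsum_mul_right, (h θ).tsum_eq]

theorem isCompact_polydisk (w : Fin m → ℂ) : IsCompact (polydisk w) := by
  have : polydisk w = Set.univ.pi fun j => closedBall (0 : ℂ) ‖w j‖ := by
    ext v; simp [polydisk]
  rw [this]
  exact isCompact_univ_pi fun j => isCompact_closedBall _ _

theorem torusPoint_mem_polydisk (w : Fin m → ℂ) (θ : Fin m → ℝ) : torusPoint w θ ∈ polydisk w :=
  fun j => (norm_torusPoint_apply w θ j).le

theorem smul_mem_polydisk {w v : Fin m → ℂ} (hv : v ∈ polydisk w) {τ : ℂ} (hτ : ‖τ‖ ≤ 1) :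
    τ • v ∈ polydisk w := fun j => by
  rw [Pi.smul_apply, norm_smul]
  exact (mul_le_of_le_one_left (norm_nonneg _) hτ).trans (hv j)

/-- Holomorphy in the scaling parameter is what allows the coefficient formula to be continued from
small tori to large ones. -/
theorem differentiableOn_integral_smul_torusPoint {F : (Fin m → ℂ) → ℂ} {w : Fin m → ℂ} {R : ℝ}
    (hF : ∀ τ : ℂ, ‖τ‖ < R → ∀ v ∈ polydisk w, AnalyticAt ℂ F (τ • v)) (c : Fin m → ℝ)
    (r : Fin m → ℕ) :
    DifferentiableOn ℂ (fun τ : ℂ => ∫ θ, F (τ • torusPoint w θ) * character r θ ∂cubeMeasure c)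
      (ball 0 R) := by
  intro τ₀ hτ₀
  rw [mem_ball_zero_iff] at hτ₀
  obtain ⟨δ, hδ, hδR⟩ : ∃ δ : ℝ, 0 < δ ∧ ‖τ₀‖ + δ < R := ⟨(R - ‖τ₀‖) / 2, by linarith, by linarith⟩
  have hball : ∀ τ ∈ closedBall τ₀ δ, ‖τ‖ < R := fun τ hτ => by
    have h1 : ‖τ - τ₀‖ ≤ δ := by simpa [dist_eq_norm] using hτ
    have h2 : ‖τ‖ ≤ ‖τ₀‖ + ‖τ - τ₀‖ := by
      simpa using norm_add_le τ₀ (τ - τ₀)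
    linarith
  have hcont : ContinuousOn (fun p : ℂ × (Fin m → ℂ) => fderiv ℂ F (p.1 • p.2) p.2)
      (closedBall τ₀ δ ×ˢ polydisk w) := by
    rintro ⟨τ, v⟩ ⟨hτ, hv⟩
    refine ContinuousAt.continuousWithinAt (ContinuousAt.clm_apply ?_ continuousAt_snd)
    exact ContinuousAt.comp (f := fun p : ℂ × (Fin m → ℂ) => p.1 • p.2)
      (hF τ (hball τ hτ) v hv).fderiv.continuousAt (by fun_prop)
  obtain ⟨B, hB⟩ := ((isCompact_closedBall τ₀ δ).prod (isCompact_polydisk w)).exists_bound_of_continuousOn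
    hcont
  have hder : ∀ τ, ‖τ‖ < R → ∀ v ∈ polydisk w,
      HasDerivAt (fun τ : ℂ => F (τ • v)) (fderiv ℂ F (τ • v) v) τ := fun τ hτ v hv => by
    have h1 : HasDerivAt (fun τ : ℂ => τ • v) v τ := by
      simpa using (hasDerivAt_id τ).smul_const v
    exact (hF τ hτ v hv).differentiableAt.hasFDerivAt.comp_hasDerivAt τ h1
  have hc1 : ∀ τ, ‖τ‖ < R → Continuous fun θ => F (τ • torusPoint w θ) * character r θ :=
    fun τ hτ => (continuous_iff_continuousAt.2 fun θ => ContinuousAt.comp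
      (f := fun θ => τ • torusPoint w θ) (hF τ hτ _ (torusPoint_mem_polydisk w θ)).continuousAt
      ((continuous_torusPoint w).const_smul τ).continuousAt).mul (continuous_character r)
  have hc2 : Continuous fun θ => fderiv ℂ F (τ₀ • torusPoint w θ) (torusPoint w θ) :=
    (continuous_iff_continuousAt.2 fun θ => ContinuousAt.comp
      (f := fun θ => τ₀ • torusPoint w θ)
      (hF τ₀ hτ₀ _ (torusPoint_mem_polydisk w θ)).fderiv.continuousAt
      ((continuous_torusPoint w).const_smul τ₀).continuousAt).clm_apply (continuous_torusPoint w)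
  obtain ⟨B', hB'⟩ := (isCompact_polydisk w).exists_bound_of_continuousOn (f := fun v => F (τ₀ • v))
    fun v hv => (ContinuousAt.comp (f := fun v : Fin m → ℂ => τ₀ • v) (hF τ₀ hτ₀ v hv).continuousAt
      (by fun_prop)).continuousWithinAt
  refine (hasDerivAt_integral_of_dominated_loc_of_deriv_le (μ := cubeMeasure c)
    (F := fun (τ : ℂ) θ => F (τ • torusPoint w θ) * character r θ)
    (F' := fun τ θ => fderiv ℂ F (τ • torusPoint w θ) (torusPoint w θ) * character r θ)
    (bound := fun _ => B) (closedBall_mem_nhds τ₀ hδ) ?_ ?_ ?_ ?_ (integrable_const _)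
    ?_).2.differentiableAt.differentiableWithinAt
  · filter_upwards [closedBall_mem_nhds τ₀ hδ] with τ hτ
    exact (hc1 τ (hball τ hτ)).aestronglyMeasurable
  · refine Integrable.of_bound (hc1 τ₀ hτ₀).aestronglyMeasurable B' (.of_forall fun θ => ?_)
    rw [norm_mul, norm_character, mul_one]
    exact hB' _ (torusPoint_mem_polydisk w θ)
  · exact (hc2.mul (continuous_character r)).aestronglyMeasurable
  · refine .of_forall fun θ τ hτ => ?_
    rw [norm_mul, norm_character, mul_one]
    exact hB (τ, torusPoint w θ) ⟨hτ, torusPoint_mem_polydisk w θ⟩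
  · exact .of_forall fun θ τ hτ =>
      (hder τ (hball τ hτ) _ (torusPoint_mem_polydisk w θ)).mul_const _

/-- Both sides, with `w` scaled by `τ`, are holomorphic in `τ` on a disk of radius greater than `1`
and agree near `τ = 0`, where the series converges. The identity theorem gives `τ = 1`, with no
convergence of the series on the torus itself. -/
theorem integral_torusPoint_eq {F : (Fin m → ℂ) → ℂ} {a : (Fin m → ℕ) → ℂ}
    (ha : HasCoefficients F a) {w : Fin m → ℂ} (hF : AnalyticOnNhd ℂ F (polydisk w))
    (c : Fin m → ℝ) (r : Fin m → ℕ) :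
    ∫ θ, F (torusPoint w θ) * character r θ ∂cubeMeasure c =
      (2 * Real.pi : ℂ) ^ m * (a r * monomial w r) := by
  -- The tube lemma provides a disk slightly larger than the unit disk, so that `τ = 1` is an
  -- interior point.
  obtain ⟨u, v, hu, -, h1u, hKv, huv⟩ := generalized_tube_lemma (isCompact_closedBall (0 : ℂ) 1)
    (isCompact_polydisk w)
    ((isOpen_analyticAt ℂ F).preimage (by fun_prop : Continuous fun p : ℂ × (Fin m → ℂ) => p.1 • p.2))
    (fun p hp => hF _ (smul_mem_polydisk hp.2 (by simpa using hp.1)))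
  obtain ⟨ε, hε, hεu⟩ := (isCompact_closedBall (0 : ℂ) 1).exists_thickening_subset_open hu h1u
  rw [thickening_closedBall hε zero_le_one] at hεu
  have hF' : ∀ τ : ℂ, ‖τ‖ < ε + 1 → ∀ v ∈ polydisk w, AnalyticAt ℂ F (τ • v) := fun τ hτ p hp =>
    huv (show (τ, p) ∈ u ×ˢ v from ⟨hεu (by simpa using hτ), hKv hp⟩)
  have hΦ := (differentiableOn_integral_smul_torusPoint hF' c r).analyticOnNhd isOpen_ball
  have hΨ : AnalyticOnNhd ℂ (fun τ : ℂ => (2 * Real.pi : ℂ) ^ m *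
      (a r * (τ ^ (∑ j, r j) * monomial w r))) (ball 0 (ε + 1)) :=
    (Differentiable.differentiableOn (by fun_prop)).analyticOnNhd isOpen_ball
  have hev : (fun τ : ℂ => ∫ θ, F (τ • torusPoint w θ) * character r θ ∂cubeMeasure c) =ᶠ[𝓝 0]
      fun τ : ℂ => (2 * Real.pi : ℂ) ^ m * (a r * (τ ^ (∑ j, r j) * monomial w r)) := by
    obtain ⟨δ, hδ, h⟩ := Metric.eventually_nhds_iff_ball.1 ha
    have h1 : ∀ᶠ τ in 𝓝 (0 : ℂ), ‖τ‖ * ‖w‖ < δ :=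
      (Continuous.tendsto (by fun_prop) 0).eventually_lt_const (by simpa using hδ)
    filter_upwards [h1] with τ hτ
    have h2 : ∀ θ, τ • torusPoint w θ = torusPoint (τ • w) θ := fun θ => by
      ext j; simp only [torusPoint, Pi.smul_apply, smul_eq_mul]; ring
    simp only [h2]
    rw [integral_torusPoint_of_hasSum (F := F) (a := a), monomial_smul]
    intro θ
    refine h _ (mem_ball_zero_iff.2 ?_)
    rw [pi_norm_lt_iff hδ]
    intro j
    rw [norm_torusPoint_apply, Pi.smul_apply, norm_smul]
    exact (mul_le_mul_of_nonneg_left (norm_le_pi_norm w j) (norm_nonneg _)).trans_lt hτ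
  have h1 := hΦ.eqOn_of_preconnected_of_eventuallyEq hΨ (convex_ball _ _).isPreconnected
    (mem_ball_self (by linarith)) hev (show (1 : ℂ) ∈ ball (0 : ℂ) (ε + 1) by simpa using hε)
  simpa using h1

end

end

/-! ### Separating the last variable -/

section

/-- The point with first coordinates `w'` and last coordinate `t`. -/
def join (w' : Fin n → ℂ) (t : ℂ) : Fin (n + 1) → ℂ := Fin.snoc (α := fun _ => ℂ) w' t

@[simp] theorem join_castSucc (w' : Fin n → ℂ) (t : ℂ) (j : Fin n) : join w' t j.castSucc = w' j := by
  simp [join]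

@[simp] theorem join_last (w' : Fin n → ℂ) (t : ℂ) : join w' t (Fin.last n) = t := by
  simp [join]

theorem join_init_self (w : Fin (n + 1) → ℂ) :
    join (fun j => w j.castSucc) (w (Fin.last n)) = w := by
  ext j
  refine Fin.lastCases ?_ (fun j => ?_) j <;> simp

/-- `join` as a continuous linear map. -/
def joinCLM (n : ℕ) : (Fin n → ℂ) × ℂ →L[ℂ] (Fin (n + 1) → ℂ) := ContinuousLinearMap.pi
  (Fin.lastCases (ContinuousLinearMap.snd ℂ _ _)
    fun j => (ContinuousLinearMap.proj j).comp (ContinuousLinearMap.fst ℂ _ _))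

theorem joinCLM_apply (p : (Fin n → ℂ) × ℂ) : joinCLM n p = join p.1 p.2 := by
  ext j
  refine Fin.lastCases ?_ (fun j => ?_) j <;> simp [joinCLM]

theorem analyticAt_comp_join {F : (Fin (n + 1) → ℂ) → ℂ} {p : (Fin n → ℂ) × ℂ}
    (hF : AnalyticAt ℂ F (join p.1 p.2)) : AnalyticAt ℂ (fun p => F (join p.1 p.2)) p := by
  have : (fun p : (Fin n → ℂ) × ℂ => F (join p.1 p.2)) = F ∘ joinCLM n := by
    ext p; simp [joinCLM_apply]
  rw [this]
  exact AnalyticAt.comp (by rwa [joinCLM_apply]) ((joinCLM n).analyticAt p)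

theorem continuous_join : Continuous fun p : (Fin n → ℂ) × ℂ => join p.1 p.2 := by
  have : (fun p : (Fin n → ℂ) × ℂ => join p.1 p.2) = joinCLM n := by
    ext1 p; exact (joinCLM_apply p).symm
  rw [this]
  exact (joinCLM n).continuous

theorem integral_cubeMeasure_succ {c : Fin (n + 1) → ℝ} {g : (Fin (n + 1) → ℝ) → ℂ}
    (hg : Integrable g (cubeMeasure c)) :
    ∫ θ, g θ ∂cubeMeasure c = ∫ θ', (∫ t in Set.Ioc (c (Fin.last n)) (c (Fin.last n) + 2 * Real.pi),
      g (Fin.snoc (α := fun _ => ℝ) θ' t)) ∂cubeMeasure fun j => c j.castSucc := by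
  have hmp := (measurePreserving_piFinSuccAbove (fun j : Fin (n + 1) =>
    (volume.restrict (Set.Ioc (c j) (c j + 2 * Real.pi)) : Measure ℝ)) (Fin.last n)).symm
  have h1 := hmp.integral_comp' g
  have h2 : Integrable (fun p : ℝ × (Fin n → ℝ) => g (Fin.snoc (α := fun _ => ℝ) p.2 p.1))
      ((volume.restrict (Set.Ioc (c (Fin.last n)) (c (Fin.last n) + 2 * Real.pi))).prod
        (cubeMeasure fun j => c j.castSucc)) := by
    have := hmp.integrable_comp_of_integrable hg
    simpa [Function.comp_def, MeasurableEquiv.piFinSuccAbove, Fin.insertNthEquiv,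
      Fin.insertNth_last', cubeMeasure] using this
  rw [cubeMeasure, ← h1]
  rw [← integral_prod_symm _ h2]
  simp [MeasurableEquiv.piFinSuccAbove, Fin.insertNthEquiv, Fin.insertNth_last', cubeMeasure]

theorem circleIntegral_div_pow (φ : ℂ → ℂ) {ρ : ℝ} (hρ : 0 < ρ) (k : ℕ) :
    (∮ t in C(0, ρ), φ t / t ^ (k + 1)) = Complex.I * ((ρ : ℂ) ^ k)⁻¹ *
      ∫ t in Set.Ioc 0 (0 + 2 * Real.pi), φ (ρ * Complex.exp (Complex.I * t)) *
        Complex.exp (-(Complex.I * k * t)) := by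
  rw [circleIntegral, zero_add, intervalIntegral.integral_of_le (by positivity),
    ← integral_const_mul]
  refine integral_congr_ae (.of_forall fun t => ?_)
  have hρ' : (ρ : ℂ) ≠ 0 := by exact_mod_cast hρ.ne'
  simp only [deriv_circleMap, circleMap_zero, smul_eq_mul]
  rw [show Complex.exp (-(Complex.I * k * t)) = (Complex.exp (t * Complex.I) ^ k)⁻¹ by
    rw [← Complex.exp_nat_mul, ← Complex.exp_neg]; ring_nf, mul_comm Complex.I (t : ℂ)]
  have := Complex.exp_ne_zero ((t : ℂ) * Complex.I)
  field_simp
  ring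

/-- The coefficients as integrals over a torus of coefficients in the last variable. -/
theorem coefficient_eq_integral_circleIntegral {F : (Fin (n + 1) → ℂ) → ℂ}
    {a : (Fin (n + 1) → ℕ) → ℂ} (ha : HasCoefficients F a) {w' : Fin n → ℂ} {ρ : ℝ} (hρ : 0 < ρ)
    (hF : AnalyticOnNhd ℂ F (polydisk (join w' ρ))) (c : Fin n → ℝ) (r : Fin (n + 1) → ℕ) :
    (2 * Real.pi : ℂ) ^ (n + 1) * Complex.I * (a r * monomial w' fun j => r j.castSucc) =
      ∫ θ, character (fun j => r j.castSucc) θ * (∮ t in C(0, ρ),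
        F (join (torusPoint w' θ) t) / t ^ (r (Fin.last n) + 1)) ∂cubeMeasure c := by
  have hρ' : (ρ : ℂ) ≠ 0 := by exact_mod_cast hρ.ne'
  -- The last angle starts at `0` to match the parametrization of `circleIntegral`; the other
  -- starting points remain free.
  set c' : Fin (n + 1) → ℝ := Fin.snoc (α := fun _ => ℝ) c 0 with hc'
  have h1 := integral_torusPoint_eq ha hF c' r
  have hcont : Continuous fun θ => F (torusPoint (join w' ρ) θ) * character r θ :=
    (continuous_iff_continuousAt.2 fun θ => ContinuousAt.comp
      (hF _ (torusPoint_mem_polydisk _ θ)).continuousAt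
      (continuous_torusPoint _).continuousAt).mul (continuous_character r)
  obtain ⟨B, hB⟩ := (isCompact_polydisk (join w' (ρ : ℂ))).exists_bound_of_continuousOn
    hF.continuousOn
  rw [integral_cubeMeasure_succ (Integrable.of_bound hcont.aestronglyMeasurable B
    (.of_forall fun θ => by
      rw [norm_mul, norm_character, mul_one]
      exact hB _ (torusPoint_mem_polydisk _ θ)))] at h1
  have h2 : ∀ (θ : Fin n → ℝ) (t : ℝ), torusPoint (join w' ρ) (Fin.snoc (α := fun _ => ℝ) θ t) =
      join (torusPoint w' θ) (ρ * Complex.exp (Complex.I * t)) := by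
    intro θ t
    ext j
    refine Fin.lastCases ?_ (fun j => ?_) j <;> simp [torusPoint]
  have h3 : ∀ (θ : Fin n → ℝ) (t : ℝ), character r (Fin.snoc (α := fun _ => ℝ) θ t) =
      character (fun j => r j.castSucc) θ * Complex.exp (-(Complex.I * r (Fin.last n) * t)) := by
    intro θ t
    simp [character, Fin.prod_univ_castSucc]
  have h4 : monomial (join w' (ρ : ℂ)) r = monomial w' (fun j => r j.castSucc) *
      (ρ : ℂ) ^ r (Fin.last n) := by
    simp [monomial, Fin.prod_univ_castSucc]
  have h5 : (fun j : Fin n => c' j.castSucc) = c := by ext j; simp [hc']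
  have h6 : c' (Fin.last n) = 0 := by simp [hc']
  simp only [h2, h3, h4, h5, h6] at h1
  have h7 : ∀ θ : Fin n → ℝ, character (fun j => r j.castSucc) θ * (∮ t in C(0, ρ),
        F (join (torusPoint w' θ) t) / t ^ (r (Fin.last n) + 1)) =
      Complex.I * ((ρ : ℂ) ^ r (Fin.last n))⁻¹ * ∫ t in Set.Ioc 0 (0 + 2 * Real.pi),
        F (join (torusPoint w' θ) (ρ * Complex.exp (Complex.I * t))) *
        (character (fun j => r j.castSucc) θ *
          Complex.exp (-(Complex.I * r (Fin.last n) * t))) := by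
    intro θ
    rw [circleIntegral_div_pow (fun t => F (join (torusPoint w' θ) t)) hρ, mul_left_comm]
    congr 1
    rw [← integral_const_mul]
    exact integral_congr_ae (.of_forall fun t => by simp only; ring)
  simp only [h7]
  rw [integral_const_mul, h1]
  field_simp

/-! ### Circle integrals of a function with one simple pole -/

/-- A recursion in the exponent from `(t - g)⁻¹ t⁻¹ = g⁻¹ ((t - g)⁻¹ - t⁻¹)`. The pole lies outside
the circle, so the integral without a power of `t` is zero, and among the powers `t ^ (-(m + 1))`
only `t⁻¹` contributes. -/
theorem circleIntegral_inv_pow_mul {g : ℂ} {ρ : ℝ} (hρ : 0 < ρ) (hg : ρ < ‖g‖) (k : ℕ) :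
    (∮ t in C(0, ρ), (t - g)⁻¹ / t ^ (k + 1)) = -(2 * Real.pi * Complex.I) * (g ^ (k + 1))⁻¹ := by
  have hg0 : g ≠ 0 := norm_pos_iff.1 (hρ.trans hg)
  have hne : ∀ t ∈ sphere (0 : ℂ) ρ, t ≠ 0 ∧ t - g ≠ 0 := fun t ht => by
    have ht' : ‖t‖ = ρ := by simpa using ht
    exact ⟨norm_pos_iff.1 (ht' ▸ hρ), sub_ne_zero.2 fun h => by rw [h] at ht'; linarith⟩
  have hci : ∀ m : ℕ, CircleIntegrable (fun t => (t - g)⁻¹ / t ^ m) 0 ρ := fun m =>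
    ContinuousOn.circleIntegrable hρ.le fun t ht => ContinuousAt.continuousWithinAt
      (ContinuousAt.div (ContinuousAt.inv₀ (f := fun t => t - g) (by fun_prop) (hne t ht).2)
        (continuous_pow m).continuousAt (pow_ne_zero _ (hne t ht).1))
  have hstep : ∀ m : ℕ, (∮ t in C(0, ρ), (t - g)⁻¹ / t ^ (m + 1)) =
      g⁻¹ * ((∮ t in C(0, ρ), (t - g)⁻¹ / t ^ m) - ∮ t in C(0, ρ), (t ^ (m + 1))⁻¹) := by
    intro m
    have hci2 : CircleIntegrable (fun t => (t ^ (m + 1))⁻¹) 0 ρ :=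
      ContinuousOn.circleIntegrable hρ.le fun t ht => ContinuousAt.continuousWithinAt
        ((continuous_pow (m + 1)).continuousAt.inv₀ (pow_ne_zero _ (hne t ht).1))
    rw [← circleIntegral.integral_sub (hci m) hci2, ← smul_eq_mul, ← circleIntegral.integral_smul]
    refine circleIntegral.integral_congr hρ.le fun t ht => ?_
    obtain ⟨h1, h2⟩ := hne t ht
    simp only [smul_eq_mul]
    field_simp
    ring
  have hzero : (∮ t in C(0, ρ), (t - g)⁻¹ / t ^ 0) = 0 := by
    refine Complex.circleIntegral_eq_zero_of_differentiable_on_off_countable hρ.le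
      Set.countable_empty (fun t ht => ?_) (fun t ht => ?_)
    · have : t - g ≠ 0 := sub_ne_zero.2 fun h => by
        have : ‖t‖ ≤ ρ := by simpa using ht
        rw [h] at this; linarith
      exact ContinuousAt.continuousWithinAt (by
        simpa using ContinuousAt.fun_inv₀ (f := fun t => t - g) (by fun_prop) this)
    · have : t - g ≠ 0 := sub_ne_zero.2 fun h => by
        have : ‖t‖ < ρ := by simpa using ht.1
        rw [h] at this; linarith
      simpa using DifferentiableAt.fun_inv (𝕜 := ℂ) (h := fun t => t - g) (by fun_prop) this
  induction k with
  | zero =>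
    rw [hstep, hzero]
    have := circleIntegral.integral_sub_center_inv (0 : ℂ) hρ.ne'
    simp only [sub_zero] at this
    simp only [zero_add, pow_one, this]
    ring
  | succ k ih =>
    rw [hstep, ih]
    have : (∮ t in C(0, ρ), (t ^ (k + 1 + 1))⁻¹) = 0 := by
      have := circleIntegral.integral_sub_zpow_of_ne (n := -(k + 1 + 1 : ℕ)) (by omega) 0 0 ρ
      refine Eq.trans (circleIntegral.integral_congr hρ.le fun t _ => ?_) this
      rw [sub_zero, zpow_neg, zpow_natCast]
    rw [this, pow_succ g (k + 1)]
    field_simp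
    ring

theorem circleIntegral_div_pow_eq {φ : ℂ → ℂ} {ρ R : ℝ} (hρ : 0 < ρ) (hR : ρ ≤ R)
    (hφ : ∀ t ∈ closedBall (0 : ℂ) R, DifferentiableAt ℂ φ t) (k : ℕ) :
    (∮ t in C(0, ρ), φ t / t ^ (k + 1)) = ∮ t in C(0, R), φ t / t ^ (k + 1) := by
  have hne : ∀ t, t ∉ ball (0 : ℂ) ρ → t ≠ 0 := fun t ht h => ht (h ▸ mem_ball_self hρ)
  refine (Complex.circleIntegral_eq_of_differentiable_on_annulus_off_countable hρ hR
    Set.countable_empty (fun t ht => ?_) (fun t ht => ?_)).symm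
  · exact ((hφ t ht.1).continuousAt.div (continuous_pow (k + 1)).continuousAt
      (pow_ne_zero _ (hne t ht.2))).continuousWithinAt
  · exact (hφ t (ball_subset_closedBall ht.1.1)).fun_div (by fun_prop)
      (pow_ne_zero _ (hne t fun h => ht.1.2 (ball_subset_closedBall h)))

/-- Without a pole in the way, the contour can be pushed from `ρ` to `R`, where the kernel is as
small as `R ^ (-k - 1)`. -/
theorem norm_circleIntegral_div_pow_le {φ : ℂ → ℂ} {ρ R B : ℝ} (hρ : 0 < ρ) (hR : ρ ≤ R)
    (hφ : ∀ t ∈ closedBall (0 : ℂ) R, DifferentiableAt ℂ φ t)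
    (hB : ∀ t ∈ sphere (0 : ℂ) R, ‖φ t‖ ≤ B) (k : ℕ) :
    ‖∮ t in C(0, ρ), φ t / t ^ (k + 1)‖ ≤ 2 * Real.pi * B * (R ^ k)⁻¹ := by
  have hR0 : 0 < R := hρ.trans_le hR
  rw [circleIntegral_div_pow_eq hρ hR hφ]
  refine (circleIntegral.norm_integral_le_of_norm_le_const (C := B * (R ^ (k + 1))⁻¹) hR0.le
    fun t ht => ?_).trans_eq ?_
  · have ht' : ‖t‖ = R := by simpa using ht
    rw [norm_div, norm_pow, ht', div_eq_mul_inv]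
    exact mul_le_mul_of_nonneg_right (hB t ht) (by positivity)
  · rw [pow_succ]
    field_simp

/-- A quotient with a single simple pole `g` in the closed disk is, up to an error that is
exponentially smaller, determined by its residue. -/
theorem norm_circleIntegral_quotient_sub_le {G H : ℂ → ℂ} {g : ℂ} {ρ R B : ℝ} (hρ : 0 < ρ)
    (hρg : ρ < ‖g‖) (hgR : ‖g‖ < R) (hG : ∀ t ∈ closedBall (0 : ℂ) R, AnalyticAt ℂ G t)
    (hH : ∀ t ∈ closedBall (0 : ℂ) R, AnalyticAt ℂ H t)
    (hzero : ∀ t ∈ closedBall (0 : ℂ) R, H t = 0 ↔ t = g) (hd : deriv H g ≠ 0)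
    (hB : ∀ t ∈ sphere (0 : ℂ) R, ‖G t / H t - G g / deriv H g * (t - g)⁻¹‖ ≤ B) (k : ℕ) :
    ‖(∮ t in C(0, ρ), G t / H t / t ^ (k + 1)) +
      2 * Real.pi * Complex.I * (G g / deriv H g) * (g ^ (k + 1))⁻¹‖ ≤
      2 * Real.pi * B * (R ^ k)⁻¹ := by
  have hgm : g ∈ closedBall (0 : ℂ) R := by simpa using hgR.le
  have hHg : H g = 0 := (hzero g hgm).2 rfl
  -- With `H = (t - g) K`, `K` has no zero in the disk and `M = G / K` is analytic with `M g` the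
  -- residue. Subtracting the polar part from `G / H` leaves the difference quotient of `M` at `g`,
  -- which is analytic on the whole disk.
  set K : ℂ → ℂ := dslope H g with hK
  have hKne : ∀ t ∈ closedBall (0 : ℂ) R, K t ≠ 0 := by
    intro t ht
    rcases eq_or_ne t g with rfl | h
    · rwa [hK, dslope_same]
    · rw [hK, dslope_of_ne _ h, slope_def_field, hHg, sub_zero]
      exact div_ne_zero (fun h' => h ((hzero t ht).1 h')) (sub_ne_zero.2 h)
  have hds : ∀ {f : ℂ → ℂ}, (∀ t ∈ closedBall (0 : ℂ) R, AnalyticAt ℂ f t) →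
      ∀ t ∈ closedBall (0 : ℂ) R, AnalyticAt ℂ (dslope f g) t := by
    intro f hf t ht
    rcases eq_or_ne t g with rfl | h
    · obtain ⟨p, hp⟩ := hf t ht
      exact hp.has_fpower_series_dslope_fslope.analyticAt
    · rw [Complex.analyticAt_iff_eventually_differentiableAt]
      filter_upwards [(hf t ht).eventually_analyticAt, eventually_ne_nhds h] with y hy hyg
      exact (differentiableAt_dslope_of_ne hyg).2 hy.differentiableAt
  have hKa := hds hH
  set M : ℂ → ℂ := fun t => G t / K t with hM
  have hMa : ∀ t ∈ closedBall (0 : ℂ) R, AnalyticAt ℂ M t := fun t ht =>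
    (hG t ht).fun_div (hKa t ht) (hKne t ht)
  have hMg : M g = G g / deriv H g := by simp only [hM, hK, dslope_same]
  have hquot : ∀ t ∈ closedBall (0 : ℂ) R, t ≠ g →
      G t / H t - G g / deriv H g * (t - g)⁻¹ = dslope M g t := by
    intro t ht h
    have h1 : t - g ≠ 0 := sub_ne_zero.2 h
    have h2 : H t = (t - g) * K t := by
      rw [hK, dslope_of_ne _ h, slope_def_field, hHg]; field_simp; ring
    have h3 := hKne t ht
    rw [dslope_of_ne _ h, slope_def_field, hMg, h2]
    simp only [hM]
    field_simp
  have hne : ∀ t ∈ sphere (0 : ℂ) ρ, t ≠ 0 ∧ t - g ≠ 0 ∧ t ∈ closedBall (0 : ℂ) R := fun t ht => by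
    have ht' : ‖t‖ = ρ := by simpa using ht
    refine ⟨norm_pos_iff.1 (ht' ▸ hρ), sub_ne_zero.2 fun h => by rw [h] at ht'; linarith, ?_⟩
    simp only [mem_closedBall_zero_iff]; linarith
  have hsplit : (∮ t in C(0, ρ), G t / H t / t ^ (k + 1)) =
      (∮ t in C(0, ρ), dslope M g t / t ^ (k + 1)) +
        G g / deriv H g * ∮ t in C(0, ρ), (t - g)⁻¹ / t ^ (k + 1) := by
    rw [← smul_eq_mul, ← circleIntegral.integral_smul, ← circleIntegral.integral_add]
    · refine circleIntegral.integral_congr hρ.le fun t ht => ?_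
      obtain ⟨h1, h2, h3⟩ := hne t ht
      simp only [smul_eq_mul]
      rw [← hquot t h3 (sub_ne_zero.1 h2)]
      ring
    · exact ContinuousOn.circleIntegrable hρ.le fun t ht => ContinuousAt.continuousWithinAt
        ((hds hMa t (hne t ht).2.2).continuousAt.div (continuous_pow (k + 1)).continuousAt (pow_ne_zero _ (hne t ht).1))
    · refine ContinuousOn.circleIntegrable hρ.le fun t ht => ContinuousAt.continuousWithinAt ?_
      have h : ContinuousAt (fun z => (z - g)⁻¹ / z ^ (k + 1)) t := ContinuousAt.div
        (ContinuousAt.fun_inv₀ (f := fun t => t - g) (by fun_prop) (hne t ht).2.1)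
        (continuous_pow (k + 1)).continuousAt (pow_ne_zero _ (hne t ht).1)
      exact (continuousAt_const (y := G g / deriv H g)).mul h
  rw [hsplit, circleIntegral_inv_pow_mul hρ hρg]
  have := norm_circleIntegral_div_pow_le hρ (hρg.trans hgR).le
    (fun t ht => (hds hMa t ht).differentiableAt) (B := B) (fun t ht => by
      have ht' : ‖t‖ = R := by simpa using ht
      rw [← hquot t (sphere_subset_closedBall ht) fun h => by rw [h] at ht'; linarith]
      exact hB t ht) k
  refine le_of_eq_of_le (congrArg _ ?_) this
  ring

end

section

/-! ### Uniform bounds for the inner circle integrals -/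

/-- The tube lemma for the compact disk over `w₀`: a property holding near every point of the disk
persists on a slightly larger disk, for all `w` near `w₀`. -/
theorem exists_radius_forall {P : (Fin n → ℂ) → ℂ → Prop} {w₀ : Fin n → ℂ} {R₀ : ℝ} (hR : 0 ≤ R₀)
    (h : ∀ t ∈ closedBall (0 : ℂ) R₀, ∀ᶠ p : (Fin n → ℂ) × ℂ in 𝓝 (w₀, t), P p.1 p.2) :
    ∃ R, R₀ < R ∧ ∀ᶠ w in 𝓝 w₀, ∀ t ∈ closedBall (0 : ℂ) R, P w t := by
  obtain ⟨u, v, hu, hv, h1u, hKv, huv⟩ := generalized_tube_lemma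
    (isCompact_closedBall (0 : ℂ) R₀) (isCompact_singleton (x := w₀))
    ((isOpen_setOfPred_eventually_nhds (p := fun p : (Fin n → ℂ) × ℂ => P p.1 p.2)).preimage
      continuous_swap)
    (fun p hp => by
      obtain ⟨h1, h2⟩ := hp
      rw [Set.mem_singleton_iff] at h2
      have := h p.1 h1
      rw [← h2] at this
      exact this)
  obtain ⟨ε, hε, hεu⟩ := (isCompact_closedBall (0 : ℂ) R₀).exists_thickening_subset_open hu h1u
  rw [thickening_closedBall hε hR] at hεu
  refine ⟨R₀ + ε / 2, by linarith, ?_⟩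
  filter_upwards [hv.mem_nhds (hKv rfl)] with w hw t ht
  have : (t, w) ∈ u ×ˢ v := ⟨hεu (by
    rw [mem_ball_zero_iff]; rw [mem_closedBall_zero_iff] at ht; linarith), hw⟩
  exact (huv this : ∀ᶠ q in 𝓝 (w, t), P q.1 q.2).self_of_nhds

theorem exists_bound_of_continuousAt {M : (Fin n → ℂ) → ℂ → ℂ} {w₀ : Fin n → ℂ} {K : Set ℂ}
    (hK : IsCompact K)
    (h : ∀ t ∈ K, ContinuousAt (fun p : (Fin n → ℂ) × ℂ => M p.1 p.2) (w₀, t)) :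
    ∃ B, ∀ᶠ w in 𝓝 w₀, ∀ t ∈ K, ‖M w t‖ ≤ B := by
  have hc : ContinuousOn (fun t => M w₀ t) K := fun t ht => ContinuousAt.continuousWithinAt
    (ContinuousAt.comp (f := fun t => (w₀, t)) (g := fun p : (Fin n → ℂ) × ℂ => M p.1 p.2) (h t ht)
      (by fun_prop))
  obtain ⟨B, hB⟩ := hK.exists_bound_of_continuousOn hc
  refine ⟨B + 1, hK.eventually_forall_of_forall_eventually fun t ht => ?_⟩
  exact ((h t ht).norm.eventually_lt_const (by have := hB t ht; simp only; linarith)).mono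
    fun _ => le_of_lt

theorem hasDerivAt_join (w : Fin n → ℂ) (t : ℂ) :
    HasDerivAt (fun t => join w t) (Pi.single (Fin.last n) 1) t := by
  rw [hasDerivAt_pi]
  refine Fin.lastCases ?_ (fun j => ?_)
  · simpa using hasDerivAt_id' t
  · simpa [Pi.single_apply, Fin.castSucc_ne_last] using hasDerivAt_const t (w j)

theorem deriv_comp_join {H : (Fin (n + 1) → ℂ) → ℂ} {w : Fin n → ℂ} {t : ℂ}
    (hH : DifferentiableAt ℂ H (join w t)) :
    deriv (fun t => H (join w t)) t = partialDeriv H (Fin.last n) (join w t) :=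
  (hH.hasFDerivAt.comp_hasDerivAt t (hasDerivAt_join w t)).deriv

theorem analyticAt_partialDeriv {m : ℕ} {H : (Fin m → ℂ) → ℂ} {w : Fin m → ℂ} (hH : AnalyticAt ℂ H w)
    (j : Fin m) : AnalyticAt ℂ (partialDeriv H j) w :=
  ((ContinuousLinearMap.apply ℂ ℂ (Pi.single j 1 : Fin m → ℂ)).analyticAt _).comp hH.fderiv

theorem analyticAt_slice {F : (Fin (n + 1) → ℂ) → ℂ} {w : Fin n → ℂ} {t : ℂ}
    (hF : AnalyticAt ℂ F (join w t)) : AnalyticAt ℂ (fun t => F (join w t)) t :=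
  AnalyticAt.comp (f := fun t => (w, t)) (analyticAt_comp_join (p := (w, t)) hF)
    (analyticAt_const.prod analyticAt_id)

theorem join_mem_polydisk {z : Fin (n + 1) → ℂ} {w : Fin n → ℂ} {t : ℂ}
    (hw : ∀ j, ‖w j‖ ≤ ‖z j.castSucc‖) (ht : ‖t‖ ≤ ‖z (Fin.last n)‖) : join w t ∈ polydisk z := by
  intro j
  refine Fin.lastCases ?_ (fun j => ?_) j <;> simp [hw, ht]

/-- The residue of `t ↦ G (w, t) / H (w, t)` at the pole `t = g w`. -/
def residue (G H : (Fin (n + 1) → ℂ) → ℂ) (g : (Fin n → ℂ) → ℂ) (w : Fin n → ℂ) : ℂ :=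
  G (join w (g w)) / partialDeriv H (Fin.last n) (join w (g w))

theorem analyticAt_comp_graph {F : (Fin (n + 1) → ℂ) → ℂ} {g : (Fin n → ℂ) → ℂ} {w : Fin n → ℂ}
    (hg : AnalyticAt ℂ g w) (hF : AnalyticAt ℂ F (join w (g w))) :
    AnalyticAt ℂ (fun w => F (join w (g w))) w :=
  AnalyticAt.comp (f := fun w => (w, g w)) (analyticAt_comp_join (p := (w, g w)) hF)
    (analyticAt_id.prod hg)

theorem analyticAt_residue {G H : (Fin (n + 1) → ℂ) → ℂ} {z : Fin (n + 1) → ℂ}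
    {g : (Fin n → ℂ) → ℂ} (hG : AnalyticAt ℂ G z) (hH : AnalyticAt ℂ H z)
    (hg : IsParametrization H z g) (hd : partialDeriv H (Fin.last n) z ≠ 0) :
    AnalyticAt ℂ (residue G H g) fun j => z j.castSucc := by
  have hz : join (fun j => z j.castSucc) (g fun j => z j.castSucc) = z := by
    rw [hg.2.1, join_init_self]
  exact AnalyticAt.div (analyticAt_comp_graph hg.1 (by rwa [hz]))
    (analyticAt_comp_graph hg.1 (analyticAt_partialDeriv (by rwa [hz]) _)) (by rwa [hz])

theorem exists_bound_of_analyticAt {F : (Fin (n + 1) → ℂ) → ℂ} {w₀ : Fin n → ℂ} {ρ R₀ : ℝ}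
    (hρ : 0 < ρ) (hρR : ρ ≤ R₀) (hF : ∀ t ∈ closedBall (0 : ℂ) R₀, AnalyticAt ℂ F (join w₀ t)) :
    ∃ R, R₀ < R ∧ ∃ B, ∀ᶠ w in 𝓝 w₀, ∀ k : ℕ,
      ‖∮ t in C(0, ρ), F (join w t) / t ^ (k + 1)‖ ≤ 2 * Real.pi * B * (R ^ k)⁻¹ := by
  obtain ⟨R, hR, h⟩ := exists_radius_forall (P := fun w t => AnalyticAt ℂ F (join w t)) (w₀ := w₀)
    (hρ.le.trans hρR) fun t ht => continuous_join.continuousAt.eventually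
      (hF t ht).eventually_analyticAt
  obtain ⟨B, hB⟩ := exists_bound_of_continuousAt (M := fun w t => F (join w t)) (w₀ := w₀)
    (isCompact_sphere (0 : ℂ) R) fun t ht =>
      (analyticAt_comp_join (h.self_of_nhds t (sphere_subset_closedBall ht))).continuousAt
  refine ⟨R, hR, B, ?_⟩
  filter_upwards [h, hB] with w hw hBw k
  exact norm_circleIntegral_div_pow_le hρ (hρR.trans hR.le)
    (fun t ht => (analyticAt_slice (hw t ht)).differentiableAt) hBw k

/-- By strict minimality `z_d` is the only zero of `H` over `z'` in the closed disk of radius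
`|z_d|`. For nearby `w` and a slightly larger disk the only zero is `g w`, so the quotient estimate
applies with uniform constants. -/
theorem exists_bound_of_isParametrization {G H : (Fin (n + 1) → ℂ) → ℂ} {z : Fin (n + 1) → ℂ}
    {g : (Fin n → ℂ) → ℂ} (hG : AnalyticOnNhd ℂ G (polydisk z)) (hH : AnalyticOnNhd ℂ H (polydisk z))
    (hV : ∀ w ∈ polydisk z, H w = 0 → w = z) (hg : IsParametrization H z g)
    (hd : partialDeriv H (Fin.last n) z ≠ 0) {ρ : ℝ} (hρ : 0 < ρ) (hρz : ρ < ‖z (Fin.last n)‖) :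
    ∃ R, ‖z (Fin.last n)‖ < R ∧ ∃ B, ∀ᶠ w in 𝓝 fun j => z j.castSucc, ∀ k : ℕ,
      ‖(∮ t in C(0, ρ), G (join w t) / H (join w t) / t ^ (k + 1)) +
        2 * Real.pi * Complex.I * residue G H g w * (g w ^ (k + 1))⁻¹‖ ≤
          2 * Real.pi * B * (R ^ k)⁻¹ := by
  set z' : Fin n → ℂ := fun j => z j.castSucc with hz'
  have hzj : join z' (z (Fin.last n)) = z := join_init_self z
  have hmem : ∀ t ∈ closedBall (0 : ℂ) ‖z (Fin.last n)‖, join z' t ∈ polydisk z := fun t ht =>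
    join_mem_polydisk (fun _ => le_rfl) (by simpa using ht)
  have hgc : ContinuousAt g z' := hg.1.continuousAt
  obtain ⟨R, hR, h⟩ := exists_radius_forall (w₀ := z') (R₀ := ‖z (Fin.last n)‖)
    (P := fun w t => (AnalyticAt ℂ G (join w t) ∧ AnalyticAt ℂ H (join w t)) ∧
      (H (join w t) = 0 ↔ t = g w)) (norm_nonneg _) fun t ht => by
    refine Eventually.and ((continuous_join.tendsto (z', t)).eventually
      ((hG _ (hmem t ht)).eventually_analyticAt.and (hH _ (hmem t ht)).eventually_analyticAt)) ?_
    -- At `t = z_d` the parametrization describes the zeros; at every other `t` both `H ≠ 0` and `t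
    -- ≠ g` persist by continuity.
    by_cases htz : t = z (Fin.last n)
    · have h1 : Tendsto (fun p : (Fin n → ℂ) × ℂ => join p.1 p.2) (𝓝 (z', t)) (𝓝 z) := by
        have := continuous_join.tendsto (z', t)
        rw [htz] at this ⊢
        rwa [hzj] at this
      filter_upwards [h1.eventually hg.2.2] with p hp
      simpa [variety] using hp
    · have h1 : H (join z' t) ≠ 0 := fun h0 => htz (by
        have := congrFun (hV _ (hmem t ht) h0) (Fin.last n)
        simpa using this)
      have h2 : ContinuousAt (fun p : (Fin n → ℂ) × ℂ => p.2 - g p.1) (z', t) :=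
        continuousAt_snd.sub (ContinuousAt.comp (f := Prod.fst) (x := (z', t)) (g := g) hgc continuousAt_fst)
      have h3 : z (Fin.last n) = g z' := hg.2.1.symm
      filter_upwards [(analyticAt_comp_join (p := (z', t)) (hH _ (hmem t ht))).continuousAt.eventually_ne
        h1, h2.eventually_ne (y := 0) (sub_ne_zero.2 (h3 ▸ htz))] with p hp1 hp2
      exact iff_of_false hp1 (sub_ne_zero.1 hp2)
  have hres := analyticAt_residue (hG z fun _ => le_rfl) (hH z fun _ => le_rfl) hg hd
  obtain ⟨B, hB⟩ := exists_bound_of_continuousAt (w₀ := z') (M := fun w t =>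
    G (join w t) / H (join w t) - residue G H g w * (t - g w)⁻¹) (isCompact_sphere (0 : ℂ) R)
    fun t ht => by
      have ht' : ‖t‖ = R := by simpa using ht
      obtain ⟨⟨h1, h2⟩, h3⟩ := h.self_of_nhds t (sphere_subset_closedBall ht)
      have hne : t ≠ g z' := fun h0 => by
        rw [h0, hg.2.1] at ht'; linarith
      have h4 : ContinuousAt (fun p : (Fin n → ℂ) × ℂ => residue G H g p.1) (z', t) :=
        ContinuousAt.comp (f := Prod.fst) (x := (z', t)) (g := residue G H g) hres.continuousAt
          continuousAt_fst
      have h5 : ContinuousAt (fun p : (Fin n → ℂ) × ℂ => p.2 - g p.1) (z', t) :=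
        continuousAt_snd.sub (ContinuousAt.comp (f := Prod.fst) (x := (z', t)) (g := g) hgc continuousAt_fst)
      exact ((analyticAt_comp_join (p := (z', t)) h1).continuousAt.div
        (analyticAt_comp_join (p := (z', t)) h2).continuousAt fun h0 => hne (h3.1 h0)).sub
        (h4.mul (h5.inv₀ (sub_ne_zero.2 hne)))
  refine ⟨R, hR, B, ?_⟩
  have hgn : g z' = z (Fin.last n) := hg.2.1
  have hcd : ContinuousAt (fun w => partialDeriv H (Fin.last n) (join w (g w))) z' :=
    (analyticAt_comp_graph hg.1 (analyticAt_partialDeriv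
      (hH _ (by rw [hgn, hzj]; exact fun _ => le_rfl)) _)).continuousAt
  filter_upwards [h, hB, hgc.norm.eventually_const_lt (u := ρ) (by simpa only [hgn]),
    hgc.norm.eventually_lt_const (u := R) (by simpa only [hgn]),
    hcd.eventually_ne (y := 0) (by simpa only [hgn, hzj])] with w hw hBw h1 h2 h3 k
  have h4 : g w ∈ closedBall (0 : ℂ) R := by simpa using h2.le
  have h5 := deriv_comp_join (hw _ h4).1.2.differentiableAt
  have := norm_circleIntegral_quotient_sub_le (G := fun t => G (join w t)) (H := fun t => H (join w t))
    (g := g w) (B := B) hρ h1 h2 (fun t ht => (analyticAt_slice (hw t ht).1.1))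
    (fun t ht => (analyticAt_slice (hw t ht).1.2)) (fun t ht => (hw t ht).2) (by rwa [h5])
    (fun t ht => by rw [h5]; exact hBw t ht) k
  rwa [h5] at this

end

section

/-! ### Reduction of the coefficients to an oscillatory integral near the point -/

/-- Local bounds, each with its own `R > R₀`, are combined by compactness: take the smallest radius
and the largest constant. -/
theorem exists_bound_of_isCompact {F : (Fin (n + 1) → ℂ) → ℂ} {w' : Fin n → ℂ}
    {K : Set (Fin n → ℝ)} {ρ R₀ : ℝ} (hK : IsCompact K) (hρ : 0 < ρ) (hρR : ρ ≤ R₀)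
    (hF : ∀ θ ∈ K, ∀ t ∈ closedBall (0 : ℂ) R₀, AnalyticAt ℂ F (join (torusPoint w' θ) t)) :
    ∃ R, R₀ < R ∧ ∃ B, 0 ≤ B ∧ ∀ θ ∈ K, ∀ k : ℕ,
      ‖∮ t in C(0, ρ), F (join (torusPoint w' θ) t) / t ^ (k + 1)‖ ≤ B * (R ^ k)⁻¹ := by
  refine hK.induction_on (p := fun s => ∃ R, R₀ < R ∧ ∃ B, 0 ≤ B ∧ ∀ θ ∈ s, ∀ k : ℕ,
      ‖∮ t in C(0, ρ), F (join (torusPoint w' θ) t) / t ^ (k + 1)‖ ≤ B * (R ^ k)⁻¹)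
    ⟨R₀ + 1, by linarith, 0, le_rfl, by simp⟩ ?_ ?_ ?_
  · rintro s t hst ⟨R, hR, B, hB0, hB⟩
    exact ⟨R, hR, B, hB0, fun θ hθ => hB θ (hst hθ)⟩
  · rintro s t ⟨R, hR, B, hB0, hB⟩ ⟨R', hR', B', hB0', hB'⟩
    have hR0 : 0 < R := by linarith
    have hR0' : 0 < R' := by linarith
    have h0 : 0 < min R R' := lt_min hR0 hR0'
    refine ⟨min R R', lt_min hR hR', max B B', le_max_of_le_left hB0, ?_⟩
    rintro θ (hθ | hθ) k
    · refine (hB θ hθ k).trans ?_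
      gcongr
      exacts [le_max_left _ _, min_le_left _ _]
    · refine (hB' θ hθ k).trans ?_
      gcongr
      exacts [le_max_right _ _, min_le_right _ _]
  · intro θ hθ
    obtain ⟨R, hR, B, hB⟩ := exists_bound_of_analyticAt hρ hρR (hF θ hθ)
    have h1 := (continuous_torusPoint w').continuousAt.eventually hB
    refine ⟨_, mem_nhdsWithin_of_mem_nhds h1, R, hR, |2 * Real.pi * B|, abs_nonneg _,
      fun θ' hθ' k => (hθ' k).trans ?_⟩
    have : 0 < R := by linarith
    gcongr
    exact le_abs_self _

theorem continuous_circleIntegral_join {F : (Fin (n + 1) → ℂ) → ℂ} {w' : Fin n → ℂ} {ρ : ℝ}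
    (hρ : 0 < ρ) (hF : AnalyticOnNhd ℂ F (polydisk (join w' ρ))) (k : ℕ) :
    Continuous fun θ => ∮ t in C(0, ρ), F (join (torusPoint w' θ) t) / t ^ (k + 1) := by
  unfold circleIntegral
  refine intervalIntegral.continuous_parametric_intervalIntegral_of_continuous' ?_ _ _
  have h1 : Continuous fun p : (Fin n → ℝ) × ℝ => circleMap 0 ρ p.2 :=
    (continuous_circleMap 0 ρ).comp continuous_snd
  have h2 : Continuous fun p : (Fin n → ℝ) × ℝ =>
      F (join (torusPoint w' p.1) (circleMap 0 ρ p.2)) :=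
    continuous_iff_continuousAt.2 fun p => ContinuousAt.comp (g := F)
      (hF _ (join_mem_polydisk (by simp [norm_torusPoint_apply]) (by simp))).continuousAt
      (continuous_join.comp (((continuous_torusPoint w').comp continuous_fst).prodMk h1)).continuousAt
  simp only [deriv_circleMap]
  exact (h1.mul continuous_const).smul (h2.div (h1.pow _) fun p =>
    pow_ne_zero _ (circleMap_ne_center hρ.ne'))

theorem torusPoint_zero {m : ℕ} (w : Fin m → ℂ) : torusPoint w 0 = w := by
  ext j; simp [torusPoint]

theorem eq_zero_of_torusPoint_eq {m : ℕ} {w : Fin m → ℂ} (hw : ∀ j, w j ≠ 0) {θ : Fin m → ℝ}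
    (hθ : ∀ j, |θ j| ≤ Real.pi) (h : torusPoint w θ = w) : θ = 0 := by
  ext j
  have h1 := congrFun h j
  have h2 : Complex.exp (Complex.I * θ j) = 1 := by
    simpa [torusPoint, hw j] using h1
  obtain ⟨k, hk⟩ := Complex.exp_eq_one_iff.1 h2
  have h3 : (θ j : ℂ) = k * (2 * Real.pi) := by
    apply mul_left_cancel₀ Complex.I_ne_zero
    rw [hk]; ring
  have h4 : θ j = k * (2 * Real.pi) := by exact_mod_cast h3
  have h5 := hθ j
  rw [h4, abs_mul, abs_of_pos Real.two_pi_pos] at h5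
  have h6 : |(k : ℝ)| < 1 := by
    by_contra! h
    nlinarith [Real.pi_pos]
  have h7 : |k| < 1 := by exact_mod_cast h6
  rw [h4, Int.abs_lt_one_iff.1 h7]
  simp

theorem cubeMeasure_eq_restrict (c : Fin n → ℝ) :
    cubeMeasure c = volume.restrict (Set.univ.pi fun j => Set.Ioc (c j) (c j + 2 * Real.pi)) := by
  rw [cubeMeasure, volume_pi, Measure.restrict_pi_pi]

/-- Outside the ball in `θ` the inner function has no pole in the closed disk of radius `|z_d|`;
inside, it has exactly one simple pole there or just beyond. Either way the contour moves past
`|z_d|`, with a residue in the second case. The pole is outside the original circle, hence the plus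
sign before the residue integral. -/
theorem exists_coefficient_sub_integral_le {G H : (Fin (n + 1) → ℂ) → ℂ}
    {a : (Fin (n + 1) → ℕ) → ℂ} {z : Fin (n + 1) → ℂ} {g : (Fin n → ℂ) → ℂ}
    (hG : AnalyticOnNhd ℂ G (polydisk z)) (hH : AnalyticOnNhd ℂ H (polydisk z))
    (ha : HasCoefficients (fun w => G w / H w) a)
    (hV : ∀ w ∈ polydisk z, H w = 0 → w = z) (hg : IsParametrization H z g)
    (hd : partialDeriv H (Fin.last n) z ≠ 0) (hz : ∀ j, z j ≠ 0) :
    ∃ r₀, 0 < r₀ ∧ ∀ δ, 0 < δ → δ ≤ r₀ → ∃ R, ‖z (Fin.last n)‖ < R ∧ ∃ B, 0 ≤ B ∧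
      ∀ r : Fin (n + 1) → ℕ,
      ‖(2 * Real.pi : ℂ) ^ n * (a r * monomial (fun j => z j.castSucc) fun j => r j.castSucc) +
        ∫ θ in closedBall 0 δ, character (fun j => r j.castSucc) θ *
          (residue G H g (torusMap z θ) * (g (torusMap z θ) ^ (r (Fin.last n) + 1))⁻¹)‖ ≤
        B * (R ^ r (Fin.last n))⁻¹ := by
  set z' : Fin n → ℂ := fun j => z j.castSucc with hz'
  have htm : torusMap z = torusPoint z' := rfl
  have hzd : 0 < ‖z (Fin.last n)‖ := norm_pos_iff.2 (hz _)
  -- A radius strictly below `|z_d|` keeps `z` out of the polydisk, so the quotient is analytic on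
  -- all of it.
  set ρ := ‖z (Fin.last n)‖ / 2 with hρ_def
  have hρ : 0 < ρ := half_pos hzd
  have hρz : ρ < ‖z (Fin.last n)‖ := half_lt_self hzd
  have hF : AnalyticOnNhd ℂ (fun w => G w / H w) (polydisk (join z' ρ)) := by
    intro w hw
    have h1 : ‖w (Fin.last n)‖ ≤ ρ := by simpa [abs_of_pos hρ] using hw (Fin.last n)
    have h2 : w ∈ polydisk z := fun j => by
      refine Fin.lastCases (h1.trans hρz.le) (fun j => ?_) j
      simpa using hw j.castSucc
    exact (hG w h2).div (hH w h2) fun h0 => by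
      rw [hV w h2 h0] at h1; linarith
  obtain ⟨R₁, hR₁, B₁, hB₁⟩ := exists_bound_of_isParametrization hG hH hV hg hd hρ hρz
  have hgn : g z' = z (Fin.last n) := hg.2.1
  have hev : ∀ᶠ θ in 𝓝 (0 : Fin n → ℝ), (∀ k : ℕ,
      ‖(∮ t in C(0, ρ), G (join (torusPoint z' θ) t) / H (join (torusPoint z' θ) t) / t ^ (k + 1)) +
        2 * Real.pi * Complex.I * residue G H g (torusPoint z' θ) * (g (torusPoint z' θ) ^ (k + 1))⁻¹‖ ≤
          2 * Real.pi * B₁ * (R₁ ^ k)⁻¹) ∧ AnalyticAt ℂ g (torusPoint z' θ) ∧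
      AnalyticAt ℂ (residue G H g) (torusPoint z' θ) ∧ g (torusPoint z' θ) ≠ 0 := by
    have h1 : Tendsto (torusPoint z') (𝓝 0) (𝓝 z') := by
      have := (continuous_torusPoint z').tendsto 0
      rwa [torusPoint_zero] at this
    exact h1.eventually (hB₁.and (hg.1.eventually_analyticAt.and
      ((analyticAt_residue (hG z fun _ => le_rfl) (hH z fun _ => le_rfl) hg hd).eventually_analyticAt.and
      (hg.1.continuousAt.eventually_ne (by rw [hg.2.1]; exact hz _)))))
  obtain ⟨r₁, hr₁, hr₁'⟩ := Metric.eventually_nhds_iff_ball.1 hev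
  -- The bound `1 < π` keeps the ball inside the cube of angles; halving `r₁` puts the closed ball
  -- inside the open one.
  refine ⟨min (r₁ / 2) 1, lt_min (half_pos hr₁) one_pos, fun δ hδ hδr => ?_⟩
  have hδ1 : δ < r₁ := (hδr.trans (min_le_left _ _)).trans_lt (half_lt_self hr₁)
  have hδπ : δ < Real.pi := (hδr.trans (min_le_right _ _)).trans_lt (by linarith [Real.pi_gt_three])
  have hball : ∀ θ ∈ closedBall (0 : Fin n → ℝ) δ, θ ∈ ball (0 : Fin n → ℝ) r₁ := fun θ hθ =>
    closedBall_subset_ball hδ1 hθ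
  have hK : IsCompact ((Set.univ.pi fun _ : Fin n => Set.Icc (-Real.pi) Real.pi) \ ball 0 δ) :=
    (isCompact_univ_pi fun _ => isCompact_Icc).diff isOpen_ball
  obtain ⟨R₂, hR₂, B₂, hB₂0, hB₂⟩ := exists_bound_of_isCompact (F := fun w => G w / H w) (w' := z')
    hK hρ hρz.le fun θ hθ t ht => by
      have h1 : join (torusPoint z' θ) t ∈ polydisk z :=
        join_mem_polydisk (fun j => (norm_torusPoint_apply _ _ _).le) (by simpa using ht)
      refine (hG _ h1).div (hH _ h1) fun h0 => hθ.2 ?_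
      have h2 : torusPoint z' θ = z' := by
        ext j
        have := congrFun (hV _ h1 h0) j.castSucc
        simpa using this
      rw [eq_zero_of_torusPoint_eq (fun j => hz _) (fun j => abs_le.2 (hθ.1 j trivial)) h2]
      exact mem_ball_self hδ
  set Q : Set (Fin n → ℝ) := Set.univ.pi fun _ => Set.Ioc (-Real.pi) (-Real.pi + 2 * Real.pi) with hQ
  have hQm : MeasurableSet Q := MeasurableSet.univ_pi fun _ => measurableSet_Ioc
  have hQK : Q \ closedBall 0 δ ⊆ (Set.univ.pi fun _ : Fin n => Set.Icc (-Real.pi) Real.pi) \ ball 0 δ :=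
    Set.sdiff_subset_sdiff (fun θ hθ j hj => ⟨(hθ j hj).1.le, by linarith [(hθ j hj).2]⟩)
      ball_subset_closedBall
  have hbQ : closedBall 0 δ ⊆ Q := fun θ hθ j _ => by
    have h1 : |θ j| ≤ δ := (norm_le_pi_norm θ j).trans (by simpa using hθ)
    have := abs_le.1 h1
    constructor <;> linarith
  have hQfin : volume Q < ⊤ := by
    have : IsFiniteMeasure (cubeMeasure fun _ : Fin n => -Real.pi) := inferInstance
    rw [cubeMeasure_eq_restrict] at this
    simpa using this.measure_univ_lt_top
  have hbfin : volume (closedBall (0 : Fin n → ℝ) δ) < ⊤ := (measure_mono hbQ).trans_lt hQfin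
  set R := min R₁ R₂ with hR
  have hRz : ‖z (Fin.last n)‖ < R := lt_min hR₁ hR₂
  have hR0 : 0 < R := hzd.trans hRz
  have hR₁0 : 0 < R₁ := hzd.trans hR₁
  have hR₂0 : 0 < R₂ := hzd.trans hR₂
  refine ⟨R, hRz, (|2 * Real.pi * B₁| * volume.real (closedBall (0 : Fin n → ℝ) δ) +
    B₂ * volume.real (Q \ closedBall 0 δ)) / (2 * Real.pi), by positivity, fun r => ?_⟩
  set φ : (Fin n → ℝ) → ℂ := fun θ => ∮ t in C(0, ρ),
    (G (join (torusPoint z' θ) t) / H (join (torusPoint z' θ) t)) / t ^ (r (Fin.last n) + 1) with hφ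
  set χ : (Fin n → ℝ) → ℂ := character fun j => r j.castSucc with hχ
  have hφc : Continuous φ := continuous_circleIntegral_join hρ hF _
  have hint : IntegrableOn (fun θ => χ θ * φ θ) Q := by
    have h1 : IntegrableOn (fun θ => χ θ * φ θ) (Set.univ.pi fun _ : Fin n => Set.Icc (-Real.pi) Real.pi) :=
      ((continuous_character _).mul hφc).continuousOn.integrableOn_compact
        (isCompact_univ_pi fun _ => isCompact_Icc)
    refine h1.mono_set fun θ hθ j hj => ⟨(hθ j hj).1.le, by linarith [(hθ j hj).2]⟩
  set ψ : (Fin n → ℝ) → ℂ := fun θ => residue G H g (torusMap z θ) *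
    (g (torusMap z θ) ^ (r (Fin.last n) + 1))⁻¹ with hψ
  have hψint : IntegrableOn (fun θ => χ θ * ψ θ) (closedBall 0 δ) := by
    refine ContinuousOn.integrableOn_compact (isCompact_closedBall _ _) fun θ hθ =>
      ContinuousAt.continuousWithinAt ?_
    obtain ⟨-, h1, h2, h3⟩ := hr₁' θ (hball θ hθ)
    have hc := (continuous_torusPoint z').continuousAt (x := θ)
    have h1' : ContinuousAt (fun θ => g (torusPoint z' θ)) θ :=
      ContinuousAt.comp (g := g) h1.continuousAt hc
    have h2' : ContinuousAt (fun θ => residue G H g (torusPoint z' θ)) θ :=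
      ContinuousAt.comp (g := residue G H g) h2.continuousAt hc
    exact (continuous_character _).continuousAt.mul
      (h2'.mul ((h1'.pow _).inv₀ (pow_ne_zero _ h3)))
  have hcoef := coefficient_eq_integral_circleIntegral ha hρ hF (fun _ => -Real.pi) r
  rw [cubeMeasure_eq_restrict] at hcoef
  change _ = ∫ θ in Q, χ θ * φ θ at hcoef
  have hsplit : ∫ θ in Q, χ θ * φ θ =
      (∫ θ in closedBall 0 δ, χ θ * φ θ) + ∫ θ in Q \ closedBall 0 δ, χ θ * φ θ := by
    rw [setIntegral_sdiff measurableSet_closedBall hint hbQ]; ring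
  -- The coefficient formula with its factor `(2π) ^ (n + 1) i` split as `2πi (2π) ^ n`, and the
  -- residue term added to both sides.
  have hmain : 2 * Real.pi * Complex.I * ((2 * Real.pi : ℂ) ^ n *
      (a r * monomial z' fun j => r j.castSucc) + ∫ θ in closedBall 0 δ, χ θ * ψ θ) =
      (∫ θ in closedBall 0 δ, χ θ * (φ θ + 2 * Real.pi * Complex.I * ψ θ)) +
        ∫ θ in Q \ closedBall 0 δ, χ θ * φ θ := by
    have h1 : ∫ θ in closedBall 0 δ, χ θ * (φ θ + 2 * Real.pi * Complex.I * ψ θ) =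
        (∫ θ in closedBall 0 δ, χ θ * φ θ) +
          2 * Real.pi * Complex.I * ∫ θ in closedBall 0 δ, χ θ * ψ θ := by
      rw [← integral_const_mul, ← integral_add (hint.mono_set hbQ) (hψint.const_mul _)]
      exact integral_congr_ae (.of_forall fun θ => by simp only; ring)
    rw [h1, mul_add, add_right_comm, ← hsplit, ← hcoef]
    ring
  have hb1 : ‖∫ θ in closedBall 0 δ, χ θ * (φ θ + 2 * Real.pi * Complex.I * ψ θ)‖ ≤
      |2 * Real.pi * B₁| * (R ^ r (Fin.last n))⁻¹ * volume.real (closedBall (0 : Fin n → ℝ) δ) := by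
    refine norm_setIntegral_le_of_norm_le_const hbfin fun θ hθ => ?_
    rw [norm_mul, hχ, norm_character, one_mul, hψ, ← mul_assoc]
    refine ((hr₁' θ (hball θ hθ)).1 (r (Fin.last n))).trans ?_
    gcongr
    exacts [le_abs_self _, min_le_left _ _]
  have hb2 : ‖∫ θ in Q \ closedBall 0 δ, χ θ * φ θ‖ ≤
      B₂ * (R ^ r (Fin.last n))⁻¹ * volume.real (Q \ closedBall 0 δ) := by
    refine norm_setIntegral_le_of_norm_le_const ((measure_mono Set.sdiff_subset).trans_lt hQfin)
      fun θ hθ => ?_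
    rw [norm_mul, hχ, norm_character, one_mul]
    refine (hB₂ θ (hQK hθ) (r (Fin.last n))).trans ?_
    gcongr
    exact min_le_right _ _
  have hnorm : ‖(2 * Real.pi * Complex.I : ℂ)‖ = 2 * Real.pi := by
    simp [abs_of_pos Real.pi_pos]
  have h3 := congrArg norm hmain
  rw [norm_mul, hnorm] at h3
  rw [div_mul_eq_mul_div, le_div_iff₀ Real.two_pi_pos, mul_comm, h3]
  refine (norm_add_le _ _).trans ((add_le_add hb1 hb2).trans (le_of_eq ?_))
  ring

end

section

/-! ### The phase and the amplitude -/

/-- The slope `z_j H_j / (z_d H_d)`. -/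
def slope (H : (Fin (n + 1) → ℂ) → ℂ) (z : Fin (n + 1) → ℂ) (j : Fin n) : ℂ :=
  (z j.castSucc * partialDeriv H j.castSucc z) /
    (z (Fin.last n) * partialDeriv H (Fin.last n) z)

/-- The extension of `torusMap` to complex arguments. -/
def complexTorusMap (z : Fin (n + 1) → ℂ) (Θ : Fin n → ℂ) : Fin n → ℂ :=
  fun j => z j.castSucc * Complex.exp (Complex.I * Θ j)

/-- The extension of `phase` to complex arguments. -/
def complexPhase (H : (Fin (n + 1) → ℂ) → ℂ) (z : Fin (n + 1) → ℂ) (Θ : Fin n → ℂ) : ℂ :=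
  Complex.log (parametrization H z (complexTorusMap z Θ) / parametrization H z (complexTorusMap z 0)) +
    Complex.I * ∑ j : Fin n, slope H z j * Θ j

/-- The amplitude of the oscillatory integral, for complex arguments. -/
def amplitude (G H : (Fin (n + 1) → ℂ) → ℂ) (z : Fin (n + 1) → ℂ) (Θ : Fin n → ℂ) : ℂ :=
  -(residue G H (parametrization H z) (complexTorusMap z Θ) /
    parametrization H z (complexTorusMap z Θ))

theorem complexTorusMap_coe (z : Fin (n + 1) → ℂ) (θ : Fin n → ℝ) :
    complexTorusMap z (fun j => (θ j : ℂ)) = torusMap z θ := rfl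

theorem complexTorusMap_zero (z : Fin (n + 1) → ℂ) :
    complexTorusMap z 0 = fun j => z j.castSucc := by
  ext j; simp [complexTorusMap]

theorem torusMap_zero (z : Fin (n + 1) → ℂ) : torusMap z 0 = fun j => z j.castSucc := by
  ext j; simp [torusMap]

theorem phase_eq_complexPhase (H : (Fin (n + 1) → ℂ) → ℂ) (z : Fin (n + 1) → ℂ) :
    phase H z = fun θ => complexPhase H z fun j => (θ j : ℂ) := by
  ext θ
  rw [complexPhase, complexTorusMap_coe, complexTorusMap_zero, ← torusMap_zero]
  rfl

theorem analyticAt_complexTorusMap (z : Fin (n + 1) → ℂ) (Θ : Fin n → ℂ) :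
    AnalyticAt ℂ (complexTorusMap z) Θ := by
  refine AnalyticAt.pi fun j => ?_
  exact analyticAt_const.mul (AnalyticAt.cexp (analyticAt_const.mul
    ((ContinuousLinearMap.proj (R := ℂ) (φ := fun _ : Fin n => ℂ) j).analyticAt Θ)))

theorem hasFDerivAt_complexTorusMap (z : Fin (n + 1) → ℂ) :
    HasFDerivAt (complexTorusMap z) (ContinuousLinearMap.pi fun j =>
      (z j.castSucc * Complex.I) • ContinuousLinearMap.proj (R := ℂ) (φ := fun _ : Fin n => ℂ) j) 0 := by
  rw [hasFDerivAt_pi]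
  intro j
  have h := ((((ContinuousLinearMap.proj (R := ℂ) (φ := fun _ : Fin n => ℂ) j).hasFDerivAt
    (x := 0)).const_mul Complex.I).cexp).const_mul (z j.castSucc)
  refine h.congr_fderiv ?_
  ext
  simp [mul_assoc]

section

variable {G H : (Fin (n + 1) → ℂ) → ℂ} {z : Fin (n + 1) → ℂ}

/-- Differentiate the identity `H (w, g w) = 0` at `z'`. -/
theorem fderiv_parametrization (hH : AnalyticAt ℂ H z) (hd : partialDeriv H (Fin.last n) z ≠ 0)
    {g : (Fin n → ℂ) → ℂ} (hg : IsParametrization H z g) (j : Fin n) :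
    fderiv ℂ g (fun j => z j.castSucc) (Pi.single j 1) =
      -(partialDeriv H j.castSucc z / partialDeriv H (Fin.last n) z) := by
  set z' : Fin n → ℂ := fun j => z j.castSucc with hz'
  have hgz : join z' (g z') = z := by rw [hg.2.1]; exact join_init_self z
  have hγ : HasFDerivAt (fun w => join w (g w))
      ((joinCLM n).comp ((ContinuousLinearMap.id ℂ (Fin n → ℂ)).prod (fderiv ℂ g z'))) z' := by
    have := (joinCLM n).hasFDerivAt.comp z'
      ((hasFDerivAt_id z').prodMk hg.1.differentiableAt.hasFDerivAt)
    refine this.congr_of_eventuallyEq (.of_forall fun w => ?_)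
    simp [joinCLM_apply]
  have h1 := HasFDerivAt.comp z' (f := fun w => join w (g w)) (g := H) (g' := fderiv ℂ H z)
    (by rw [hgz]; exact hH.differentiableAt.hasFDerivAt) hγ
  have h2 : (H ∘ fun w => join w (g w)) =ᶠ[𝓝 z'] fun _ => 0 := by
    have h3 := hγ.continuousAt.tendsto
    rw [hgz] at h3
    filter_upwards [h3.eventually hg.2.2] with w hw
    simpa [variety] using hw
  have h3 := (h1.congr_of_eventuallyEq h2.symm).unique (hasFDerivAt_const (0 : ℂ) z')
  have h4 := DFunLike.congr_fun h3 (Pi.single j 1)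
  have h5 : join (Pi.single j 1) (fderiv ℂ g z' (Pi.single j 1)) = (Pi.single j.castSucc 1 : Fin (n + 1) → ℂ) +
      fderiv ℂ g z' (Pi.single j 1) • Pi.single (Fin.last n) 1 := by
    ext i
    refine Fin.lastCases ?_ (fun i => ?_) i
    · simp
    · simp [Pi.single_apply]
  simp only [ContinuousLinearMap.comp_apply, ContinuousLinearMap.prod_apply, joinCLM_apply,
    ContinuousLinearMap.id_apply, h5, map_add, map_smul, _root_.zero_apply,
    smul_eq_mul] at h4
  rw [← neg_div, eq_div_iff hd, partialDeriv, partialDeriv]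
  linear_combination h4

theorem analyticAt_complexPhase (hH : AnalyticAt ℂ H z) (hz : z ∈ variety H)
    (hd : z (Fin.last n) * partialDeriv H (Fin.last n) z ≠ 0) :
    AnalyticAt ℂ (complexPhase H z) 0 := by
  have hg := isParametrization_parametrization hH hz (right_ne_zero_of_mul hd)
  refine AnalyticAt.add ?_ ?_
  · refine AnalyticAt.clog (AnalyticAt.div (AnalyticAt.comp (f := complexTorusMap z)
      (by rw [complexTorusMap_zero]; exact hg.1) (analyticAt_complexTorusMap z 0)) analyticAt_const ?_) ?_
    · rw [complexTorusMap_zero, hg.2.1]; exact left_ne_zero_of_mul hd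
    · rw [div_self]
      · exact Complex.one_mem_slitPlane
      · rw [complexTorusMap_zero, hg.2.1]; exact left_ne_zero_of_mul hd
  · refine analyticAt_const.mul (Finset.analyticAt_fun_sum _ fun j _ => analyticAt_const.mul
      ((ContinuousLinearMap.proj (R := ℂ) (φ := fun _ : Fin n => ℂ) j).analyticAt 0))

/-- The logarithmic derivative of `g` along the torus is `-i` times the slope, by
`fderiv_parametrization`; the linear term of the phase was chosen to cancel it. -/
theorem fderiv_complexPhase (hH : AnalyticAt ℂ H z) (hz : z ∈ variety H)
    (hd : z (Fin.last n) * partialDeriv H (Fin.last n) z ≠ 0) (j : Fin n) :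
    fderiv ℂ (complexPhase H z) 0 (Pi.single j 1) = 0 := by
  have hg := isParametrization_parametrization hH hz (right_ne_zero_of_mul hd)
  have hzd := left_ne_zero_of_mul hd
  have hHd := right_ne_zero_of_mul hd
  set g := parametrization H z with hg_def
  have h0 : g (complexTorusMap z 0) = z (Fin.last n) := by rw [complexTorusMap_zero, hg.2.1]
  have h1 : HasFDerivAt (fun Θ => g (complexTorusMap z Θ)) _ 0 :=
    HasFDerivAt.comp (f := complexTorusMap z) (g := g) 0
    (by rw [complexTorusMap_zero]; exact hg.1.differentiableAt.hasFDerivAt)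
    (hasFDerivAt_complexTorusMap z)
  have h2 : HasFDerivAt (fun Θ => g (complexTorusMap z Θ) / g (complexTorusMap z 0)) _ 0 :=
    h1.mul_const (g (complexTorusMap z 0))⁻¹
  have h3 := h2.clog (by
    rw [div_self (by rw [h0]; exact hzd)]; exact Complex.one_mem_slitPlane)
  have h4 : HasFDerivAt (fun Θ : Fin n → ℂ => ∑ j, slope H z j * Θ j)
      (∑ j, slope H z j • ContinuousLinearMap.proj (R := ℂ) (φ := fun _ : Fin n => ℂ) j) 0 :=
    HasFDerivAt.fun_sum fun j _ => ((ContinuousLinearMap.proj (R := ℂ)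
      (φ := fun _ : Fin n => ℂ) j).hasFDerivAt).const_mul _
  have h5 : HasFDerivAt (complexPhase H z) _ 0 := h3.add (h4.const_mul Complex.I)
  have h6 : (ContinuousLinearMap.pi fun j => (z j.castSucc * Complex.I) •
      ContinuousLinearMap.proj (R := ℂ) (φ := fun _ : Fin n => ℂ) j) (Pi.single j 1) =
      (z j.castSucc * Complex.I) • (Pi.single j 1 : Fin n → ℂ) := by
    ext i
    by_cases hij : i = j
    · subst hij; simp
    · simp [hij]
  rw [h5.fderiv]
  have h7 := fderiv_parametrization hH hHd hg j
  simp only [_root_.add_apply, _root_.smul_apply,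
    ContinuousLinearMap.comp_apply, h6, map_smul, h7, h0, _root_.sum_apply,
    ContinuousLinearMap.proj_apply, smul_eq_mul, Pi.single_apply, mul_ite, mul_one, mul_zero,
    Finset.sum_ite_eq', Finset.mem_univ, if_true, slope]
  field_simp
  ring

/-- If `z_j = 0`, the phase does not depend on `θ_j` and the Hessian has a zero column.
Nondegeneracy thus forces all coordinates to be nonzero, as needed for dividing by `z ^ r` and for
the torus map to be injective near `0`. -/
theorem castSucc_ne_zero_of_det_hessian_ne_zero (h : (hessian (phase H z) 0).det ≠ 0) (j : Fin n) :
    z j.castSucc ≠ 0 := by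
  intro hj
  refine h (Matrix.det_eq_zero_of_column_eq_zero j fun i => ?_)
  have h1 : ∀ (y : Fin n → ℝ) (s : ℝ), phase H z (y + s • Pi.single j 1) = phase H z y := by
    intro y s
    have h2 : torusMap z (y + s • Pi.single j 1) = torusMap z y := by
      ext i
      by_cases hij : i = j
      · subst hij; simp [torusMap, hj]
      · simp [torusMap, hij]
    rw [phase, phase, h2]
    congr 2
    refine Finset.sum_congr rfl fun i _ => ?_
    by_cases hij : i = j
    · subst hij; simp [hj]
    · simp [hij]
  have h2 : ∀ y, fderiv ℝ (phase H z) y (Pi.single j 1) = 0 := by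
    intro y
    -- Where the phase is not differentiable, `fderiv` is `0` by convention, so the conclusion holds
    -- at every point.
    by_cases hd : DifferentiableAt ℝ (phase H z) y
    · rw [← hd.lineDeriv_eq_fderiv, lineDeriv]
      simp only [h1, deriv_const]
    · simp [fderiv_zero_of_not_differentiableAt hd]
  simp only [hessian, Matrix.of_apply, h2]
  simp

end

end

/-! ### Positivity of the phase, vanishing of the amplitude, and directions -/

section

section

variable {G H : (Fin (n + 1) → ℂ) → ℂ} {z : Fin (n + 1) → ℂ}

theorem analyticAt_amplitude (hG : AnalyticAt ℂ G z) (hH : AnalyticAt ℂ H z) (hz : z ∈ variety H)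
    (hd : z (Fin.last n) * partialDeriv H (Fin.last n) z ≠ 0) :
    AnalyticAt ℂ (amplitude G H z) 0 := by
  have hg := isParametrization_parametrization hH hz (right_ne_zero_of_mul hd)
  refine (AnalyticAt.div ?_ ?_ ?_).neg
  · exact AnalyticAt.comp (f := complexTorusMap z)
      (by rw [complexTorusMap_zero]; exact analyticAt_residue hG hH hg (right_ne_zero_of_mul hd))
      (analyticAt_complexTorusMap z 0)
  · exact AnalyticAt.comp (f := complexTorusMap z)
      (by rw [complexTorusMap_zero]; exact hg.1) (analyticAt_complexTorusMap z 0)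
  · rw [complexTorusMap_zero, hg.2.1]; exact left_ne_zero_of_mul hd

theorem amplitude_zero (hH : AnalyticAt ℂ H z) (hz : z ∈ variety H)
    (hd : z (Fin.last n) * partialDeriv H (Fin.last n) z ≠ 0) :
    amplitude G H z 0 = G z / (-(z (Fin.last n) * partialDeriv H (Fin.last n) z)) := by
  have hg := isParametrization_parametrization hH hz (right_ne_zero_of_mul hd)
  rw [amplitude, complexTorusMap_zero, residue, hg.2.1, join_init_self, div_neg, div_div, mul_comm]

theorem complexPhase_zero (hH : AnalyticAt ℂ H z) (hz : z ∈ variety H)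
    (hd : z (Fin.last n) * partialDeriv H (Fin.last n) z ≠ 0) : complexPhase H z 0 = 0 := by
  have hg := isParametrization_parametrization hH hz (right_ne_zero_of_mul hd)
  rw [complexPhase, complexTorusMap_zero, hg.2.1, div_self (left_ne_zero_of_mul hd)]
  simp

/-- The amplitude is `G` along the graph of `g`, times a factor bounded near `0`. The graph lies in
`V` and its distance to `z` is `O(‖Θ‖)`, so the bound for `G` on `V` pulls back. -/
theorem isBigO_amplitude (hH : AnalyticAt ℂ H z) (hz : z ∈ variety H)
    (hd : z (Fin.last n) * partialDeriv H (Fin.last n) z ≠ 0) {l : ℕ}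
    (h : G =O[𝓝[variety H] z] fun w => ‖w - z‖ ^ l) :
    amplitude G H z =O[𝓝 0] fun Θ => ‖Θ‖ ^ l := by
  have hHd := right_ne_zero_of_mul hd
  have hzd := left_ne_zero_of_mul hd
  have hg := isParametrization_parametrization hH hz hHd
  set g := parametrization H z with hg_def
  set T := complexTorusMap z with hT
  have hT0 : T 0 = fun j => z j.castSucc := complexTorusMap_zero z
  have hgT : AnalyticAt ℂ (fun Θ => g (T Θ)) 0 := AnalyticAt.comp (f := T)
    (by rw [hT0]; exact hg.1) (analyticAt_complexTorusMap z 0)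
  have hγ0 : join (T 0) (g (T 0)) = z := by rw [hT0, hg.2.1, join_init_self]
  have hγ : DifferentiableAt ℂ (fun Θ => join (T Θ) (g (T Θ))) 0 := by
    have := (joinCLM n).differentiableAt.comp (0 : Fin n → ℂ)
      ((analyticAt_complexTorusMap z 0).differentiableAt.prodMk hgT.differentiableAt)
    refine this.congr_of_eventuallyEq (.of_forall fun w => ?_)
    simp [joinCLM_apply, hT]
  have h1 : Tendsto (fun Θ => join (T Θ) (g (T Θ))) (𝓝 0) (𝓝 z) := by
    have := hγ.continuousAt.tendsto
    rwa [hγ0] at this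
  have h2 : Tendsto (fun Θ => join (T Θ) (g (T Θ))) (𝓝 0) (𝓝[variety H] z) := by
    refine tendsto_nhdsWithin_iff.2 ⟨h1, ?_⟩
    filter_upwards [h1.eventually hg.2.2] with Θ hΘ
    exact hΘ.2 (by simp only [join_castSucc, join_last])
  have h3 : (fun Θ => G (join (T Θ) (g (T Θ)))) =O[𝓝 0] fun Θ => ‖Θ‖ ^ l := by
    refine (h.comp_tendsto h2).trans (IsBigO.pow (IsBigO.norm_norm ?_) l)
    have := hγ.isBigO_sub
    simpa only [hγ0, sub_zero] using this
  have h4 : ContinuousAt (fun Θ => -(partialDeriv H (Fin.last n) (join (T Θ) (g (T Θ))) *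
      g (T Θ))⁻¹) 0 := by
    refine (ContinuousAt.inv₀ (ContinuousAt.mul (ContinuousAt.comp (g := partialDeriv H (Fin.last n)) ?_
      hγ.continuousAt) hgT.continuousAt) ?_).neg
    · rw [hγ0]; exact (analyticAt_partialDeriv hH _).continuousAt
    · change partialDeriv H (Fin.last n) (join (T 0) (g (T 0))) * g (T 0) ≠ 0
      rw [hγ0, hT0, hg.2.1, mul_comm]
      exact hd
  have h5 := h3.mul (h4.tendsto.isBigO_one ℝ)
  refine h5.congr (fun Θ => ?_) fun Θ => by simp
  rw [amplitude, residue, div_div, mul_neg, div_eq_mul_inv]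

/-- With real slopes the linear term is purely imaginary, so the real part is `log (|g(M θ)| /
|z_d|)`. If it were not positive, the point of `V` above `M θ` would lie in the polydisk, hence
equal `z`, forcing `θ = 0`. -/
theorem eventually_re_phase_pos (hH : AnalyticAt ℂ H z)
    (hV : ∀ w ∈ polydisk z, H w = 0 → w = z) (hz : z ∈ variety H) (hz0 : ∀ j, z j ≠ 0)
    (hd : z (Fin.last n) * partialDeriv H (Fin.last n) z ≠ 0) (hs : ∀ j, (slope H z j).im = 0) :
    ∀ᶠ θ in 𝓝 0, θ ≠ 0 → 0 < (phase H z θ).re := by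
  have hg := isParametrization_parametrization hH hz (right_ne_zero_of_mul hd)
  set g := parametrization H z with hg_def
  have hT : Tendsto (torusMap z) (𝓝 0) (𝓝 fun j => z j.castSucc) := by
    have := (continuous_torusPoint fun j : Fin n => z j.castSucc).tendsto 0
    rwa [torusPoint_zero] at this
  have hγ : Tendsto (fun θ => join (torusMap z θ) (g (torusMap z θ))) (𝓝 0) (𝓝 z) := by
    have h1 := (continuous_join.tendsto (_, _)).comp (hT.prodMk_nhds (hg.1.continuousAt.tendsto.comp hT))
    simp only [hg.2.1, join_init_self] at h1
    exact h1
  have hπ : ∀ᶠ θ in 𝓝 (0 : Fin n → ℝ), ‖θ‖ < Real.pi :=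
    (continuous_norm.tendsto (0 : Fin n → ℝ)).eventually_lt_const (by simpa using Real.pi_pos)
  filter_upwards [hγ.eventually hg.2.2, hπ] with θ h1 h2 h3
  have h4 : H (join (torusMap z θ) (g (torusMap z θ))) = 0 := h1.2 (by
    simp only [join_castSucc, join_last])
  have hzd : 0 < ‖z (Fin.last n)‖ := norm_pos_iff.2 (hz0 _)
  have h5 : ‖z (Fin.last n)‖ < ‖g (torusMap z θ)‖ := by
    by_contra! h
    have h6 := hV _ (join_mem_polydisk (fun j =>
      (norm_torusPoint_apply (fun j : Fin n => z j.castSucc) θ j).le) h) h4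
    refine h3 (eq_zero_of_torusPoint_eq (w := fun j => z j.castSucc) (fun j => hz0 _)
      (fun j => (norm_le_pi_norm θ j).trans h2.le) ?_)
    ext j
    have := congrFun h6 j.castSucc
    simpa using this
  have h6 : (Complex.I * ∑ j : Fin n, slope H z j * (θ j : ℂ)).re = 0 := by
    simp [hs]
  rw [phase, Complex.add_re]
  change 0 < _ + (Complex.I * ∑ j : Fin n, slope H z j * (θ j : ℂ)).re
  rw [h6, add_zero, Complex.log_re, torusMap_zero, ← hg_def, hg.2.1, norm_div]
  exact Real.log_pos ((one_lt_div hzd).2 h5)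

theorem castSucc_eq_slope_mul_of_mem_dir (hd : z (Fin.last n) * partialDeriv H (Fin.last n) z ≠ 0)
    {r : Fin (n + 1) → ℕ} (hr : r ∈ dir H z) (j : Fin n) :
    (r j.castSucc : ℂ) = slope H z j * r (Fin.last n) := by
  obtain ⟨c, -, h⟩ := hr
  have h1 := left_ne_zero_of_mul hd
  have h2 := right_ne_zero_of_mul hd
  rw [h, h, slope]
  field_simp

theorem im_slope_of_mem_dir (hd : z (Fin.last n) * partialDeriv H (Fin.last n) z ≠ 0)
    {r : Fin (n + 1) → ℕ} (hr : r ∈ dir H z) (j : Fin n) : (slope H z j).im = 0 := by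
  have h1 := castSucc_eq_slope_mul_of_mem_dir hd hr j
  have h2 : (r (Fin.last n) : ℂ) ≠ 0 := by
    obtain ⟨c, hc, h⟩ := hr
    rw [h]; exact mul_ne_zero hc hd
  rw [← div_eq_iff h2] at h1
  rw [← h1]
  have : ((r j.castSucc : ℂ) / r (Fin.last n)) = ((r j.castSucc / r (Fin.last n) : ℝ) : ℂ) := by
    push_cast; rfl
  rw [this, Complex.ofReal_im]

/-- In `dir(z)` all entries are fixed multiples of the last one, so `r` is determined by `r_d` and
only finitely many `r` have `r_d` below a given bound. -/
theorem tendsto_last_dir (hd : z (Fin.last n) * partialDeriv H (Fin.last n) z ≠ 0) :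
    Tendsto (fun r : Fin (n + 1) → ℕ => (r (Fin.last n) : ℝ)) (cofinite ⊓ 𝓟 (dir H z)) atTop := by
  refine tendsto_natCast_atTop_atTop.comp (tendsto_atTop.2 fun b => ?_)
  rw [eventually_inf_principal, eventually_cofinite]
  refine Set.Finite.of_injOn (f := fun r : Fin (n + 1) → ℕ => r (Fin.last n)) (t := Set.Iio b) ?_ ?_
    (Set.finite_Iio b)
  · intro r hr
    rw [Set.mem_ofPred_eq] at hr
    push Not at hr
    exact hr.2
  · intro r hr s hs hrs
    rw [Set.mem_ofPred_eq] at hr hs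
    push Not at hr hs
    ext j
    refine Fin.lastCases hrs (fun j => ?_) j
    have h1 := castSucc_eq_slope_mul_of_mem_dir hd hr.1 j
    have h2 := castSucc_eq_slope_mul_of_mem_dir hd hs.1 j
    simp only at hrs
    rw [hrs, ← h2] at h1
    exact_mod_cast h1

/-- On `dir(z)` the character is `exp` of `-r_d` times the linear part of the phase. Since `r_d` is
an integer, `exp (-r_d log w) = w ^ (-r_d)` for nonzero `w`, with no ambiguity of branch. -/
theorem character_mul_residue_eq (hd : z (Fin.last n) * partialDeriv H (Fin.last n) z ≠ 0)
    (hH : AnalyticAt ℂ H z) (hz : z ∈ variety H)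
    {r : Fin (n + 1) → ℕ} (hr : r ∈ dir H z) {θ : Fin n → ℝ}
    (hθ : parametrization H z (torusMap z θ) ≠ 0) :
    character (fun j => r j.castSucc) θ * (residue G H (parametrization H z) (torusMap z θ) *
      (parametrization H z (torusMap z θ) ^ (r (Fin.last n) + 1))⁻¹) =
    -(z (Fin.last n) ^ r (Fin.last n))⁻¹ * (amplitude G H z (fun j => (θ j : ℂ)) *
      Complex.exp (-((r (Fin.last n) : ℝ) * phase H z θ))) := by
  have hg := isParametrization_parametrization hH hz (right_ne_zero_of_mul hd)
  have hzd := left_ne_zero_of_mul hd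
  have h1 : Complex.exp (-((r (Fin.last n) : ℝ) * phase H z θ)) =
      character (fun j => r j.castSucc) θ *
        ((parametrization H z (torusMap z θ) / z (Fin.last n)) ^ r (Fin.last n))⁻¹ := by
    have h2 : -(((r (Fin.last n) : ℝ) : ℂ) * phase H z θ) =
        (∑ j, -(Complex.I * r j.castSucc * θ j)) + -(r (Fin.last n) *
          Complex.log (parametrization H z (torusMap z θ) / z (Fin.last n))) := by
      rw [phase, torusMap_zero, hg.2.1, mul_add, neg_add_rev, mul_left_comm, Finset.mul_sum,
        Finset.sum_neg_distrib, Finset.mul_sum, Complex.ofReal_natCast]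
      congr 2
      refine Finset.sum_congr rfl fun j _ => ?_
      rw [castSucc_eq_slope_mul_of_mem_dir hd hr j, slope]
      ring
    rw [h2, Complex.exp_add, Complex.exp_sum, Complex.exp_neg, Complex.exp_nat_mul,
      Complex.exp_log (div_ne_zero hθ hzd)]
    rfl
  rw [h1, amplitude, complexTorusMap_coe, div_pow, pow_succ]
  field_simp

end

end

section

/-! ### The asymptotic expansion -/

/-- The coefficients, indexed by half-integer orders, of an expansion in integer powers multiplied
by a Gaussian factor `√(2π) ^ n`. -/
def interleave (n : ℕ) (c : ℕ → ℂ) (l : ℕ) : ℂ :=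
  if Even l then (((2 * Real.pi) ^ ((n : ℝ) / 2) : ℝ) : ℂ) * c (l / 2) else 0

theorem sqrt_div_pow_eq {L : ℝ} (hL : 0 < L) (n : ℕ) :
    √(2 * Real.pi / L) ^ n = (2 * Real.pi) ^ ((n : ℝ) / 2) * L ^ (-((n : ℝ) / 2)) := by
  rw [Real.sqrt_eq_rpow, ← Real.rpow_mul_natCast (by positivity), Real.div_rpow (by positivity) hL.le,
    Real.rpow_neg hL.le, div_eq_mul_inv, one_div_mul_eq_div]

theorem sum_interleave {L : ℝ} (hL : 0 < L) (n : ℕ) (c : ℕ → ℂ) (N : ℕ) :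
    ∑ l ∈ Finset.range (N + 1), interleave n c l *
      ((L ^ ((1 - ((n + 1 : ℕ) : ℝ) - (l : ℝ)) / 2) : ℝ) : ℂ) =
      ((√(2 * Real.pi / L) ^ n : ℝ) : ℂ) * ∑ k ∈ Finset.range (N / 2 + 1), c k * (L : ℂ)⁻¹ ^ k := by
  have h1 : ∀ M : ℕ, ∑ l ∈ Finset.range (2 * M), interleave n c l *
      ((L ^ ((1 - ((n + 1 : ℕ) : ℝ) - (l : ℝ)) / 2) : ℝ) : ℂ) =
      ((√(2 * Real.pi / L) ^ n : ℝ) : ℂ) * ∑ k ∈ Finset.range M, c k * (L : ℂ)⁻¹ ^ k := by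
    intro M
    induction M with
    | zero => simp
    | succ M ih =>
      have h2 : ¬ Even (2 * M + 1) := by simp
      have h3 : L ^ ((1 - ((n + 1 : ℕ) : ℝ) - ((2 * M : ℕ) : ℝ)) / 2) =
          L ^ (-((n : ℝ) / 2)) * L⁻¹ ^ M := by
        rw [← Real.rpow_natCast, Real.inv_rpow hL.le, ← Real.rpow_neg hL.le, ← Real.rpow_add hL]
        congr 1
        push_cast
        ring
      rw [mul_add, Finset.sum_range_succ, Finset.sum_range_succ, ih, Finset.sum_range_succ, mul_add,
        interleave, interleave, if_pos (even_two_mul M), if_neg h2, h3, sqrt_div_pow_eq hL,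
        Nat.mul_div_cancel_left _ two_pos]
      push_cast
      ring
  rw [← h1]
  refine Finset.sum_subset (Finset.range_subset_range.2 (by omega)) fun l h2 h3 => ?_
  rw [Finset.mem_range] at h2 h3
  have : ¬ Even l := by
    rw [Nat.even_iff]; omega
  rw [interleave, if_neg this, zero_mul]

theorem isLittleO_rpow_rpow_atTop {s t : ℝ} (hst : s < t) :
    (fun x : ℝ => x ^ s) =o[atTop] fun x : ℝ => x ^ t := by
  have h1 : (fun x : ℝ => x ^ (-(t - s))) =o[atTop] fun _ => (1 : ℝ) :=
    (isLittleO_one_iff ℝ).2 (tendsto_rpow_neg_atTop (sub_pos.2 hst))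
  refine ((isBigO_refl (fun x : ℝ => x ^ t) atTop).mul_isLittleO h1).congr' ?_
    (.of_forall fun x => mul_one _)
  filter_upwards [eventually_gt_atTop 0] with x hx
  rw [← Real.rpow_add hx]
  congr 1
  ring

theorem sub_sum_interleave_isLittleO {A : ℝ → ℂ} {c : ℕ → ℂ}
    (h : ∀ N, (fun L : ℝ => A L / ((√(2 * Real.pi / L) ^ n : ℝ) : ℂ) -
      ∑ k ∈ Finset.range N, c k * (L : ℂ)⁻¹ ^ k) =O[atTop] fun L => (L : ℂ)⁻¹ ^ N) (N : ℕ) :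
    (fun L : ℝ => A L - ∑ l ∈ Finset.range (N + 1), interleave n c l *
      ((L ^ ((1 - ((n + 1 : ℕ) : ℝ) - (l : ℝ)) / 2) : ℝ) : ℂ)) =o[atTop]
      fun L : ℝ => L ^ ((1 - ((n + 1 : ℕ) : ℝ) - (N : ℝ)) / 2) := by
  have h1 := (isBigO_refl (fun L : ℝ => ((√(2 * Real.pi / L) ^ n : ℝ) : ℂ)) atTop).mul (h (N / 2 + 1))
  have h2 : (fun L : ℝ => A L - ∑ l ∈ Finset.range (N + 1), interleave n c l *
      ((L ^ ((1 - ((n + 1 : ℕ) : ℝ) - (l : ℝ)) / 2) : ℝ) : ℂ)) =O[atTop]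
      fun L : ℝ => L ^ (-((n : ℝ) / 2) - ((N / 2 + 1 : ℕ) : ℝ)) := by
    refine (h1.congr' (g₁ := fun L : ℝ => ((√(2 * Real.pi / L) ^ n : ℝ) : ℂ) * (L : ℂ)⁻¹ ^ (N / 2 + 1)) ?_
      EventuallyEq.rfl).trans (IsBigO.of_bound ((2 * Real.pi) ^ ((n : ℝ) / 2)) ?_)
    · filter_upwards [eventually_gt_atTop 0] with L hL
      have h3 : ((√(2 * Real.pi / L) ^ n : ℝ) : ℂ) ≠ 0 := by
        have : 0 < √(2 * Real.pi / L) ^ n := by have := Real.pi_pos; positivity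
        exact_mod_cast this.ne'
      rw [sum_interleave hL, mul_sub, mul_div_cancel₀ _ h3]
    · filter_upwards [eventually_gt_atTop 0] with L hL
      rw [norm_mul, norm_pow, norm_inv, Complex.norm_real, Complex.norm_real, Real.norm_of_nonneg hL.le,
        Real.norm_of_nonneg (by positivity), Real.norm_of_nonneg (by positivity), sqrt_div_pow_eq hL,
        Real.rpow_sub hL, Real.rpow_natCast, mul_assoc, inv_pow,
        div_eq_mul_inv (L ^ (-((n : ℝ) / 2)))]
  -- Keeping `N / 2 + 1` integer powers leaves an error strictly smaller than the half-integer order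
  -- asked for, because `N < 2 * (N / 2 + 1)`.
  refine h2.trans_isLittleO (isLittleO_rpow_rpow_atTop ?_)
  have h3 : (N : ℝ) < 2 * ((N / 2 + 1 : ℕ) : ℝ) := by
    exact_mod_cast (by omega : N < 2 * (N / 2 + 1))
  push_cast at h3 ⊢
  linarith

theorem pow_isLittleO_rpow {q : ℝ} (hq0 : 0 < q) (hq1 : q < 1) (s : ℝ) :
    (fun k : ℕ => q ^ k) =o[atTop] fun k : ℕ => (k : ℝ) ^ s := by
  have h := (isLittleO_exp_neg_mul_rpow_atTop (neg_pos.2 (Real.log_neg hq0 hq1)) s).comp_tendsto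
    tendsto_natCast_atTop_atTop
  refine h.congr_left fun k => ?_
  simp only [Function.comp_apply, neg_neg]
  rw [mul_comm, Real.exp_nat_mul, Real.exp_log hq0]

section

variable {G H : (Fin (n + 1) → ℂ) → ℂ} {z : Fin (n + 1) → ℂ}

/-- The filter within `V` includes the point `z` itself; there a bound with `l > 0` reads `‖G z‖ ≤
0`. -/
theorem vanishingOrder_eq_zero (hz : z ∈ variety H) (hG : G z ≠ 0) : vanishingOrder G H z = 0 := by
  refine le_antisymm (iSup₂_le fun l hl => ?_) bot_le
  rw [Set.mem_ofPred_eq] at hl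
  by_contra h0
  have hl0 : l ≠ 0 := fun h => h0 (by simp [h])
  obtain ⟨C, hC⟩ := hl.bound
  have := hC.self_of_nhdsWithin hz
  simp [hl0] at this
  exact hG this

theorem exists_isBigO_of_lt_vanishingOrder {l : ℕ} (h : (l : ℕ∞) < vanishingOrder G H z) :
    ∃ m, l < m ∧ G =O[𝓝[variety H] z] fun w => ‖w - z‖ ^ m := by
  obtain ⟨m, hm⟩ := lt_iSup_iff.1 h
  obtain ⟨hm1, hm2⟩ := lt_iSup_iff.1 hm
  exact ⟨m, by exact_mod_cast hm2, hm1⟩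

end

end

/-! ### Assembling the expansion of the coefficients -/

section

section

variable {G H : (Fin (n + 1) → ℂ) → ℂ} {z : Fin (n + 1) → ℂ}

theorem monomial_eq_mul (w : Fin (n + 1) → ℂ) (r : Fin (n + 1) → ℕ) :
    monomial w r = (monomial (fun j => w j.castSucc) fun j => r j.castSucc) *
      w (Fin.last n) ^ r (Fin.last n) := by
  simp [monomial, Fin.prod_univ_castSucc]

theorem exists_coefficient_sub_laplace_le {a : (Fin (n + 1) → ℕ) → ℂ}
    (hG : AnalyticOnNhd ℂ G (polydisk z)) (hH : AnalyticOnNhd ℂ H (polydisk z))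
    (ha : HasCoefficients (fun w => G w / H w) a)
    (hV : ∀ w ∈ polydisk z, H w = 0 → w = z) (hz : z ∈ variety H) (hz0 : ∀ j, z j ≠ 0)
    (hd : z (Fin.last n) * partialDeriv H (Fin.last n) z ≠ 0) :
    ∃ r₀, 0 < r₀ ∧ ∀ δ, 0 < δ → δ ≤ r₀ → ∃ q, 0 < q ∧ q < 1 ∧ ∃ B, 0 ≤ B ∧ ∀ r ∈ dir H z,
      ‖a r * monomial z r - ((2 * Real.pi : ℂ) ^ n)⁻¹ * ∫ θ in closedBall 0 δ,
        amplitude G H z (fun j => (θ j : ℂ)) * Complex.exp (-((r (Fin.last n) : ℝ) * phase H z θ))‖ ≤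
        B * q ^ r (Fin.last n) := by
  have hHz := hH z fun _ => le_rfl
  have hg := isParametrization_parametrization hHz hz (right_ne_zero_of_mul hd)
  obtain ⟨r₁, hr₁, h1⟩ := exists_coefficient_sub_integral_le hG hH ha hV hg (right_ne_zero_of_mul hd) hz0
  have hT : Tendsto (torusMap z) (𝓝 0) (𝓝 fun j => z j.castSucc) := by
    have := (continuous_torusPoint fun j : Fin n => z j.castSucc).tendsto 0
    rwa [torusPoint_zero] at this
  have hne : ∀ᶠ θ in 𝓝 0, parametrization H z (torusMap z θ) ≠ 0 :=
    hT.eventually (hg.1.continuousAt.eventually_ne (by rw [hg.2.1]; exact hz0 _))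
  obtain ⟨r₂, hr₂, h2⟩ := Metric.eventually_nhds_iff_ball.1 hne
  refine ⟨min r₁ (r₂ / 2), lt_min hr₁ (half_pos hr₂), fun δ hδ hδr => ?_⟩
  obtain ⟨R, hR, B, hB0, hB⟩ := h1 δ hδ (hδr.trans (min_le_left _ _))
  have hzd : 0 < ‖z (Fin.last n)‖ := norm_pos_iff.2 (hz0 _)
  have hR0 : 0 < R := hzd.trans hR
  have hπ : (2 * Real.pi : ℂ) ^ n ≠ 0 := pow_ne_zero _ (by exact_mod_cast Real.two_pi_pos.ne')
  -- Normalizing by `z_d ^ r_d` turns the error `R ^ (-r_d)` into a geometric one with ratio `|z_d|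
  -- / R < 1`.
  refine ⟨‖z (Fin.last n)‖ / R, div_pos hzd hR0, (div_lt_one hR0).2 hR,
    ‖((2 * Real.pi : ℂ) ^ n)⁻¹‖ * B, by positivity, fun r hr => ?_⟩
  have h3 : ∫ θ in closedBall 0 δ, character (fun j => r j.castSucc) θ *
      (residue G H (parametrization H z) (torusMap z θ) *
        (parametrization H z (torusMap z θ) ^ (r (Fin.last n) + 1))⁻¹) =
      -(z (Fin.last n) ^ r (Fin.last n))⁻¹ * ∫ θ in closedBall 0 δ,
        amplitude G H z (fun j => (θ j : ℂ)) * Complex.exp (-((r (Fin.last n) : ℝ) * phase H z θ)) := by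
    rw [← integral_const_mul]
    refine setIntegral_congr_fun measurableSet_closedBall fun θ hθ =>
      character_mul_residue_eq hd hHz hz hr (h2 θ (closedBall_subset_ball ?_ hθ))
    exact (hδr.trans (min_le_right _ _)).trans_lt (half_lt_self hr₂)
  have h4 := hB r
  rw [h3] at h4
  set J := ∫ θ in closedBall 0 δ,
    amplitude G H z (fun j => (θ j : ℂ)) * Complex.exp (-((r (Fin.last n) : ℝ) * phase H z θ))
  have hzr : z (Fin.last n) ^ r (Fin.last n) ≠ 0 := pow_ne_zero _ (hz0 _)
  have h5 : a r * monomial z r - ((2 * Real.pi : ℂ) ^ n)⁻¹ * J = ((2 * Real.pi : ℂ) ^ n)⁻¹ *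
      (z (Fin.last n) ^ r (Fin.last n)) * ((2 * Real.pi : ℂ) ^ n *
        (a r * monomial (fun j => z j.castSucc) fun j => r j.castSucc) +
        -(z (Fin.last n) ^ r (Fin.last n))⁻¹ * J) := by
    rw [monomial_eq_mul]
    field_simp
    ring
  rw [h5, norm_mul, norm_mul, norm_pow, div_pow, mul_assoc, mul_assoc]
  refine mul_le_mul_of_nonneg_left ?_ (norm_nonneg _)
  refine (mul_le_mul_of_nonneg_left h4 (by positivity)).trans (le_of_eq ?_)
  rw [div_eq_mul_inv]
  ring

theorem exists_coefficient_expansion {a : (Fin (n + 1) → ℕ) → ℂ}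
    (hG : AnalyticOnNhd ℂ G (polydisk z)) (hH : AnalyticOnNhd ℂ H (polydisk z))
    (ha : HasCoefficients (fun w => G w / H w) a)
    (hV : ∀ w ∈ polydisk z, H w = 0 → w = z) (hz : z ∈ variety H)
    (hd : z (Fin.last n) * partialDeriv H (Fin.last n) z ≠ 0)
    (hhess : (hessian (phase H z) 0).det ≠ 0) (hs : ∀ j, (slope H z j).im = 0) :
    ∃ c : ℕ → ℂ, (∀ N : ℕ, (fun r : Fin (n + 1) → ℕ => a r - (monomial z r)⁻¹ *
        ∑ l ∈ Finset.range (N + 1), interleave n c l *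
          (((r (Fin.last n) : ℝ) ^ ((1 - ((n + 1 : ℕ) : ℝ) - (l : ℝ)) / 2) : ℝ) : ℂ))
        =o[cofinite ⊓ 𝓟 (dir H z)] (fun r : Fin (n + 1) → ℕ => (monomial z r)⁻¹ *
          (((r (Fin.last n) : ℝ) ^ ((1 - ((n + 1 : ℕ) : ℝ) - (N : ℝ)) / 2) : ℝ) : ℂ))) ∧
      c 0 = ((2 * Real.pi : ℂ) ^ n)⁻¹ * (invSqrtDet (hessian (phase H z) 0) *
        (G z / (-(z (Fin.last n) * partialDeriv H (Fin.last n) z)))) ∧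
      ∀ l : ℕ, (l : ℕ∞) < vanishingOrder G H z → interleave n c l = 0 := by
  have hHz := hH z fun _ => le_rfl
  have hGz := hG z fun _ => le_rfl
  have hz0 : ∀ j, z j ≠ 0 := Fin.lastCases (left_ne_zero_of_mul hd)
    fun j => castSucc_ne_zero_of_det_hessian_ne_zero hhess j
  have hΦ := analyticAt_complexPhase hHz hz hd
  have hΨ := analyticAt_amplitude hGz hHz hz hd
  have hphase := phase_eq_complexPhase H z
  obtain ⟨r₀, hr₀, hlap⟩ := exists_coefficient_sub_laplace_le hG hH ha hV hz hz0 hd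
  obtain ⟨δ, hδ, hδr, c, hc, hc0, hcv⟩ := exists_laplace_expansion (f := phase H z)
    (ψ := fun θ => amplitude G H z fun j => (θ j : ℂ))
    (by rw [hphase]; exact eventually_contDiffAt_restrict hΦ)
    (eventually_contDiffAt_restrict hΨ)
    (by rw [hphase]; exact complexPhase_zero hHz hz hd)
    (fun j => by
      rw [hphase, (coordDeriv_restrict hΦ j).self_of_nhds]
      exact fderiv_complexPhase hHz hz hd j) hhess
    (eventually_re_phase_pos hHz hV hz hz0 hd hs) hr₀
  obtain ⟨q, hq0, hq1, B, hB0, hB⟩ := hlap δ hδ hδr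
  set κ : ℂ := ((2 * Real.pi : ℂ) ^ n)⁻¹ with hκ
  set A : ℝ → ℂ := fun L => κ * ∫ θ in closedBall 0 δ,
    amplitude G H z (fun j => (θ j : ℂ)) * Complex.exp (-(L * phase H z θ)) with hA
  refine ⟨fun k => κ * c k, fun N => ?_, ?_, fun l hl => ?_⟩
  · have h1 := sub_sum_interleave_isLittleO (n := n) (A := A) (c := fun k => κ * c k) (fun M => by
      refine ((hc M).const_mul_left κ).congr_left fun L => ?_
      simp only [hA, mul_sub, Finset.mul_sum, mul_assoc, mul_div_assoc]) N
    have hlast := tendsto_last_dir hd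
    have h2 := h1.comp_tendsto hlast
    have hlast' : Tendsto (fun r : Fin (n + 1) → ℕ => r (Fin.last n)) (cofinite ⊓ 𝓟 (dir H z)) atTop :=
      tendsto_natCast_atTop_iff.1 hlast
    have h3 := (pow_isLittleO_rpow hq0 hq1 ((1 - ((n + 1 : ℕ) : ℝ) - (N : ℝ)) / 2)).comp_tendsto hlast'
    have h4 : (fun r : Fin (n + 1) → ℕ => a r * monomial z r - A (r (Fin.last n)))
        =O[cofinite ⊓ 𝓟 (dir H z)] fun r => q ^ r (Fin.last n) := by
      refine IsBigO.of_bound B (eventually_inf_principal.2 (.of_forall fun r hr => ?_))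
      rw [Real.norm_of_nonneg (by positivity)]
      exact hB r hr
    have h5 := (h4.trans_isLittleO h3).add h2
    have h6 := (isBigO_refl (fun r => (monomial z r)⁻¹) (cofinite ⊓ 𝓟 (dir H z))).mul_isLittleO
      (Complex.isLittleO_ofReal_right.2 h5)
    refine h6.congr_left fun r => ?_
    have hm : monomial z r ≠ 0 := Finset.prod_ne_zero_iff.2 fun j _ => pow_ne_zero _ (hz0 j)
    simp only [Function.comp_apply]
    field_simp
    ring
  · have : (fun j : Fin n => (((0 : Fin n → ℝ) j : ℝ) : ℂ)) = 0 := by ext j; simp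
    simp only [hc0, this, amplitude_zero hHz hz hd]
  · rw [interleave]
    split_ifs with he
    -- For `l` even and `l < m`, `2 * (l / 2) = l < m`, which is the condition for the Laplace
    -- coefficient of index `l / 2` to vanish.
    · obtain ⟨m, hlm, hm⟩ := exists_isBigO_of_lt_vanishingOrder hl
      rw [hcv m (vanishesAt_of_isBigO hΨ (isBigO_amplitude hHz hz hd hm)) (l / 2) (by omega)]
      simp
    · rfl

theorem two_pi_rpow_mul_inv_pow (n : ℕ) :
    (((2 * Real.pi) ^ ((n : ℝ) / 2) : ℝ) : ℂ) * ((2 * Real.pi : ℂ) ^ n)⁻¹ =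
      (((2 * Real.pi) ^ ((1 - ((n + 1 : ℕ) : ℝ)) / 2) : ℝ) : ℂ) := by
  have h : (2 * Real.pi) ^ ((n : ℝ) / 2) * ((2 * Real.pi) ^ n)⁻¹ =
      (2 * Real.pi) ^ ((1 - ((n + 1 : ℕ) : ℝ)) / 2) := by
    rw [← Real.rpow_natCast, ← Real.rpow_neg Real.two_pi_pos.le, ← Real.rpow_add Real.two_pi_pos]
    congr 1
    push_cast
    ring
  rw [← h]
  push_cast
  rfl

theorem IsStrictlyMinimal.eq_of_mem (h : IsStrictlyMinimal H z) : ∀ w ∈ polydisk z, H w = 0 → w = z := by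
  intro w hw hw0
  obtain ⟨x, hx⟩ := Set.encard_eq_one.1 h.2
  have h1 : w ∈ variety H ∩ polydisk z := ⟨hw0, hw⟩
  have h2 : z ∈ variety H ∩ polydisk z := ⟨h.1.1, fun _ => le_rfl⟩
  rw [hx] at h1 h2
  rw [Set.mem_singleton_iff.1 h1, Set.mem_singleton_iff.1 h2]

end

end

end

end SmoothPoint

theorem theorem3p3 {n : ℕ} (G H : (Fin (n + 1) → ℂ) → ℂ) (a : (Fin (n + 1) → ℕ) → ℂ)
    (z : Fin (n + 1) → ℂ)
    (hG : AnalyticOnNhd ℂ G (SmoothPoint.polydisk z))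
    (hH : AnalyticOnNhd ℂ H (SmoothPoint.polydisk z))
    (ha : SmoothPoint.HasCoefficients (fun w => G w / H w) a)
    (hmin : SmoothPoint.IsStrictlyMinimal H z)
    (hpole : SmoothPoint.IsSimplePole H z)
    (hd : z (Fin.last n) * SmoothPoint.partialDeriv H (Fin.last n) z ≠ 0)
    (hhess : (SmoothPoint.hessian (SmoothPoint.phase H z) 0).det ≠ 0) :
    ∃ C : ℕ → ℂ,
      (∀ N : ℕ,
        (fun r : Fin (n + 1) → ℕ => a r - (SmoothPoint.monomial z r)⁻¹ *
            ∑ l ∈ (Finset.range (N + 1)).filter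
                (fun l : ℕ => SmoothPoint.vanishingOrder G H z ≤ (l : ℕ∞)),
              C l * (((r (Fin.last n) : ℝ) ^ ((1 - ((n + 1 : ℕ) : ℝ) - (l : ℝ)) / 2) : ℝ) : ℂ))
          =o[cofinite ⊓ 𝓟 (SmoothPoint.dir H z)]
        (fun r : Fin (n + 1) → ℕ => (SmoothPoint.monomial z r)⁻¹ *
          (((r (Fin.last n) : ℝ) ^ ((1 - ((n + 1 : ℕ) : ℝ) - (N : ℝ)) / 2) : ℝ) : ℂ))) ∧
      (G z ≠ 0 →
        SmoothPoint.vanishingOrder G H z = 0 ∧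
        C 0 = (((2 * Real.pi) ^ ((1 - ((n + 1 : ℕ) : ℝ)) / 2) : ℝ) : ℂ) *
          SmoothPoint.invSqrtDet (SmoothPoint.hessian (SmoothPoint.phase H z) 0) *
          (G z / (-(z (Fin.last n) * SmoothPoint.partialDeriv H (Fin.last n) z)))) := by
  have hz := hpole.1
  have hV := hmin.eq_of_mem
  -- If no integer vector lies in `dir(z)`, the asymptotic claim is about the trivial filter, and
  -- the constants only have to give the prescribed value at `0`. Otherwise any `r` in `dir(z)`
  -- shows that the slopes are real, as the positivity of the phase requires.
  rcases (SmoothPoint.dir H z).eq_empty_or_nonempty with hempty | ⟨r, hr⟩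
  · refine ⟨fun _ => (((2 * Real.pi) ^ ((1 - ((n + 1 : ℕ) : ℝ)) / 2) : ℝ) : ℂ) *
      SmoothPoint.invSqrtDet (SmoothPoint.hessian (SmoothPoint.phase H z) 0) *
      (G z / (-(z (Fin.last n) * SmoothPoint.partialDeriv H (Fin.last n) z))), fun N => ?_,
      fun hGz => ⟨SmoothPoint.vanishingOrder_eq_zero hz hGz, rfl⟩⟩
    simp [hempty]
  obtain ⟨c, hc, hc0, hcv⟩ := SmoothPoint.exists_coefficient_expansion hG hH ha hV hz hd hhess
    fun j => SmoothPoint.im_slope_of_mem_dir hd hr j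
  refine ⟨SmoothPoint.interleave n c, fun N => ?_,
    fun hGz => ⟨SmoothPoint.vanishingOrder_eq_zero hz hGz, ?_⟩⟩
  · refine (hc N).congr_left fun r => ?_
    -- The terms below `l_0` have zero coefficients, so leaving them out does not change the sum.
    rw [Finset.sum_filter_of_ne]
    intro l _ hl
    by_contra h
    rw [hcv l (not_le.1 h), zero_mul] at hl
    exact hl rfl
  · rw [SmoothPoint.interleave, if_pos Even.zero, Nat.zero_div, hc0,
      ← SmoothPoint.two_pi_rpow_mul_inv_pow]
    ring
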